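/- **Setting.** Let $\beta,\eta\in\mathbb R$, $H=\frac{\eta}{2}(\sigma_3\otimes 1+1\otimes\sigma_3)\in M_4(\mathbb C)=M_2(\mathbb C)\otimes M_2(\mathbb C)$ and $\rho_\beta=e^{-\beta H}/\mathrm{Tr}\,e^{-\beta H}$. For $N\ge1$ let $\mathcal A_N=M_4(\mathbb C)^{\otimes N}$ be the algebra of the sites $0,\dots,N-1$ of a double spin-$1/2$ chain, $x^{(k)}$ the copy of $x\in M_4(\mathbb C)$ at site $k$, and $\omega_\beta(X)=\mathrm{Tr}(\rho_\beta^{\otimes N}X)$ the thermal product state. Let $$x_1=\sigma_1\otimes1,\; x_2=\sigma_2\otimes1,\; x_3=1\otimes\sigma_1,\; x_4=1\otimes\sigma_2,\; x_5=\sigma_1\otimes\sigma_3,\; x_6=\sigma_2\otimes\sigma_3,\; x_7=\sigma_3\otimes\sigma_1,\; x_8=\sigma_3\otimes\sigma_2 ,$$ $F_N(x)=N^{-1/2}\sum_{k=0}^{N-1}(x^{(k)}-\mathrm{Tr}(\rho_\beta x))$ and $W_N(r)=\exp\big(i\sum_{j=1}^8 r_jF_N(x_j)\big)$ for $r\in\mathbb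 R^8$. Put $\Sigma_{ij}=\frac12\mathrm{Tr}(\rho_\beta\{x_i,x_j\})$ and $\sigma_{ij}=-i\,\mathrm{Tr}(\rho_\beta[x_i,x_j])$. The fluctuation algebra $\mathcal W$ is the strong operator closure, in the GNS representation of $\Omega_\beta$, of the linear span of Weyl operators $W(r)$, $r\in\mathbb R^8$, with $W(r)^\dagger=W(-r)$ and $W(r)W(s)=e^{-\frac i2(r,\sigma s)}W(r+s)$; here $\Omega_\beta$ is the state with $\Omega_\beta(W(r))=e^{-\frac12(r,\Sigma r)}$. **Microscopic dynamics.** Let $h=h^\dagger\in M_4(\mathbb C)$, $v_1,\dots,v_d\in M_4(\mathbb C)$, let $D=[D_{\mu\nu}]$ be a positive semidefinite $d\times d$ matrix, and let $J_{k\ell}=J(|k-\ell|)$ with $J$ real-valued, $J(0)>0$, such that $[J_{k\ell}]_{k,\ell=0}^{N-1}$ is positive semidefinite for every $N$ and $\lim_{N\to\infty}\frac1N\sum_{k,\ell=0}^{N-1}|J_{k\ell}|$ exists and is finite. Let $\Phi^N_t=e^{t\mathbb L_N}$, $t\ge0$, on $\mathcal A_N$, where $$\mathbb L_N[X]=i\Big[\sum_{k=0}^{N-1}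 h^{(k)},X\Big]+\sum_{k,\ell=0}^{N-1}J_{k\ell}\sum_{\mu,\nu=1}^dD_{\mu\nu}\Big(v_\mu^{(k)}X(v_\nu^\dagger)^{(\ell)}-\tfrac12\big\{v_\mu^{(k)}(v_\nu^\dagger)^{(\ell)},X\big\}\Big).$$ Assume that $\omega_\beta\circ\Phi^N_t=\omega_\beta$ on $\mathcal A_N$ for all $N$ and $t\ge0$, and that there is a real $8\times8$ matrix $\mathcal L$ with $\mathbb L_N[x_j^{(k)}]=\sum_{p=1}^8\mathcal L_{jp}\,x_p^{(k)}$ for all $N$, all $0\le k\le N-1$ and all $j$. **Theorem.** There is a semigroup $\{\Phi_t\}_{t\ge0}$ ($\Phi_0=\mathrm{id}$, $\Phi_{s+t}=\Phi_s\circ\Phi_t$) of completely positive, unital linear maps on $\mathcal W$ such that for all $t\ge0$ and $a,b,r\in\mathbb R^8$ $$\lim_{N\to\infty}\omega_\beta\big(W_N(a)\,\Phi^N_t[W_N(r)]\,W_N(b)\big)=\Omega_\beta\big(W(a)\,\Phi_t[W(r)]\,W(b)\big).$$ The maps $\Phi_t$ are quasi-free: $$\Phi_t[W(r)]=e^{f_r(t)}\,W(r_t),\qquad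 r_t=e^{t\mathcal L^{tr}}r,\qquad f_r(t)=-\tfrac12\big(r,(\Sigma-e^{t\mathcal L}\Sigma e^{t\mathcal L^{tr}})\,r\big),$$ and $\Omega_\beta\circ\Phi_t=\Omega_\beta$ on $\mathcal W$. -/

import Mathlib

open scoped ComplexOrder Kronecker Topology

noncomputable section

namespace SpinFluct

/-! ### One lattice site of the double chain -/

/-- Basis labels of the one-site space `ℂ² ⊗ ℂ²` (first chain, second chain). -/
abbrev Site : Type := Fin 2 × Fin 2

/-- The one-site algebra `M₂(ℂ) ⊗ M₂(ℂ) = M₄(ℂ)`. -/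
abbrev SiteMat : Type := Matrix Site Site ℂ

def pauli1 : Matrix (Fin 2) (Fin 2) ℂ := !![0, 1; 1, 0]

def pauli2 : Matrix (Fin 2) (Fin 2) ℂ := !![0, -Complex.I; Complex.I, 0]

def pauli3 : Matrix (Fin 2) (Fin 2) ℂ := !![1, 0; 0, -1]

/-- The eight selected single-site observables `x₁, …, x₈`. -/
def chi : Fin 8 → SiteMat :=
  ![pauli1 ⊗ₖ 1, pauli2 ⊗ₖ 1, 1 ⊗ₖ pauli1, 1 ⊗ₖ pauli2,
    pauli1 ⊗ₖ pauli3, pauli2 ⊗ₖ pauli3, pauli3 ⊗ₖ pauli1, pauli3 ⊗ₖ pauli2]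

/-- The one-site Hamiltonian `(η/2) (σ₃ ⊗ 1 + 1 ⊗ σ₃)`. -/
def siteHam (η : ℝ) : SiteMat := ((η / 2 : ℝ) : ℂ) • (pauli3 ⊗ₖ 1 + 1 ⊗ₖ pauli3)

/-- The one-site Gibbs density matrix `e^{-βH} / Tr e^{-βH}`. -/
def rho (β η : ℝ) : SiteMat :=
  (NormedSpace.exp (-(β : ℂ) • siteHam η)).trace⁻¹ • NormedSpace.exp (-(β : ℂ) • siteHam η)

/-- The one-site expectation `ω_β(x) = Tr(ρ_β x)`. -/
def siteExp (β η : ℝ) (x : SiteMat) : ℂ := (rho β η * x).trace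

/-- The covariance matrix `Σ_{ij} = ½ Tr(ρ_β {x_i, x_j})`. -/
def covMat (β η : ℝ) : Matrix (Fin 8) (Fin 8) ℝ :=
  Matrix.of fun i j => ((1 / 2 : ℂ) * siteExp β η (chi i * chi j + chi j * chi i)).re

/-- The symplectic matrix `σ_{ij} = -i Tr(ρ_β [x_i, x_j])`. -/
def sympMat (β η : ℝ) : Matrix (Fin 8) (Fin 8) ℝ :=
  Matrix.of fun i j => (-Complex.I * siteExp β η (chi i * chi j - chi j * chi i)).re

/-! ### The local algebra of the sites `0, …, N-1` and its dissipative dynamics -/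

/-- The local algebra `𝒜_{[0,N-1]} = M₄(ℂ)^{⊗N}`, as matrices indexed by spin configurations. -/
abbrev LocalAlg (N : ℕ) : Type := Matrix (Fin N → Site) (Fin N → Site) ℂ

/-- The operator `x^{(k)}`: `x` at the site `k`, the identity at all other sites. -/
def siteOp {N : ℕ} (k : Fin N) (x : SiteMat) : LocalAlg N :=
  Matrix.of fun s s' => if ∀ j, j ≠ k → s j = s' j then x (s k) (s' k) else 0

/-- The density matrix `⨂_k ρ_β^{(k)}` of the local thermal state. -/
def localRho (β η : ℝ) (N : ℕ) : LocalAlg N :=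
  Matrix.of fun s s' => ∏ k, rho β η (s k) (s' k)

/-- The thermal product state `ω_β` on the local algebra. -/
def localState (β η : ℝ) (N : ℕ) (X : LocalAlg N) : ℂ := (localRho β η N * X).trace

/-- The local fluctuation `F_N(x) = N^{-1/2} ∑_k (x^{(k)} - ω_β(x))`. -/
def fluct (β η : ℝ) (N : ℕ) (x : SiteMat) : LocalAlg N :=
  ((Real.sqrt N)⁻¹ : ℂ) • ∑ k : Fin N, (siteOp k x - siteExp β η x • (1 : LocalAlg N))

/-- The local exponential `W_N(r) = exp(i ∑_j r_j F_N(x_j))`. -/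
def localWeyl (β η : ℝ) (N : ℕ) (r : Fin 8 → ℝ) : LocalAlg N :=
  NormedSpace.exp (Complex.I • ∑ j, (r j : ℂ) • fluct β η N (chi j))

/-- The site couplings `J_{kl} = J(|k-l|)`. -/
def couplings (J : ℕ → ℝ) (N : ℕ) : Matrix (Fin N) (Fin N) ℝ :=
  Matrix.of fun k l => J ((k : ℤ) - (l : ℤ)).natAbs

/-- The map `X ↦ A X B - ½ {A B, X}` on a local algebra. -/
def dissip {N : ℕ} (A B : LocalAlg N) : LocalAlg N →ₗ[ℂ] LocalAlg N :=
  LinearMap.mulLeft ℂ A ∘ₗ LinearMap.mulRight ℂ B -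
    (1 / 2 : ℂ) • (LinearMap.mulLeft ℂ (A * B) + LinearMap.mulRight ℂ (A * B))

lemma dissip_apply {N : ℕ} (A B X : LocalAlg N) :
    dissip A B X = A * X * B - (1 / 2 : ℂ) • (A * B * X + X * (A * B)) := by
  simp [dissip, mul_assoc]

/-- The local Lindblad generator (Heisenberg picture)
`𝕃_N[X] = i[H_N, X] + ∑_{k,l} J_{kl} ∑_{μ,ν} D_{μν} (v_μ^{(k)} X v_ν^{†(l)} - ½{v_μ^{(k)} v_ν^{†(l)}, X})`
with `H_N = ∑_k h^{(k)}`. -/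
def lindblad (N : ℕ) {d : ℕ} (J : ℕ → ℝ) (D : Matrix (Fin d) (Fin d) ℂ) (v : Fin d → SiteMat)
    (h : SiteMat) : LocalAlg N →ₗ[ℂ] LocalAlg N :=
  Complex.I • (LinearMap.mulLeft ℂ (∑ k, siteOp k h) - LinearMap.mulRight ℂ (∑ k, siteOp k h)) +
    ∑ k : Fin N, ∑ l : Fin N, (couplings J N k l : ℂ) • ∑ μ : Fin d, ∑ ν : Fin d,
      D μ ν • dissip (siteOp k (v μ)) (siteOp l (v ν).conjTranspose)

open scoped Matrix.Norms.L2Operator in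
/-- The local semigroup `Φ^N_t = e^{t 𝕃_N}`, for a linear map `𝕃` on the local algebra. -/
def semigroupOf {N : ℕ} (L : LocalAlg N →ₗ[ℂ] LocalAlg N) (t : ℝ) (X : LocalAlg N) : LocalAlg N :=
  (NormedSpace.exp ((t : ℂ) • LinearMap.toContinuousLinearMap L) :
    LocalAlg N →L[ℂ] LocalAlg N) X

/-! ### The Weyl algebra of fluctuations and the GNS representation of `Ω_β` -/

/-- The bilinear form `(r, M s) = ∑_{ij} r_i M_{ij} s_j`. -/
def form (M : Matrix (Fin 8) (Fin 8) ℝ) (r s : Fin 8 → ℝ) : ℝ := r ⬝ᵥ M.mulVec s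

/-- The value `Ω_β(W(r)) = exp(-½ (r, Σ r))`. -/
def weylVal (β η : ℝ) (r : Fin 8 → ℝ) : ℂ :=
  Complex.exp (((-(1 / 2) * form (covMat β η) r r : ℝ)) : ℂ)

/-- The phase in the Weyl relation `W(r) W(s) = e^{-(i/2)(r, σ s)} W(r + s)`. -/
def weylPhase (β η : ℝ) (r s : Fin 8 → ℝ) : ℂ :=
  Complex.exp (-(Complex.I / 2) * (form (sympMat β η) r s : ℂ))

/-- `Ω_β(W(r)† W(s)) = Ω_β(W(-r) W(s))`. -/
def weylKernel (β η : ℝ) : Matrix (Fin 8 → ℝ) (Fin 8 → ℝ) ℂ :=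
  Matrix.of fun r s => weylPhase β η (-r) s * weylVal β η (s - r)

/-- A kernel of the form `conj (f r) * f s` is positive semidefinite. -/
lemma posSemidef_rankOne {α : Type*} (f : α → ℂ) :
    (Matrix.of fun r s => star (f r) * f s : Matrix α α ℂ).PosSemidef := by
  refine ⟨?_, fun x => ?_⟩
  · ext r s
    simp [Matrix.conjTranspose_apply, mul_comm]
  · have : (x.sum fun i xi => x.sum fun j xj =>
        star xi * (Matrix.of fun r s => star (f r) * f s : Matrix α α ℂ) i j * xj) =
        star (x.sum fun i xi => f i * xi) * (x.sum fun i xi => f i * xi) := by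
      simp only [Finsupp.sum, star_sum, Finset.sum_mul_sum, Matrix.of_apply, star_mul']
      refine Finset.sum_congr rfl fun i _ => Finset.sum_congr rfl fun j _ => ?_
      ring
    rw [this]
    exact star_mul_self_nonneg _

/-- The entrywise exponential of a positive semidefinite kernel is positive semidefinite. -/
lemma posSemidef_exp {α : Type*} {A : Matrix α α ℂ} (hA : A.PosSemidef) :
    (Matrix.of fun r s => Complex.exp (A r s) : Matrix α α ℂ).PosSemidef := by
  have hpow : ∀ n : ℕ, (Matrix.of fun r s => A r s ^ n : Matrix α α ℂ).PosSemidef := by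
    intro n
    induction n with
    | zero => simpa using posSemidef_rankOne (fun _ : α => (1 : ℂ))
    | succ n ih =>
      have e : (Matrix.of fun r s => A r s ^ (n + 1) : Matrix α α ℂ) =
          (Matrix.of fun r s => A r s ^ n : Matrix α α ℂ).hadamard A := by
        ext r s
        simp [pow_succ]
      rw [e]
      exact ih.hadamard hA
  refine ⟨?_, fun x => ?_⟩
  · ext r s
    have := hA.isHermitian.apply r s
    simp only [Matrix.conjTranspose_apply, Matrix.of_apply, Complex.star_def] at this ⊢
    rw [← Complex.exp_conj, this]
  · have hs : HasSum (fun n : ℕ => x.sum fun i xi => x.sum fun j xj =>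
        star xi * ((n.factorial : ℂ)⁻¹ * A i j ^ n) * xj)
        (x.sum fun i xi => x.sum fun j xj =>
          star xi * (Matrix.of fun r s => Complex.exp (A r s) : Matrix α α ℂ) i j * xj) := by
      refine hasSum_sum fun i _ => hasSum_sum fun j _ => ?_
      refine HasSum.mul_right _ (HasSum.mul_left _ ?_)
      simpa [Complex.exp_eq_exp_ℂ, smul_eq_mul] using NormedSpace.exp_series_hasSum_exp' (𝕂 := ℂ) (A i j)
    refine hs.nonneg fun n => ?_
    have h2 := (hpow n).2 x
    have h3 : (0 : ℂ) ≤ (n.factorial : ℂ)⁻¹ := by positivity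
    have h4 := mul_nonneg h3 h2
    convert h4 using 1
    simp only [Finsupp.sum, Finset.mul_sum, Matrix.of_apply]
    refine Finset.sum_congr rfl fun i _ => Finset.sum_congr rfl fun j _ => ?_
    ring

lemma chi_isHermitian (i : Fin 8) : (chi i).conjTranspose = chi i := by
  have h1 : pauli1.conjTranspose = pauli1 := by
    ext i j; fin_cases i <;> fin_cases j <;> simp [pauli1]
  have h2 : pauli2.conjTranspose = pauli2 := by
    ext i j; fin_cases i <;> fin_cases j <;> simp [pauli2]
  have h3 : pauli3.conjTranspose = pauli3 := by
    ext i j; fin_cases i <;> fin_cases j <;> simp [pauli3]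
  fin_cases i <;> simp [chi, Matrix.conjTranspose_kronecker, h1, h2, h3]

/-- The correlation `Tr(ρ_β X Y)` as a sum of rank-one terms. -/
lemma exists_gram (β η : ℝ) : ∃ (c : ℂ) (K : SiteMat), 0 ≤ c ∧ K.conjTranspose = K ∧
    rho β η = c • (K * K) := by
  have hp3 : pauli3.conjTranspose = pauli3 := by
    ext i j; fin_cases i <;> fin_cases j <;> simp [pauli3]
  have hH : (siteHam η).conjTranspose = siteHam η := by
    simp [siteHam, Matrix.conjTranspose_smul, Matrix.conjTranspose_kronecker, hp3]
  set A : SiteMat := (-(β : ℂ) / 2) • siteHam η with hA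
  have hAh : A.conjTranspose = A := by
    simp [hA, Matrix.conjTranspose_smul, hH]
  have hK : (NormedSpace.exp A).conjTranspose = NormedSpace.exp A := by
    rw [← Matrix.exp_conjTranspose, hAh]
  have hE : NormedSpace.exp (-(β : ℂ) • siteHam η) = NormedSpace.exp A * NormedSpace.exp A := by
    rw [← Matrix.exp_add_of_commute A A (Commute.refl A)]
    congr 1
    rw [hA, ← add_smul]
    congr 1
    ring
  refine ⟨(NormedSpace.exp (-(β : ℂ) • siteHam η)).trace⁻¹, NormedSpace.exp A, ?_, hK, ?_⟩
  · rw [hE]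
    have : 0 ≤ ((NormedSpace.exp A).conjTranspose * NormedSpace.exp A).trace :=
      (Matrix.posSemidef_conjTranspose_mul_self (NormedSpace.exp A)).trace_nonneg
    rw [hK] at this
    exact inv_nonneg.mpr this
  · rw [rho, hE]

lemma rho_conjTranspose (β η : ℝ) : (rho β η).conjTranspose = rho β η := by
  obtain ⟨c, K, hc, hK, h⟩ := exists_gram β η
  have hc' : star c = c := (IsSelfAdjoint.of_nonneg hc).star_eq
  rw [h, Matrix.conjTranspose_smul, Matrix.conjTranspose_mul, hK, hc']

/-- `Tr(ρ_β x_i x_j) = Σ_{ij} + (i/2) σ_{ij}`. -/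
lemma siteExp_chi (β η : ℝ) (i j : Fin 8) :
    siteExp β η (chi i * chi j) =
      (covMat β η i j : ℂ) + (Complex.I / 2) * (sympMat β η i j : ℂ) := by
  have hsw : siteExp β η (chi j * chi i) = star (siteExp β η (chi i * chi j)) := by
    simp only [siteExp]
    rw [← Matrix.trace_conjTranspose, Matrix.conjTranspose_mul, Matrix.conjTranspose_mul,
      chi_isHermitian, chi_isHermitian, rho_conjTranspose, Matrix.trace_mul_comm]
  have hadd : ∀ X Y : SiteMat, siteExp β η (X + Y) = siteExp β η X + siteExp β η Y := by
    intro X Y; simp [siteExp, mul_add]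
  have hsub : ∀ X Y : SiteMat, siteExp β η (X - Y) = siteExp β η X - siteExp β η Y := by
    intro X Y; simp [siteExp, mul_sub]
  simp only [covMat, sympMat, Matrix.of_apply, hadd, hsub, hsw]
  generalize siteExp β η (chi i * chi j) = z
  apply Complex.ext <;> simp <;> ring

lemma form_covMat_symm (β η : ℝ) (r s : Fin 8 → ℝ) :
    form (covMat β η) r s = form (covMat β η) s r := by
  have : ∀ i j, covMat β η i j = covMat β η j i := by
    intro i j; simp [covMat, add_comm]
  simp only [form, dotProduct, Matrix.mulVec, Finset.mul_sum]
  rw [Finset.sum_comm]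
  refine Finset.sum_congr rfl fun i _ => Finset.sum_congr rfl fun j _ => ?_
  rw [this]; ring

lemma form_add_left (M : Matrix (Fin 8) (Fin 8) ℝ) (r s t : Fin 8 → ℝ) :
    form M (r + s) t = form M r t + form M s t := by
  simp [form, add_dotProduct]

lemma form_add_right (M : Matrix (Fin 8) (Fin 8) ℝ) (r s t : Fin 8 → ℝ) :
    form M r (s + t) = form M r s + form M r t := by
  simp [form, Matrix.mulVec_add]

lemma form_neg_left (M : Matrix (Fin 8) (Fin 8) ℝ) (r t : Fin 8 → ℝ) :
    form M (-r) t = -form M r t := by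
  simp [form]

lemma form_neg_right (M : Matrix (Fin 8) (Fin 8) ℝ) (r t : Fin 8 → ℝ) :
    form M r (-t) = -form M r t := by
  simp [form, Matrix.mulVec_neg]

lemma form_sympMat_antisymm (β η : ℝ) (r s : Fin 8 → ℝ) :
    form (sympMat β η) r s = -form (sympMat β η) s r := by
  have : ∀ i j, sympMat β η i j = -sympMat β η j i := by
    intro i j
    have e : chi i * chi j - chi j * chi i = -(chi j * chi i - chi i * chi j) := by abel
    have e2 : siteExp β η (chi i * chi j - chi j * chi i) =
        -siteExp β η (chi j * chi i - chi i * chi j) := by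
      rw [e, siteExp, siteExp, mul_neg, Matrix.trace_neg]
    simp only [sympMat, Matrix.of_apply]
    rw [e2, mul_neg, Complex.neg_re]
  simp only [form, dotProduct, Matrix.mulVec, Finset.mul_sum]
  rw [Finset.sum_comm, ← Finset.sum_neg_distrib]
  refine Finset.sum_congr rfl fun i _ => ?_
  rw [← Finset.sum_neg_distrib]
  refine Finset.sum_congr rfl fun j _ => ?_
  rw [this]; ring

/-- The correlation form `(r, C s)`, `C = Σ + (i/2) σ`, is a positive semidefinite kernel. -/
lemma posSemidef_corr (β η : ℝ) :
    (Matrix.of fun r s : Fin 8 → ℝ => (form (covMat β η) r s : ℂ) +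
      (Complex.I / 2) * (form (sympMat β η) r s : ℂ)).PosSemidef := by
  obtain ⟨c, K, hc, hK, h⟩ := exists_gram β η
  let f : Site × Site → (Fin 8 → ℝ) → ℂ := fun p r => ((∑ j, (r j : ℂ) • chi j) * K) p.1 p.2
  have key : (Matrix.of fun r s : Fin 8 → ℝ => (form (covMat β η) r s : ℂ) +
      (Complex.I / 2) * (form (sympMat β η) r s : ℂ)) =
      c • ∑ p : Site × Site,
        (Matrix.of fun r s => star (f p r) * f p s : Matrix (Fin 8 → ℝ) (Fin 8 → ℝ) ℂ) := by
    ext r s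
    have h1 : (form (covMat β η) r s : ℂ) + (Complex.I / 2) * (form (sympMat β η) r s : ℂ) =
        siteExp β η ((∑ j, (r j : ℂ) • chi j) * ∑ j, (s j : ℂ) • chi j) := by
      rw [Finset.sum_mul_sum]
      simp only [siteExp, Finset.mul_sum, Matrix.trace_sum, smul_mul_assoc,
        mul_smul_comm, Matrix.trace_smul]
      simp only [form, dotProduct, Matrix.mulVec, Finset.mul_sum, Complex.ofReal_sum,
        ← Finset.sum_add_distrib]
      refine Finset.sum_congr rfl fun i _ => Finset.sum_congr rfl fun j _ => ?_
      have := siteExp_chi β η i j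
      simp only [siteExp] at this
      rw [this]
      push_cast
      simp only [smul_eq_mul]
      ring
    have hX : (∑ j, (r j : ℂ) • chi j).conjTranspose = ∑ j, (r j : ℂ) • chi j := by
      simp [Matrix.conjTranspose_sum, Matrix.conjTranspose_smul, chi_isHermitian]
    simp only [Matrix.of_apply]
    rw [h1, siteExp, h, smul_mul_assoc, Matrix.trace_smul, mul_assoc, Matrix.trace_mul_comm,
      ]
    have h2 : K * ((∑ j, (r j : ℂ) • chi j) * ∑ j, (s j : ℂ) • chi j) * K =
        ((∑ j, (r j : ℂ) • chi j) * K).conjTranspose * ((∑ j, (s j : ℂ) • chi j) * K) := by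
      rw [Matrix.conjTranspose_mul, hK, hX]
      simp only [mul_assoc]
    rw [h2]
    simp only [Matrix.smul_apply, Matrix.sum_apply, Matrix.of_apply, Matrix.trace, Matrix.diag,
      Matrix.mul_apply (M := Matrix.conjTranspose _), Matrix.conjTranspose_apply, f]
    congr 1
    rw [Fintype.sum_prod_type (f := fun c : Site × Site => _), Finset.sum_comm]
  rw [key]
  refine Matrix.PosSemidef.smul ?_ hc
  refine Matrix.posSemidef_sum _ fun p _ => posSemidef_rankOne (f p)

/-- `Ω_β` is a positive functional on the linear span of the Weyl operators. -/
lemma posSemidef_weylKernel (β η : ℝ) : (weylKernel β η).PosSemidef := by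
  have h1 := (posSemidef_rankOne (fun r : Fin 8 → ℝ => weylVal β η r)).hadamard
    (posSemidef_exp (posSemidef_corr β η))
  have e : ∀ A B : Matrix (Fin 8 → ℝ) (Fin 8 → ℝ) ℂ, A = B → B.PosSemidef → A.PosSemidef := by
    rintro A B rfl h
    exact h
  refine e _ _ ?_ h1
  ext r s
  simp only [weylKernel, weylPhase, weylVal, Matrix.hadamard_apply, Matrix.of_apply,
    Complex.star_def, ← Complex.exp_conj, Complex.conj_ofReal, ← Complex.exp_add]
  congr 1
  rw [sub_eq_add_neg, form_add_left, form_add_right, form_add_right, form_neg_left, form_neg_left,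
    form_neg_left, form_neg_right, form_neg_right, form_covMat_symm β η s r]
  push_cast
  ring

/-- The sesquilinear form `⟨∑ z_r W(r), ∑ w_s W(s)⟩ = ∑ conj(z_r) w_s Ω_β(W(r)† W(s))`. -/
def weylForm (β η : ℝ) (f g : (Fin 8 → ℝ) →₀ ℂ) : ℂ :=
  f.sum fun r z => g.sum fun s w => star z * weylKernel β η r s * w

lemma weylForm_conj (β η : ℝ) (f g : (Fin 8 → ℝ) →₀ ℂ) :
    (starRingEnd ℂ) (weylForm β η g f) = weylForm β η f g := by
  unfold weylForm
  rw [Finsupp.sum_comm]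
  simp only [map_finsuppSum]
  refine Finsupp.sum_congr fun r _ => Finsupp.sum_congr fun s _ => ?_
  rw [← (posSemidef_weylKernel β η).isHermitian.apply]
  simp
  ring

lemma weylForm_add_left (β η : ℝ) (f g h : (Fin 8 → ℝ) →₀ ℂ) :
    weylForm β η (f + g) h = weylForm β η f h + weylForm β η g h := by
  unfold weylForm
  rw [Finsupp.sum_add_index'] <;> simp [← Finsupp.sum_add, add_mul]

lemma weylForm_smul_left (β η : ℝ) (f g : (Fin 8 → ℝ) →₀ ℂ) (c : ℂ) :
    weylForm β η (c • f) g = (starRingEnd ℂ) c * weylForm β η f g := by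
  unfold weylForm
  rw [Finsupp.sum_smul_index (by simp)]
  simp [Finsupp.mul_sum, mul_assoc]

/-- The linear span of the abstract Weyl operators: `∑ c_r W(r)` is the finitely supported
function `r ↦ c_r`. -/
def WeylSpan (_β _η : ℝ) : Type := (Fin 8 → ℝ) →₀ ℂ

variable (β η : ℝ)

instance : AddCommGroup (WeylSpan β η) := inferInstanceAs (AddCommGroup ((Fin 8 → ℝ) →₀ ℂ))

instance : Module ℂ (WeylSpan β η) := inferInstanceAs (Module ℂ ((Fin 8 → ℝ) →₀ ℂ))

/-- The identification of the span with finitely supported functions. -/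
def toSpan : ((Fin 8 → ℝ) →₀ ℂ) ≃ₗ[ℂ] WeylSpan β η := LinearEquiv.refl ℂ _

/-- The generator `W(r)` of the span. -/
def weylGen (r : Fin 8 → ℝ) : WeylSpan β η := toSpan β η (Finsupp.single r 1)

/-- The GNS (pre-)inner product `⟨X, Y⟩ = Ω_β(X† Y)`. -/
instance weylCore : PreInnerProductSpace.Core ℂ (WeylSpan β η) where
  inner f g := weylForm β η ((toSpan β η).symm f) ((toSpan β η).symm g)
  conj_inner_symm _ _ := weylForm_conj β η _ _
  add_left _ _ _ := weylForm_add_left β η _ _ _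
  smul_left _ _ c := weylForm_smul_left β η _ _ c
  re_inner_nonneg _ := (Complex.nonneg_iff.mp ((posSemidef_weylKernel β η).2 _)).1

instance : SeminormedAddCommGroup (WeylSpan β η) :=
  InnerProductSpace.Core.toSeminormedAddCommGroup (𝕜 := ℂ)

instance : InnerProductSpace ℂ (WeylSpan β η) := .ofCore (weylCore β η)

/-- The GNS Hilbert space of `Ω_β`. -/
abbrev GNS : Type := UniformSpace.Completion (WeylSpan β η)

/-- Left multiplication `W(s) ↦ W(a) W(s) = e^{-(i/2)(a, σ s)} W(a + s)` on the span. -/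
def weylMul (a : Fin 8 → ℝ) : WeylSpan β η →ₗ[ℂ] WeylSpan β η :=
  Finsupp.linearCombination ℂ (fun s => weylPhase β η a s • weylGen β η (a + s)) ∘ₗ
    (toSpan β η).symm.toLinearMap

lemma weylMul_gen (a s : Fin 8 → ℝ) :
    weylMul β η a (weylGen β η s) = weylPhase β η a s • weylGen β η (a + s) := by
  simp [weylMul, weylGen]

lemma inner_weylGen (r s : Fin 8 → ℝ) :
    inner ℂ (weylGen β η r) (weylGen β η s) = weylKernel β η r s := by
  change weylForm β η (Finsupp.single r 1) (Finsupp.single s 1) = _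
  simp [weylForm]

/-- Properties of elements of the span can be checked on multiples of the generators. -/
lemma weylSpan_induction {p : WeylSpan β η → Prop} (f : WeylSpan β η) (h0 : p 0)
    (hadd : ∀ f g, p f → p g → p (f + g)) (hgen : ∀ (c : ℂ) r, p (c • weylGen β η r)) : p f := by
  refine Finsupp.induction_linear (motive := fun f => p (toSpan β η f)) ((toSpan β η).symm f)
    (by simpa using h0) (fun f g hf hg => by simpa using hadd _ _ hf hg) fun r c => ?_
  have := hgen c r
  rw [weylGen, ← map_smul] at this
  simpa using this

lemma inner_weylMul (a : Fin 8 → ℝ) (f g : WeylSpan β η) :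
    inner ℂ (weylMul β η a f) (weylMul β η a g) = inner ℂ f g := by
  induction f using weylSpan_induction with
  | h0 => simp
  | hadd f f' h h' => simp [inner_add_left, h, h']
  | hgen c r =>
    induction g using weylSpan_induction with
    | h0 => simp
    | hadd f f' h h' => simp only [map_add, inner_add_right, h, h']
    | hgen c' s =>
      simp only [map_smul, weylMul_gen, inner_smul_left, inner_smul_right, inner_weylGen]
      have key : (starRingEnd ℂ) (weylPhase β η a r) * weylPhase β η a s *
          weylKernel β η (a + r) (a + s) = weylKernel β η r s := by
       simp only [weylKernel, Matrix.of_apply, weylPhase, add_sub_add_left_eq_sub,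
         ← Complex.exp_conj, ← mul_assoc, ← Complex.exp_add]
       congr 2
       simp only [map_mul, map_neg, map_div₀, Complex.conj_I, Complex.conj_ofReal, neg_add,
         form_add_left, form_add_right, form_neg_left, Complex.conj_ofNat]
       have h0 : form (sympMat β η) a a = 0 := by
         have := form_sympMat_antisymm β η a a
         linarith
       rw [h0, form_sympMat_antisymm β η r a]
       push_cast
       ring
      rw [← key]
      ring

/-- The Weyl operator `W(a)` in the GNS representation of `Ω_β`. -/
def weylOp (a : Fin 8 → ℝ) : GNS β η →L[ℂ] GNS β η :=
  ((weylMul β η a).mkContinuous 1 fun f => by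
    rw [one_mul, @norm_eq_sqrt_re_inner ℂ, @norm_eq_sqrt_re_inner ℂ, inner_weylMul]).completion

/-- The cyclic vector of the GNS representation: the class of `W(0) = 1`. -/
def vacuum : GNS β η := ((weylGen β η 0 : WeylSpan β η) : GNS β η)

/-- The state `Ω_β(X) = ⟨Ω, X Ω⟩`. -/
def mesoState (X : GNS β η →L[ℂ] GNS β η) : ℂ := inner ℂ (vacuum β η) (X (vacuum β η))

lemma weylOp_coe (a : Fin 8 → ℝ) (f : WeylSpan β η) :
    weylOp β η a (f : GNS β η) = ((weylMul β η a f : WeylSpan β η) : GNS β η) := by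
  rw [weylOp, ContinuousLinearMap.completion_apply_coe]
  rfl

/-- The GNS representation reproduces `Ω_β(W(r)) = exp(-½ (r, Σ r))`. -/
lemma mesoState_weylOp (r : Fin 8 → ℝ) : mesoState β η (weylOp β η r) = weylVal β η r := by
  have h0 : ∀ M : Matrix (Fin 8) (Fin 8) ℝ, ∀ s, form M s 0 = 0 := by simp [form]
  have h1 : ∀ M : Matrix (Fin 8) (Fin 8) ℝ, ∀ s, form M 0 s = 0 := by simp [form]
  rw [mesoState, vacuum, weylOp_coe, weylMul_gen, UniformSpace.Completion.inner_coe,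
    inner_smul_right, inner_weylGen]
  simp [weylKernel, weylPhase, h0, h1]

/-- Two bounded operators on the GNS space agree if they agree on the generators of the span. -/
lemma gns_ext {X Y : GNS β η →L[ℂ] GNS β η}
    (h : ∀ s, X (weylGen β η s : WeylSpan β η) = Y (weylGen β η s : WeylSpan β η)) : X = Y := by
  ext ξ
  induction ξ using UniformSpace.Completion.induction_on with
  | hp => exact isClosed_eq X.continuous Y.continuous
  | ih f =>
    induction f using weylSpan_induction with
    | h0 => rw [UniformSpace.Completion.coe_zero, map_zero, map_zero]
    | hadd f g hf hg => simp only [UniformSpace.Completion.coe_add, map_add, hf, hg]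
    | hgen c r => simp only [UniformSpace.Completion.coe_smul, map_smul, h]

/-- The Weyl relations `W(r) W(s) = e^{-(i/2)(r, σ s)} W(r + s)`. -/
lemma weylOp_mul (r s : Fin 8 → ℝ) :
    weylOp β η r * weylOp β η s = weylPhase β η r s • weylOp β η (r + s) := by
  refine gns_ext β η fun u => ?_
  simp only [FunLike.coe_mul_eq_comp, Function.comp_apply, FunLike.coe_smul, Pi.smul_apply,
    weylOp_coe, weylMul_gen, map_smul, UniformSpace.Completion.coe_smul, smul_smul, add_assoc]
  congr 1
  simp only [weylPhase, ← Complex.exp_add, form_add_left, form_add_right]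
  congr 1
  push_cast
  ring

/-- `W(0) = 1`. -/
lemma weylOp_zero : weylOp β η 0 = 1 := by
  refine gns_ext β η fun u => ?_
  have : weylPhase β η 0 u = 1 := by simp [weylPhase, form]
  rw [weylOp_coe, weylMul_gen, this]
  simp

/-- `W(r)† = W(-r)`. -/
lemma adjoint_weylOp (r : Fin 8 → ℝ) :
    ContinuousLinearMap.adjoint (weylOp β η r) = weylOp β η (-r) := by
  symm
  rw [ContinuousLinearMap.eq_adjoint_iff]
  have hiso : ∀ ξ ζ : GNS β η, inner ℂ (weylOp β η r ξ) (weylOp β η r ζ) = inner ℂ ξ ζ := by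
    intro ξ ζ
    induction ξ, ζ using UniformSpace.Completion.induction_on₂ with
    | hp => apply isClosed_eq <;> fun_prop
    | ih f g => simp only [weylOp_coe, UniformSpace.Completion.inner_coe, inner_weylMul]
  intro ξ ζ
  have h2 : weylOp β η r (weylOp β η (-r) ξ) = ξ := by
    have h3 := weylOp_mul β η r (-r)
    have h4 : weylPhase β η r (-r) = 1 := by
      have := form_sympMat_antisymm β η r r
      have h5 : form (sympMat β η) r r = 0 := by linarith
      simp [weylPhase, form_neg_right, h5]
    rw [h4, one_smul, add_neg_cancel, weylOp_zero] at h3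
    have := congrArg (fun X : GNS β η →L[ℂ] GNS β η => X ξ) h3
    simpa using this
  rw [← hiso, h2]

/-- The fluctuation algebra `𝒲(χ, σ)`: the strong operator closure, in the GNS representation of
`Ω_β`, of the linear span of the Weyl operators. -/
def fluctAlg : Submodule ℂ (GNS β η →L[ℂ] GNS β η) where
  carrier := {X | ∀ (S : Finset (GNS β η)) (ε : ℝ), 0 < ε →
    ∃ A ∈ Submodule.span ℂ (Set.range (weylOp β η)), ∀ ξ ∈ S, ‖X ξ - A ξ‖ < ε}
  zero_mem' S ε hε := ⟨0, Submodule.zero_mem _, fun ξ _ => by simpa using hε⟩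
  add_mem' {X Y} hX hY S ε hε := by
    obtain ⟨A, hA, hA'⟩ := hX S (ε / 2) (half_pos hε)
    obtain ⟨B, hB, hB'⟩ := hY S (ε / 2) (half_pos hε)
    refine ⟨A + B, Submodule.add_mem _ hA hB, fun ξ hξ => ?_⟩
    have e : (X + Y) ξ - (A + B) ξ = (X ξ - A ξ) + (Y ξ - B ξ) := by
      simp only [add_apply]
      abel
    rw [e]
    have := norm_add_le (X ξ - A ξ) (Y ξ - B ξ)
    linarith [hA' ξ hξ, hB' ξ hξ]
  smul_mem' c X hX S ε hε := by
    obtain ⟨A, hA, hA'⟩ := hX S (ε / (‖c‖ + 1)) (by positivity)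
    refine ⟨c • A, Submodule.smul_mem _ c hA, fun ξ hξ => ?_⟩
    have h1 := hA' ξ hξ
    have hc : 0 < ‖c‖ + 1 := by positivity
    rw [lt_div_iff₀ hc] at h1
    have e : (c • X) ξ - (c • A) ξ = c • (X ξ - A ξ) := by
      simp [smul_sub]
    rw [e, norm_smul]
    nlinarith [norm_nonneg (X ξ - A ξ)]

lemma weylOp_mem (r : Fin 8 → ℝ) : weylOp β η r ∈ fluctAlg β η := fun _ _ hε =>
  ⟨weylOp β η r, Submodule.subset_span ⟨r, rfl⟩, fun _ _ => by simpa using hε⟩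

lemma one_mem_fluctAlg : (1 : GNS β η →L[ℂ] GNS β η) ∈ fluctAlg β η :=
  weylOp_zero β η ▸ weylOp_mem β η 0

/-- The Weyl operator `W(r)` as an element of the fluctuation algebra. -/
def weyl (r : Fin 8 → ℝ) : fluctAlg β η := ⟨weylOp β η r, weylOp_mem β η r⟩

/-- The unit of the fluctuation algebra. -/
def weylOne : fluctAlg β η := ⟨1, one_mem_fluctAlg β η⟩

variable {β η}

/-- A matrix `(A_{ij})` of operators on the GNS space is positive as an operator on the `n`-fold
direct sum of that space. -/
def MatrixPositive {n : ℕ} (A : Matrix (Fin n) (Fin n) (fluctAlg β η)) : Prop :=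
  ∀ ξ : Fin n → GNS β η,
    0 ≤ ∑ i, ∑ j, (inner ℂ (ξ i) ((A i j : GNS β η →L[ℂ] GNS β η) (ξ j)) : ℂ)

/-- Complete positivity: all the amplifications `(A_{ij}) ↦ (Φ(A_{ij}))` preserve positivity. -/
def IsCompletelyPositive (Φ : fluctAlg β η →ₗ[ℂ] fluctAlg β η) : Prop :=
  ∀ (n : ℕ) (A : Matrix (Fin n) (Fin n) (fluctAlg β η)),
    MatrixPositive A → MatrixPositive (Matrix.of fun i j => Φ (A i j))

/-- The exponent `f_r(t) = -½ (r, (Σ - e^{tℒ} Σ e^{tℒᵀ}) r)`. -/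
def damping (β η : ℝ) (L : Matrix (Fin 8) (Fin 8) ℝ) (t : ℝ) (r : Fin 8 → ℝ) : ℝ :=
  -(1 / 2) * form (covMat β η -
    NormedSpace.exp (t • L) * covMat β η * NormedSpace.exp (t • L.transpose)) r r

/-- The evolved vector `r_t = e^{tℒᵀ} r`. -/
def evolved (L : Matrix (Fin 8) (Fin 8) ℝ) (t : ℝ) (r : Fin 8 → ℝ) : Fin 8 → ℝ :=
  (NormedSpace.exp (t • L.transpose)).mulVec r

end SpinFluct

end

/-! Let C = Σ + (i/2)σ, the matrix with entries Tr(ρ_β x_i x_j). It is positive definite, because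
ρ_β is invertible and the x_j are linearly independent. The means Tr(ρ_β x_j) vanish, because ρ_β is
diagonal and the x_j have zero diagonal. Both halves of the proof rest on one inequality, Re (z, C
ℒᵀ z) ≤ 0 for all complex z (`corr_dissipative`). It follows from stationarity: the state
annihilates the generator, and evaluating this on Y†Y shows that -2 Re ω(Y† 𝕃_N Y) is the
expectation of a carré du champ, hence nonnegative. For Y a fluctuation, the two-point function is
exactly given by C. Consequently e^{tℒᵀ} is a contraction for C (`corrContraction_exp`).

Mesoscopic half. The vectors ξ_a = e^{½(a,Σa)} W(a)Ω have Gram kernel e^{(a,Cb)} and extend to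
complex labels z (`cohVec`, `inner_cohVec`). In these vectors the quasi-free map induced by a matrix
M is the Schur multiplier ⟨ξ_z, Φ(X) ξ_w⟩ = e^{(z,Cw) - (Tz,CTw)} ⟨ξ_{Tz}, X ξ_{Tw}⟩, where T =
C⁻¹MᵀC is the adjoint of M. If M contracts C, the kernel is positive semidefinite, so Φ is bounded
and completely positive (`SchurDatum.multiplier`, `SchurDatum.multiplier_completelyPositive`). The
semigroup law, the action on Weyl operators and the invariance of Ω_β are read off from the formula.
That Φ preserves the strong closure of the Weyl span is proved through the double commutant
(`CorrContraction.map_mem_fluctAlg`).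

Microscopic half. Up to O(N^{-1/2}) in norm, 𝕃_N[W_N(r)] is the derivative of W_N along ℒᵀr minus ½
W_N(r) Γ, where Γ is the carré du champ of the fluctuation (`norm_lindblad_exp_sub_le`). Γ is an
average of two-site observables with summable weights, so its variance is O(1/N) and it may be
replaced by its mean -2 Re (r, C ℒᵀ r) (`variance_carreDuChamp_le`). Hence the microscopic and
quasi-free generators differ on W_N(r) by O(N^{-1/2}) in the L²-norm of ω_β
(`localState_generator_error_le`). This error survives the time evolution, because Φ^N_s contracts
the L²-norm (`localState_semigroupOf_le`) and matrix elements between W_N(a) and W_N(b) are bounded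
by it uniformly in N (`exists_norm_localState_localWeyl_le`). A Duhamel interpolation then reduces
the limit to the central limit theorem for a product of three Weyl operators
(`tendsto_localState_localWeyl`). -/

noncomputable section

namespace SpinFluct

section

/-! ### Schur multipliers on the bounded operators of a Hilbert space -/

open scoped MatrixOrder Matrix.Norms.L2Operator in
/-- On a finite index set, a positive semidefinite kernel is a Gram kernel. -/
lemma exists_gram_factor {ι : Type*} {κ : Matrix ι ι ℂ} (hκ : κ.PosSemidef) (s : Finset ι) :
    ∃ B : s → ι → ℂ, ∀ p ∈ s, ∀ q ∈ s, κ p q = ∑ m, star (B m p) * B m q := by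
  classical
  obtain ⟨B, hB⟩ := CStarAlgebra.nonneg_iff_eq_star_mul_self.mp
    (Matrix.nonneg_iff_posSemidef.mpr <| hκ.submatrix (Subtype.val : s → ι))
  refine ⟨fun m p => if h : p ∈ s then B m ⟨p, h⟩ else 0, fun p hp q hq => ?_⟩
  have := congrFun (congrFun hB ⟨p, hp⟩) ⟨q, hq⟩
  simpa [Matrix.star_eq_conjTranspose, Matrix.mul_apply, hp, hq] using this

/-- Two families of vectors of a Hilbert space, the first of them total, whose Gram kernels differ
by a positive semidefinite factor. -/
structure SchurDatum (ι H : Type*) [NormedAddCommGroup H] [InnerProductSpace ℂ H] where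
  e : ι → H
  u : ι → H
  κ : Matrix ι ι ℂ
  dense : DenseRange (Finsupp.linearCombination ℂ e)
  psd : κ.PosSemidef
  inner_e : ∀ i j, inner ℂ (e i) (e j) = κ i j * inner ℂ (u i) (u j)

namespace SchurDatum

variable {ι H : Type*} [NormedAddCommGroup H] [InnerProductSpace ℂ H] (d : SchurDatum ι H)

lemma _root_.SpinFluct.inner_sum_smul_sum_smul (s : Finset ι) (f g : ι → ℂ) (x y : ι → H) :
    inner ℂ (∑ p ∈ s, f p • x p) (∑ q ∈ s, g q • y q) =
      ∑ p ∈ s, ∑ q ∈ s, star (f p) * g q * inner ℂ (x p) (y q) := by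
  simp only [sum_inner, inner_sum, inner_smul_left, inner_smul_right, Finset.mul_sum]
  rw [Finset.sum_comm]
  refine Finset.sum_congr rfl fun p _ => Finset.sum_congr rfl fun q _ => ?_
  simp only [Complex.star_def]
  ring

/-- A Gram factor of κ absorbs the weights into the vectors and leaves a sum over m of unweighted
matrix elements of X. Boundedness and complete positivity of the Schur multiplier both come from
this identity. -/
lemma sum_gram {s : Finset ι} {B : s → ι → ℂ}
    (hB : ∀ p ∈ s, ∀ q ∈ s, d.κ p q = ∑ m, star (B m p) * B m q) (X : H →L[ℂ] H) (f g : ι → ℂ) :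
    ∑ p ∈ s, ∑ q ∈ s, star (f p) * g q * (d.κ p q * inner ℂ (d.u p) (X (d.u q))) =
      ∑ m, inner ℂ (∑ p ∈ s, (f p * B m p) • d.u p) (X (∑ q ∈ s, (g q * B m q) • d.u q)) := by
  simp only [map_sum, map_smul, inner_sum_smul_sum_smul]
  conv_rhs => rw [Finset.sum_comm]
  refine Finset.sum_congr rfl fun p hp => ?_
  conv_rhs => rw [Finset.sum_comm]
  refine Finset.sum_congr rfl fun q hq => ?_
  rw [hB p hp q hq, Finset.sum_mul, Finset.mul_sum]
  refine Finset.sum_congr rfl fun m _ => ?_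
  simp only [star_mul']
  ring

/-- The case X = 1 of `sum_gram`, combined with `inner_e`: replacing ∑ f_p e_p by the family of
vectors indexed by m is isometric. -/
lemma sum_norm_gram {s : Finset ι} {B : s → ι → ℂ}
    (hB : ∀ p ∈ s, ∀ q ∈ s, d.κ p q = ∑ m, star (B m p) * B m q) (f : ι → ℂ) :
    ∑ m, ‖∑ p ∈ s, (f p * B m p) • d.u p‖ ^ 2 = ‖∑ p ∈ s, f p • d.e p‖ ^ 2 := by
  have h := d.sum_gram hB (ContinuousLinearMap.id ℂ H) f f
  simp only [ContinuousLinearMap.id_apply, inner_self_eq_norm_sq_to_K] at h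
  have h2 : (inner ℂ (∑ p ∈ s, f p • d.e p) (∑ p ∈ s, f p • d.e p) : ℂ) =
      ∑ p ∈ s, ∑ q ∈ s, star (f p) * f q * (d.κ p q * inner ℂ (d.u p) (d.u q)) := by
    simp only [inner_sum_smul_sum_smul, d.inner_e]
  rw [← h2, inner_self_eq_norm_sq_to_K] at h
  exact_mod_cast h.symm

/-- Cauchy–Schwarz in H and then in the index m, with `sum_norm_gram` identifying the norms. This is
the bound ‖Φ(X)‖ ≤ ‖X‖ in weak form. -/
lemma norm_form_le (s : Finset ι) (X : H →L[ℂ] H) (f g : ι → ℂ) :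
    ‖∑ p ∈ s, ∑ q ∈ s, star (f p) * g q * (d.κ p q * inner ℂ (d.u p) (X (d.u q)))‖ ≤
      ‖X‖ * ‖∑ p ∈ s, f p • d.e p‖ * ‖∑ p ∈ s, g p • d.e p‖ := by
  obtain ⟨B, hB⟩ := exists_gram_factor d.psd s
  rw [d.sum_gram hB]
  set η : (ι → ℂ) → s → H := fun f m => ∑ p ∈ s, (f p * B m p) • d.u p
  have hn : ∀ f : ι → ℂ, √(∑ m, ‖η f m‖ ^ 2) = ‖∑ p ∈ s, f p • d.e p‖ := fun f => by
    rw [d.sum_norm_gram hB, Real.sqrt_sq (norm_nonneg _)]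
  calc ‖∑ m, inner ℂ (η f m) (X (η g m))‖
      ≤ ∑ m, ‖X‖ * (‖η f m‖ * ‖η g m‖) := by
        refine norm_sum_le_of_le _ fun m _ => (norm_inner_le_norm _ _).trans ?_
        have := X.le_opNorm (η g m)
        nlinarith [norm_nonneg (η f m)]
    _ = ‖X‖ * ∑ m, ‖η f m‖ * ‖η g m‖ := by rw [Finset.mul_sum]
    _ ≤ ‖X‖ * (√(∑ m, ‖η f m‖ ^ 2) * √(∑ m, ‖η g m‖ ^ 2)) := by
        gcongr
        exact Real.sum_mul_le_sqrt_mul_sqrt _ _ _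
    _ = _ := by rw [hn, hn, mul_assoc]

/-- Shows that e_p ↦ κ_{jp} u_p respects linear relations among the e_p and is bounded: κ_{jp} is
expanded in a Gram factor and Cauchy–Schwarz is applied over m. -/
lemma exists_norm_row_le (j : ι) : ∃ C : ℝ, ∀ f : ι →₀ ℂ,
    ‖Finsupp.linearCombination ℂ (fun p => d.κ j p • d.u p) f‖ ≤
      C * ‖Finsupp.linearCombination ℂ d.e f‖ := by
  classical
  refine ⟨√(d.κ j j).re, fun f => ?_⟩
  -- The Gram factor must also represent the entries of row j, so j itself joins the support.
  set s := insert j f.support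
  have hlc : ∀ w : ι → H, Finsupp.linearCombination ℂ w f = ∑ p ∈ s, f p • w p := fun w => by
    rw [Finsupp.linearCombination_apply]
    exact Finsupp.sum_of_support_subset _ (Finset.subset_insert _ _) _ (by simp)
  obtain ⟨B, hB⟩ := exists_gram_factor d.psd s
  have hj : j ∈ s := Finset.mem_insert_self _ _
  have hn := d.sum_norm_gram hB f
  rw [hlc, hlc]
  have e1 : ∑ p ∈ s, f p • d.κ j p • d.u p =
      ∑ m, star (B m j) • ∑ p ∈ s, (f p * B m p) • d.u p := by
    simp only [Finset.smul_sum]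
    rw [Finset.sum_comm]
    refine Finset.sum_congr rfl fun p hp => ?_
    rw [hB j hj p hp, smul_smul, Finset.mul_sum, Finset.sum_smul]
    refine Finset.sum_congr rfl fun m _ => ?_
    rw [smul_smul]
    congr 1
    ring
  have e2 : (d.κ j j).re = ∑ m, ‖B m j‖ ^ 2 := by
    rw [hB j hj j hj, Complex.re_sum]
    refine Finset.sum_congr rfl fun m _ => ?_
    rw [Complex.star_def, ← Complex.normSq_eq_conj_mul_self, Complex.ofReal_re,
      Complex.normSq_eq_norm_sq]
  rw [e1, e2, ← Real.sqrt_sq (norm_nonneg (∑ p ∈ s, f p • d.e p)), ← hn]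
  refine (norm_sum_le_of_le _ fun m _ => ?_).trans (Real.sum_mul_le_sqrt_mul_sqrt _ _ _)
  rw [norm_smul, norm_star]

lemma norm_le_of_dense (d : SchurDatum ι H) {η : H} {K : ℝ} (hK : 0 ≤ K)
    (h : ∀ f : ι →₀ ℂ, ‖(inner ℂ (Finsupp.linearCombination ℂ d.e f) η : ℂ)‖ ≤
      K * ‖Finsupp.linearCombination ℂ d.e f‖) : ‖η‖ ≤ K := by
  have h2 : ∀ ξ : H, ‖(inner ℂ ξ η : ℂ)‖ ≤ K * ‖ξ‖ := fun ξ =>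
    d.dense.induction_on (p := fun ξ => ‖(inner ℂ ξ η : ℂ)‖ ≤ K * ‖ξ‖) ξ
      (isClosed_le (by fun_prop) (by fun_prop)) h
  have h3 := h2 η
  have h4 : ‖(inner ℂ η η : ℂ)‖ = ‖η‖ * ‖η‖ := by
    rw [inner_self_eq_norm_sq_to_K]
    simp [sq]
  rw [h4] at h3
  rcases (norm_nonneg η).eq_or_lt with h0 | h0
  · rwa [← h0]
  · exact le_of_mul_le_mul_right h3 h0

lemma inner_ext {X Y : H →L[ℂ] H}
    (h : ∀ i j, inner ℂ (d.e i) (X (d.e j)) = inner ℂ (d.e i) (Y (d.e j))) : X = Y := by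
  have key : ∀ (Z : H →L[ℂ] H), (∀ i j, inner ℂ (d.e i) (Z (d.e j)) = 0) → Z = 0 := by
    intro Z hZ
    have h1 : ∀ j, Z (d.e j) = 0 := fun j => by
      refine norm_le_zero_iff.mp (d.norm_le_of_dense le_rfl fun f => ?_)
      simp [Finsupp.linearCombination_apply, Finsupp.sum, hZ]
    ext ξ
    refine d.dense.induction_on (p := fun ξ => Z ξ = 0) ξ
      (isClosed_eq Z.continuous continuous_const) fun f => ?_
    simp [Finsupp.linearCombination_apply, Finsupp.sum, h1]
  refine sub_eq_zero.mp (key _ fun i j => ?_)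
  simp [h]

/-- The bounded operator `e_p ↦ κ_{jp} u_p`. -/
def row (j : ι) [CompleteSpace H] : H →L[ℂ] H :=
  (Finsupp.linearCombination ℂ fun p => d.κ j p • d.u p).extendOfNorm
    (Finsupp.linearCombination ℂ d.e)

variable [CompleteSpace H]

lemma row_e (j p : ι) : d.row j (d.e p) = d.κ j p • d.u p := by
  have := LinearMap.extendOfNorm_eq d.dense (d.exists_norm_row_le j) (Finsupp.single p 1)
  simpa [row] using this

/-- The vector row_j† X u_j has the inner products with the e_i required of Φ(X) e_j, so it serves
as the j-th column of Φ(X). -/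
lemma inner_adjoint_row (X : H →L[ℂ] H) (i j : ι) :
    inner ℂ (d.e i) ((d.row j).adjoint (X (d.u j))) =
      d.κ i j * inner ℂ (d.u i) (X (d.u j)) := by
  rw [ContinuousLinearMap.adjoint_inner_right, row_e, inner_smul_left]
  congr 1
  exact d.psd.isHermitian.apply i j

/-- By duality against the dense span of the e_p this is `norm_form_le`; it lets the prescription on
columns extend to a bounded operator. -/
lemma norm_multiplier_le (X : H →L[ℂ] H) (g : ι →₀ ℂ) :
    ‖Finsupp.linearCombination ℂ (fun j => (d.row j).adjoint (X (d.u j))) g‖ ≤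
      ‖X‖ * ‖Finsupp.linearCombination ℂ d.e g‖ := by
  classical
  refine d.norm_le_of_dense (by positivity) fun f => ?_
  set s := f.support ∪ g.support
  have hf : ∀ w : ι → H, Finsupp.linearCombination ℂ w f = ∑ p ∈ s, f p • w p := fun w => by
    rw [Finsupp.linearCombination_apply]
    exact Finsupp.sum_of_support_subset _ Finset.subset_union_left _ (by simp)
  have hg : ∀ w : ι → H, Finsupp.linearCombination ℂ w g = ∑ p ∈ s, g p • w p := fun w => by
    rw [Finsupp.linearCombination_apply]
    exact Finsupp.sum_of_support_subset _ Finset.subset_union_right _ (by simp)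
  rw [hf, hg, hg]
  have := d.norm_form_le s X f g
  calc _ = ‖∑ p ∈ s, ∑ q ∈ s, star (f p) * g q * (d.κ p q * inner ℂ (d.u p) (X (d.u q)))‖ := by
        congr 1
        simp only [inner_sum_smul_sum_smul, d.inner_adjoint_row]
    _ ≤ _ := this.trans (by rw [mul_right_comm])

/-- The Schur multiplier as a function. -/
def multiplierFun (X : H →L[ℂ] H) : H →L[ℂ] H :=
  (Finsupp.linearCombination ℂ fun j => (d.row j).adjoint (X (d.u j))).extendOfNorm
    (Finsupp.linearCombination ℂ d.e)

lemma multiplierFun_e (X : H →L[ℂ] H) (j : ι) :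
    d.multiplierFun X (d.e j) = (d.row j).adjoint (X (d.u j)) := by
  have := LinearMap.extendOfNorm_eq d.dense ⟨_, d.norm_multiplier_le X⟩ (Finsupp.single j 1)
  simpa [multiplierFun] using this

/-- The Schur multiplier: the linear map `Φ` with `⟨e_i, Φ(X) e_j⟩ = κ_{ij} ⟨u_i, X u_j⟩`. -/
def multiplier : (H →L[ℂ] H) →ₗ[ℂ] (H →L[ℂ] H) where
  toFun := d.multiplierFun
  map_add' X Y := d.inner_ext fun i j => by simp [multiplierFun_e]
  map_smul' c X := d.inner_ext fun i j => by simp [multiplierFun_e]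

lemma multiplier_e (X : H →L[ℂ] H) (j : ι) :
    d.multiplier X (d.e j) = (d.row j).adjoint (X (d.u j)) := d.multiplierFun_e X j

lemma inner_multiplier_e (X : H →L[ℂ] H) (i j : ι) :
    inner ℂ (d.e i) (d.multiplier X (d.e j)) = d.κ i j * inner ℂ (d.u i) (X (d.u j)) := by
  rw [multiplier_e, inner_adjoint_row]

/-- The columns of `Φ(X)` are matrix elements of `X`. -/
lemma inner_multiplier_right (X : H →L[ℂ] H) (ζ : H) (j : ι) :
    inner ℂ ζ (d.multiplier X (d.e j)) = inner ℂ (d.row j ζ) (X (d.u j)) := by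
  rw [multiplier_e, ContinuousLinearMap.adjoint_inner_right]

/-- The rows of `Φ(X)` are matrix elements of `X`. -/
lemma inner_multiplier_left (X : H →L[ℂ] H) (i : ι) (ζ : H) :
    inner ℂ (d.e i) (d.multiplier X ζ) = inner ℂ (d.u i) (X (d.row i ζ)) := by
  refine d.dense.induction_on
    (p := fun ζ => inner ℂ (d.e i) (d.multiplier X ζ) = inner ℂ (d.u i) (X (d.row i ζ))) ζ
    (isClosed_eq (by fun_prop) (by fun_prop)) fun f => ?_
  simp only [Finsupp.linearCombination_apply, Finsupp.sum, map_sum, map_smul, inner_sum,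
    inner_smul_right, inner_multiplier_e, row_e]

/-- The Schur multiplier is completely positive. -/
lemma multiplier_completelyPositive {n : ℕ} (A : Fin n → Fin n → (H →L[ℂ] H))
    (hA : ∀ ξ : Fin n → H, 0 ≤ ∑ i, ∑ j, (inner ℂ (ξ i) (A i j (ξ j)) : ℂ)) (ξ : Fin n → H) :
    0 ≤ ∑ i, ∑ j, (inner ℂ (ξ i) (d.multiplier (A i j) (ξ j)) : ℂ) := by
  classical
  -- The inequality is closed in ξ, so it suffices to test tuples of finite combinations of the e_p.
  have hd : DenseRange fun f : Fin n → (ι →₀ ℂ) =>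
      fun i => Finsupp.linearCombination ℂ d.e (f i) := DenseRange.piMap fun _ => d.dense
  refine hd.induction_on
    (p := fun ξ => 0 ≤ ∑ i, ∑ j, (inner ℂ (ξ i) (d.multiplier (A i j) (ξ j)) : ℂ)) ξ
    (isClosed_le continuous_const (by fun_prop)) fun f => ?_
  set s : Finset ι := Finset.univ.biUnion fun i => (f i).support
  have hf : ∀ (w : ι → H) i, Finsupp.linearCombination ℂ w (f i) = ∑ p ∈ s, f i p • w p :=
    fun w i => by
      rw [Finsupp.linearCombination_apply]
      exact Finsupp.sum_of_support_subset _
        (Finset.subset_biUnion_of_mem (fun i => (f i).support) (Finset.mem_univ i)) _ (by simp)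
  obtain ⟨B, hB⟩ := exists_gram_factor d.psd s
  have h1 : ∀ i j, (inner ℂ (Finsupp.linearCombination ℂ d.e (f i))
      (d.multiplier (A i j) (Finsupp.linearCombination ℂ d.e (f j))) : ℂ) =
      ∑ m, inner ℂ (∑ p ∈ s, (f i p * B m p) • d.u p)
        (A i j (∑ q ∈ s, (f j q * B m q) • d.u q)) := fun i j => by
    rw [← d.sum_gram hB, hf, hf]
    simp only [map_sum, map_smul, inner_sum_smul_sum_smul, inner_multiplier_e]
  simp only [h1]
  have h2 : ∀ i, ∑ j, ∑ m, (inner ℂ (∑ p ∈ s, (f i p * B m p) • d.u p)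
      (A i j (∑ q ∈ s, (f j q * B m q) • d.u q)) : ℂ) = ∑ m, ∑ j,
      inner ℂ (∑ p ∈ s, (f i p * B m p) • d.u p) (A i j (∑ q ∈ s, (f j q * B m q) • d.u q)) :=
    fun i => Finset.sum_comm
  simp only [h2]
  rw [Finset.sum_comm]
  -- For each fixed m the remaining double sum is the positivity of A at one tuple of vectors.
  exact Finset.sum_nonneg fun m _ => hA fun i => ∑ p ∈ s, (f i p * B m p) • d.u p

end SchurDatum

/-! ### The double commutant theorem -/

section Bicommutant

variable {H : Type*} [NormedAddCommGroup H] [InnerProductSpace ℂ H]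

/-- The diagonal action of an operator on a finite power of a Hilbert space. -/
def diagOp {ι : Type*} [Fintype ι] (A : H →L[ℂ] H) :
    PiLp 2 (fun _ : ι => H) →L[ℂ] PiLp 2 (fun _ : ι => H) :=
  ((PiLp.continuousLinearEquiv 2 ℂ fun _ : ι => H).symm : (ι → H) →L[ℂ] _) ∘L
    (ContinuousLinearMap.pi fun i => A ∘L ContinuousLinearMap.proj i) ∘L
    ((PiLp.continuousLinearEquiv 2 ℂ fun _ : ι => H) : _ →L[ℂ] (ι → H))

@[simp] lemma diagOp_apply {ι : Type*} [Fintype ι] (A : H →L[ℂ] H) (x : PiLp 2 (fun _ : ι => H))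
    (i : ι) : diagOp A x i = A (x i) := rfl

/-- U reduces A: the orthogonal complement is invariant under A because U is invariant under A†. -/
lemma starProjection_commute [CompleteSpace H] (U : Submodule ℂ H) [U.HasOrthogonalProjection]
    (A : H →L[ℂ] H) (h1 : ∀ x ∈ U, A x ∈ U) (h2 : ∀ x ∈ U, A.adjoint x ∈ U) (x : H) :
    U.starProjection (A x) = A (U.starProjection x) := by
  refine Submodule.eq_starProjection_of_mem_of_inner_eq_zero
    (h1 _ (Submodule.starProjection_apply_mem U x)) fun w hw => ?_
  rw [← map_sub, ← ContinuousLinearMap.adjoint_inner_right]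
  exact Submodule.starProjection_inner_eq_zero x _ (h2 w hw)

/-- An operator in the double commutant of a unital `*`-algebra of operators lies in its strong
closure. -/
lemma exists_approx_of_bicommutant [CompleteSpace H] (S : Submodule ℂ (H →L[ℂ] H)) (h1 : 1 ∈ S)
    (hmul : ∀ A ∈ S, ∀ B ∈ S, A * B ∈ S) (hadj : ∀ A ∈ S, A.adjoint ∈ S) (X : H →L[ℂ] H)
    (hX : ∀ Y : H →L[ℂ] H, (∀ A ∈ S, Commute A Y) → Commute X Y) (F : Finset H) {ε : ℝ}
    (hε : 0 < ε) : ∃ A ∈ S, ∀ ξ ∈ F, ‖X ξ - A ξ‖ < ε := by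
  classical
  -- The vectors to be approximated on simultaneously form a single vector v of the power H^F. The
  -- claim becomes that X, acting diagonally, maps v into the closure U of the orbit of v under S.
  let v : PiLp 2 (fun _ : F => H) := WithLp.toLp 2 fun ξ => (ξ : H)
  let U₀ : Submodule ℂ (PiLp 2 fun _ : F => H) :=
    { carrier := {x | ∃ A ∈ S, diagOp A v = x}
      zero_mem' := ⟨0, S.zero_mem, by ext; simp⟩
      add_mem' := by
        rintro _ _ ⟨A, hA, rfl⟩ ⟨B, hB, rfl⟩
        exact ⟨A + B, S.add_mem hA hB, by ext; simp⟩
      smul_mem' := by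
        rintro c _ ⟨A, hA, rfl⟩
        exact ⟨c • A, S.smul_mem c hA, by ext; simp⟩ }
  set U := U₀.topologicalClosure
  have hUc : IsClosed (U : Set (PiLp 2 fun _ : F => H)) := U₀.isClosed_topologicalClosure
  have : CompleteSpace U := hUc.completeSpace_coe
  have hinv : ∀ A ∈ S, ∀ x ∈ U, diagOp A x ∈ U := fun A hA x hx =>
    map_mem_closure (diagOp A).continuous hx (by
      rintro _ ⟨B, hB, rfl⟩
      exact ⟨A * B, hmul A hA B hB, by ext; simp⟩)
  have hadjd : ∀ A : H →L[ℂ] H, (diagOp (ι := F) A).adjoint = diagOp A.adjoint := fun A => by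
    symm
    rw [ContinuousLinearMap.eq_adjoint_iff]
    intro x y
    simp [PiLp.inner_apply, ContinuousLinearMap.adjoint_inner_left]
  have hP : ∀ A ∈ S, ∀ x, U.starProjection (diagOp A x) = diagOp A (U.starProjection x) :=
    fun A hA => starProjection_commute U _ (hinv A hA) (by
      rw [hadjd]; exact hinv _ (hadj A hA))
  let E : F → (H →L[ℂ] PiLp 2 fun _ : F => H) := fun j =>
    ((PiLp.continuousLinearEquiv 2 ℂ fun _ : F => H).symm : (F → H) →L[ℂ] PiLp 2 fun _ : F => H) ∘L
      ContinuousLinearMap.single ℂ (fun _ : F => H) j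
  have hE : ∀ j (A : H →L[ℂ] H) ξ, diagOp A (E j ξ) = E j (A ξ) := fun j A ξ => by
    ext i
    by_cases hij : i = j
    · subst hij; simp [E]
    · simp [E, hij]
  have hsum : ∀ x : PiLp 2 (fun _ : F => H), x = ∑ j, E j (x j) := fun x => by
    ext i
    simp [E, Finset.sum_apply, WithLp.ofLp_sum, Pi.single_apply]
  -- The matrix entries of the projection onto U commute with S, hence with X. So the projection
  -- commutes with the diagonal action of X, which therefore preserves U.
  let Q : F → F → (H →L[ℂ] H) := fun i j => PiLp.proj 2 (fun _ : F => H) i ∘L U.starProjection ∘L E j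
  have hQ : ∀ i j, Commute X (Q i j) := fun i j => hX _ fun A hA => by
    ext ξ
    change A ((U.starProjection (E j ξ)) i) = (U.starProjection (E j (A ξ))) i
    rw [← hE, hP A hA, diagOp_apply]
  have hPX : ∀ x, U.starProjection (diagOp X x) = diagOp X (U.starProjection x) := fun x => by
    rw [hsum x]
    simp only [map_sum]
    refine Finset.sum_congr rfl fun j _ => ?_
    rw [hE]
    ext i
    have := congrArg (fun Z : H →L[ℂ] H => Z (x j)) (hQ i j).eq
    exact this.symm
  have hv : v ∈ U := subset_closure ⟨1, h1, by ext; simp⟩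
  have hXv : diagOp X v ∈ U := by
    have h3 := hPX v
    rw [Submodule.starProjection_eq_self_iff.mpr hv] at h3
    rw [← h3]
    exact Submodule.starProjection_apply_mem U _
  obtain ⟨_, ⟨A, hA, rfl⟩, hA'⟩ := Metric.mem_closure_iff.mp hXv ε hε
  refine ⟨A, hA, fun ξ hξ => ?_⟩
  rw [dist_eq_norm] at hA'
  exact (PiLp.norm_apply_le (diagOp X v - diagOp A v) ⟨ξ, hξ⟩).trans_lt hA'

end Bicommutant

end

section

/-! ### The one-site correlation form -/

/-- The Gibbs density matrix is a positive multiple of the square of an invertible Hermitian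
matrix. -/
lemma exists_gram_isUnit (β η : ℝ) : ∃ (c : ℂ) (K : SiteMat), 0 < c ∧ K.conjTranspose = K ∧
    IsUnit K ∧ rho β η = c • (K * K) := by
  have hp3 : pauli3.conjTranspose = pauli3 := by
    ext i j; fin_cases i <;> fin_cases j <;> simp [pauli3]
  have hH : (siteHam η).conjTranspose = siteHam η := by
    simp [siteHam, Matrix.conjTranspose_smul, Matrix.conjTranspose_kronecker, hp3]
  set A : SiteMat := (-(β : ℂ) / 2) • siteHam η with hA
  have hAh : A.conjTranspose = A := by
    simp [hA, Matrix.conjTranspose_smul, hH]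
  have hK : (NormedSpace.exp A).conjTranspose = NormedSpace.exp A := by
    rw [← Matrix.exp_conjTranspose, hAh]
  have hE : NormedSpace.exp (-(β : ℂ) • siteHam η) = NormedSpace.exp A * NormedSpace.exp A := by
    rw [← Matrix.exp_add_of_commute A A (Commute.refl A)]
    congr 1
    rw [hA, ← add_smul]
    congr 1
    ring
  have hu : IsUnit (NormedSpace.exp A) := Matrix.isUnit_exp A
  refine ⟨(NormedSpace.exp (-(β : ℂ) • siteHam η)).trace⁻¹, NormedSpace.exp A, ?_, hK, hu, ?_⟩
  · rw [hE]
    have h0 : 0 ≤ ((NormedSpace.exp A).conjTranspose * NormedSpace.exp A).trace :=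
      (Matrix.posSemidef_conjTranspose_mul_self (NormedSpace.exp A)).trace_nonneg
    have h1 : ((NormedSpace.exp A).conjTranspose * NormedSpace.exp A).trace ≠ 0 := by
      rw [Ne, Matrix.trace_conjTranspose_mul_self_eq_zero_iff]
      exact hu.ne_zero
    rw [hK] at h0 h1
    exact inv_pos_of_pos (lt_of_le_of_ne h0 h1.symm)
  · rw [rho, hE]

/-- The observable `∑_j z_j x_j`. -/
def obs (z : Fin 8 → ℂ) : SiteMat := ∑ j, z j • chi j

lemma obs_conjTranspose (z : Fin 8 → ℂ) : (obs z).conjTranspose = obs (star z) := by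
  simp [obs, Matrix.conjTranspose_sum, Matrix.conjTranspose_smul, chi_isHermitian]

/-- The matrix entries that flip only the first spin involve x₁, x₂, x₅, x₆, and those that flip
only the second involve x₃, x₄, x₇, x₈. Each group gives an invertible system of four equations. -/
lemma obs_eq_zero {z : Fin 8 → ℂ} (h : obs z = 0) : z = 0 := by
  have hI := Complex.I_sq
  have e : ∀ p q, obs z p q = 0 := fun p q => by rw [h]; rfl
  have a1 := e (0, 0) (1, 0)
  have a2 := e (1, 0) (0, 0)
  have a3 := e (0, 1) (1, 1)
  have a4 := e (1, 1) (0, 1)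
  have a5 := e (0, 0) (0, 1)
  have a6 := e (0, 1) (0, 0)
  have a7 := e (1, 0) (1, 1)
  have a8 := e (1, 1) (1, 0)
  simp [obs, chi, Fin.sum_univ_succ, Matrix.add_apply, pauli1, pauli2, pauli3,
    Matrix.kroneckerMap_apply] at a1 a2 a3 a4 a5 a6 a7 a8
  ext j
  fin_cases j <;> simp
  · linear_combination (a1 + a2 + a3 + a4) / 4
  · linear_combination (Complex.I / 4) * (a1 - a2 + a3 - a4) + z 1 * hI
  · linear_combination (a5 + a6 + a7 + a8) / 4
  · linear_combination (Complex.I / 4) * (a5 - a6 + a7 - a8) + z 3 * hI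
  · linear_combination (a1 + a2 - a3 - a4) / 4
  · linear_combination (Complex.I / 4) * (a1 - a2 - a3 + a4) + z 5 * hI
  · linear_combination (a5 + a6 - a7 - a8) / 4
  · linear_combination (Complex.I / 4) * (a5 - a6 - a7 + a8) + z 7 * hI

/-- The correlation matrix `C_{ij} = Tr(ρ_β x_i x_j)`. -/
def corrMat (β η : ℝ) : Matrix (Fin 8) (Fin 8) ℂ :=
  Matrix.of fun i j => siteExp β η (chi i * chi j)

/-- The sesquilinear form `(z, C w)` on `ℂ⁸`. -/
def corr (β η : ℝ) (z w : Fin 8 → ℂ) : ℂ := star z ⬝ᵥ (corrMat β η).mulVec w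

/-- The inclusion of `ℝ⁸` in `ℂ⁸`. -/
def cvec (a : Fin 8 → ℝ) : Fin 8 → ℂ := fun j => (a j : ℂ)

@[simp] lemma star_cvec (a : Fin 8 → ℝ) : star (cvec a) = cvec a := by
  ext j; simp [cvec]

lemma cvec_add (a b : Fin 8 → ℝ) : cvec (a + b) = cvec a + cvec b := by
  ext j; simp [cvec]

lemma cvec_neg (a : Fin 8 → ℝ) : cvec (-a) = -cvec a := by
  ext j; simp [cvec]

lemma cvec_zero : cvec 0 = 0 := by
  ext j; simp [cvec]

variable (β η : ℝ)

lemma siteExp_add (X Y : SiteMat) : siteExp β η (X + Y) = siteExp β η X + siteExp β η Y := by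
  simp [siteExp, mul_add]

lemma siteExp_smul (c : ℂ) (X : SiteMat) : siteExp β η (c • X) = c * siteExp β η X := by
  simp [siteExp]

lemma siteExp_sum {ι : Type*} (s : Finset ι) (f : ι → SiteMat) :
    siteExp β η (∑ i ∈ s, f i) = ∑ i ∈ s, siteExp β η (f i) := by
  simp [siteExp, Finset.mul_sum]

lemma siteExp_obs_mul (z w : Fin 8 → ℂ) : siteExp β η (obs z * obs w) = corr β η (star z) w := by
  rw [obs, obs, Finset.sum_mul_sum]
  simp only [siteExp_sum, smul_mul_assoc, mul_smul_comm, siteExp_smul,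
    corr, dotProduct, Matrix.mulVec, corrMat, Matrix.of_apply, Finset.mul_sum, star_star]
  refine Finset.sum_congr rfl fun i _ => Finset.sum_congr rfl fun j _ => ?_
  ring

lemma corr_eq_siteExp (z w : Fin 8 → ℂ) :
    corr β η z w = siteExp β η ((obs z).conjTranspose * obs w) := by
  rw [obs_conjTranspose, siteExp_obs_mul, star_star]

lemma corr_cvec (a b : Fin 8 → ℝ) :
    corr β η (cvec a) (cvec b) =
      (form (covMat β η) a b : ℂ) + (Complex.I / 2) * (form (sympMat β η) a b : ℂ) := by
  rw [corr, star_cvec]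
  simp only [dotProduct, Matrix.mulVec, corrMat, Matrix.of_apply, siteExp_chi, form, cvec,
    Finset.mul_sum, Complex.ofReal_sum, ← Finset.sum_add_distrib]
  refine Finset.sum_congr rfl fun i _ => Finset.sum_congr rfl fun j _ => ?_
  push_cast
  ring

lemma corr_add_left (z z' w : Fin 8 → ℂ) :
    corr β η (z + z') w = corr β η z w + corr β η z' w := by
  simp [corr, add_dotProduct]

lemma corr_add_right (z w w' : Fin 8 → ℂ) :
    corr β η z (w + w') = corr β η z w + corr β η z w' := by
  simp [corr, Matrix.mulVec_add]

lemma corr_neg_left (z w : Fin 8 → ℂ) : corr β η (-z) w = -corr β η z w := by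
  simp [corr]

lemma corr_neg_right (z w : Fin 8 → ℂ) : corr β η z (-w) = -corr β η z w := by
  simp [corr, Matrix.mulVec_neg]

lemma corr_smul_right (c : ℂ) (z w : Fin 8 → ℂ) :
    corr β η z (c • w) = c * corr β η z w := by
  simp [corr, Matrix.mulVec_smul]

lemma corr_smul_left (c : ℂ) (z w : Fin 8 → ℂ) :
    corr β η (c • z) w = star c * corr β η z w := by
  simp [corr]

@[simp] lemma corr_zero_right (z : Fin 8 → ℂ) : corr β η z 0 = 0 := by
  simp [corr]

lemma siteExp_conjTranspose (X : SiteMat) :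
    siteExp β η X.conjTranspose = star (siteExp β η X) := by
  rw [siteExp, siteExp, ← Matrix.trace_conjTranspose, Matrix.conjTranspose_mul,
    rho_conjTranspose, Matrix.trace_mul_comm]

lemma star_corr (z w : Fin 8 → ℂ) : star (corr β η z w) = corr β η w z := by
  rw [corr_eq_siteExp, corr_eq_siteExp, ← siteExp_conjTranspose, Matrix.conjTranspose_mul,
    Matrix.conjTranspose_conjTranspose]

lemma siteExp_conjTranspose_mul_self_pos {X : SiteMat} (hX : X ≠ 0) :
    0 < siteExp β η (X.conjTranspose * X) := by
  obtain ⟨c, K, hc, hK, hu, h⟩ := exists_gram_isUnit β η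
  have e : siteExp β η (X.conjTranspose * X) = c * ((X * K).conjTranspose * (X * K)).trace := by
    rw [siteExp, h, smul_mul_assoc, Matrix.trace_smul, mul_assoc, Matrix.trace_mul_comm,
      Matrix.conjTranspose_mul, hK, smul_eq_mul]
    simp only [mul_assoc]
  rw [e]
  refine mul_pos hc (lt_of_le_of_ne (Matrix.posSemidef_conjTranspose_mul_self _).trace_nonneg ?_)
  rw [Ne, eq_comm, Matrix.trace_conjTranspose_mul_self_eq_zero_iff]
  intro h0
  exact hX (by simpa using (hu.mul_left_eq_zero).mp h0)

/-- The value at z is Tr(ρ_β X†X) with X = ∑ z_j x_j, which is positive by faithfulness of ρ_β and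
independence of the x_j. Definiteness, not just semidefiniteness, is needed to form adjoints with
C⁻¹. -/
lemma posDef_corrMat : (corrMat β η).PosDef := by
  refine Matrix.PosDef.of_dotProduct_mulVec_pos ?_ fun z hz => ?_
  · ext i j
    simp only [corrMat, Matrix.conjTranspose_apply, Matrix.of_apply]
    rw [← siteExp_conjTranspose, Matrix.conjTranspose_mul, chi_isHermitian, chi_isHermitian]
  · change 0 < corr β η z z
    rw [corr_eq_siteExp]
    exact siteExp_conjTranspose_mul_self_pos β η fun h => hz (obs_eq_zero h)

lemma corr_self_nonneg (z : Fin 8 → ℂ) : 0 ≤ corr β η z z :=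
  (posDef_corrMat β η).posSemidef.dotProduct_mulVec_nonneg z

open scoped MatrixOrder Matrix.Norms.L2Operator in
/-- The sesquilinear form of a positive semidefinite matrix is a positive semidefinite kernel. -/
lemma posSemidef_sesqForm {n : Type*} [Fintype n] [DecidableEq n] {Q : Matrix n n ℂ}
    (hQ : Q.PosSemidef) :
    (Matrix.of fun z w : n → ℂ => star z ⬝ᵥ Q.mulVec w : Matrix (n → ℂ) (n → ℂ) ℂ).PosSemidef := by
  obtain ⟨B, rfl⟩ := CStarAlgebra.nonneg_iff_eq_star_mul_self.mp
    (Matrix.nonneg_iff_posSemidef.mpr hQ)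
  have e : (Matrix.of fun z w : n → ℂ => star z ⬝ᵥ (star B * B).mulVec w :
      Matrix (n → ℂ) (n → ℂ) ℂ) =
      ∑ m, (Matrix.of fun z w => star (B.mulVec z m) * B.mulVec w m) := by
    ext z w
    simp only [Matrix.of_apply, Matrix.sum_apply, Matrix.star_eq_conjTranspose]
    rw [← Matrix.mulVec_mulVec, Matrix.dotProduct_mulVec, Matrix.vecMul_conjTranspose, star_star]
    rfl
  rw [e]
  exact Matrix.posSemidef_sum _ fun m _ => posSemidef_rankOne fun z => B.mulVec z m

/-- The Cauchy–Schwarz inequality for the correlation form. -/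
lemma corr_cauchySchwarz (z w : Fin 8 → ℂ) :
    ‖corr β η z w‖ ^ 2 ≤ (corr β η z z).re * (corr β η w w).re := by
  -- Up to the factor (w, C w), this is the component of z orthogonal to w.
  have h := corr_self_nonneg β η ((corr β η w w) • z - (corr β η w z) • w)
  have hw := corr_self_nonneg β η w
  have hz := corr_self_nonneg β η z
  rcases eq_or_ne w 0 with rfl | hw0
  · simp
  have hw1 : 0 < (corr β η w w).re :=
    (Complex.pos_iff.mp ((posDef_corrMat β η).dotProduct_mulVec_pos hw0)).1
  have hwr : corr β η w w = ((corr β η w w).re : ℂ) := by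
    have := (Complex.nonneg_iff.mp hw).2
    apply Complex.ext <;> simp [← this]
  have hzr : corr β η z z = ((corr β η z z).re : ℂ) := by
    have := (Complex.nonneg_iff.mp hz).2
    apply Complex.ext <;> simp [← this]
  rw [sub_eq_add_neg, corr_add_left, corr_add_right, corr_add_right] at h
  simp only [corr_neg_left, corr_neg_right, corr_smul_left, corr_smul_right] at h
  have hwz : corr β η w z = star (corr β η z w) := (star_corr β η z w).symm
  have hn : (star (corr β η z w)) * corr β η z w = ((‖corr β η z w‖ ^ 2 : ℝ) : ℂ) := by
    rw [Complex.star_def, ← Complex.normSq_eq_conj_mul_self, Complex.normSq_eq_norm_sq]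
  rw [hwz, star_star, hwr, hzr] at h
  set x := (corr β η w w).re
  set y := (corr β η z z).re
  set q := corr β η z w
  have e : star (x : ℂ) * (x * y) + -(star (x : ℂ) * (star q * q)) +
      (-(q * (x * star q)) + - -(q * (star q * x))) = ((x * (x * y - ‖q‖ ^ 2) : ℝ) : ℂ) := by
    have : star (x : ℂ) = x := by simp
    rw [this]
    push_cast at hn ⊢
    rw [← hn]
    ring
  have h2 : (0 : ℂ) ≤ ((x * (x * y - ‖q‖ ^ 2) : ℝ) : ℂ) := by
    rw [← e]; convert h using 1; ring
  have h3 := Complex.zero_le_real.mp h2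
  nlinarith [nonneg_of_mul_nonneg_right h3 hw1]

end

section

/-! ### Exponential vectors in the GNS space -/

variable (β η : ℝ)

/-- The exponential vector `e^{½ (a, Σ a)} W(a) Ω`, for real `a`. -/
def expVec (a : Fin 8 → ℝ) : GNS β η :=
  Complex.exp ((1 / 2 * form (covMat β η) a a : ℝ) : ℂ) • ((weylGen β η a : WeylSpan β η) : GNS β η)

/-- The normalisation of `expVec` removes the diagonal terms of -½(b - a, Σ(b - a)). What remains is
(a, Σb) from the covariance and (i/2)(a, σb) from the Weyl phase. -/
lemma inner_expVec (a b : Fin 8 → ℝ) :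
    inner ℂ (expVec β η a) (expVec β η b) = Complex.exp (corr β η (cvec a) (cvec b)) := by
  rw [expVec, expVec, inner_smul_left, inner_smul_right, UniformSpace.Completion.inner_coe,
    inner_weylGen, weylKernel, Matrix.of_apply, weylPhase, weylVal, ← Complex.exp_conj,
    Complex.conj_ofReal, ← Complex.exp_add, ← Complex.exp_add, ← Complex.exp_add, corr_cvec]
  congr 1
  rw [sub_eq_add_neg, form_add_left, form_add_right, form_add_right, form_neg_left, form_neg_left,
    form_neg_left, form_neg_right, form_neg_right, form_covMat_symm β η b a]
  push_cast
  ring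

lemma dense_expVec : DenseRange (Finsupp.linearCombination ℂ (expVec β η)) := by
  have h : Set.range ((↑) : WeylSpan β η → GNS β η) ⊆
      Set.range (Finsupp.linearCombination ℂ (expVec β η)) := by
    rintro _ ⟨f, rfl⟩
    rw [← LinearMap.coe_range, SetLike.mem_coe]
    induction f using weylSpan_induction with
    | h0 => rw [UniformSpace.Completion.coe_zero]; exact Submodule.zero_mem _
    | hadd f g hf hg =>
      rw [UniformSpace.Completion.coe_add]
      exact Submodule.add_mem _ hf hg
    | hgen c r =>
      rw [UniformSpace.Completion.coe_smul]
      refine Submodule.smul_mem _ _ ?_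
      refine ⟨Finsupp.single r (Complex.exp ((1 / 2 * form (covMat β η) r r : ℝ) : ℂ))⁻¹, ?_⟩
      rw [Finsupp.linearCombination_single, expVec, smul_smul, inv_mul_cancel₀ (Complex.exp_ne_zero _),
        one_smul]
  exact UniformSpace.Completion.denseRange_coe.mono h

lemma gns_eq_of_inner_expVec {x y : GNS β η}
    (h : ∀ a, inner ℂ (expVec β η a) x = inner ℂ (expVec β η a) y) : x = y := by
  have h2 : ∀ ζ : GNS β η, inner ℂ ζ (x - y) = 0 := fun ζ =>
    (dense_expVec β η).induction_on (p := fun ζ => inner ℂ ζ (x - y) = 0) ζ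
      (isClosed_eq (by fun_prop) (by fun_prop)) fun f => by
        simp [Finsupp.linearCombination_apply, Finsupp.sum, sum_inner, inner_smul_left,
          inner_sub_right, h]
  exact sub_eq_zero.mp (inner_self_eq_zero.mp (h2 _))

/-- The reproducing kernel `e^{(z, C w)}` is positive semidefinite. -/
lemma posSemidef_exp_corr : (Matrix.of fun z w : Fin 8 → ℂ => Complex.exp (corr β η z w) :
    Matrix (Fin 8 → ℂ) (Fin 8 → ℂ) ℂ).PosSemidef :=
  posSemidef_exp (posSemidef_sesqForm (posDef_corrMat β η).posSemidef)

/-- The kernel e^{(z,Cw)} stays positive when one complex point z is added to the real points.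
Cauchy–Schwarz for the enlarged kernel bounds the functional ξ_a ↦ e^{(z,Ca)}, and the Riesz theorem
then represents it by a vector. -/
lemma norm_evaluation_le (z : Fin 8 → ℂ) (f : (Fin 8 → ℝ) →₀ ℂ) :
    ‖Finsupp.linearCombination ℂ (fun a => Complex.exp (corr β η z (cvec a))) f‖ ≤
      √(Complex.exp (corr β η z z)).re * ‖Finsupp.linearCombination ℂ (expVec β η) f‖ := by
  -- `none` stands for the complex point z and `some a` for the real point a.
  let ψ : Option (Fin 8 → ℝ) → (Fin 8 → ℂ) := fun o => o.elim z cvec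
  set s := Finset.insertNone f.support
  obtain ⟨B, hB⟩ := exists_gram_factor ((posSemidef_exp_corr β η).submatrix ψ) s
  have hz : none ∈ s := Finset.none_mem_insertNone
  have hs : ∀ a ∈ f.support, some a ∈ s := fun a ha => Finset.some_mem_insertNone.mpr ha
  set v : s → ℂ := fun m => ∑ a ∈ f.support, f a * B m (some a)
  have e1 : Finsupp.linearCombination ℂ (fun a => Complex.exp (corr β η z (cvec a))) f =
      ∑ m, star (B m none) * v m := by
    simp only [v, Finsupp.linearCombination_apply, Finsupp.sum, Finset.mul_sum]
    rw [Finset.sum_comm]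
    refine Finset.sum_congr rfl fun a ha => ?_
    have := hB none hz (some a) (hs a ha)
    simp only [Matrix.submatrix_apply, Matrix.of_apply, ψ, Option.elim] at this
    rw [this, smul_eq_mul, Finset.mul_sum]
    refine Finset.sum_congr rfl fun m _ => ?_
    ring
  have e2 : (Complex.exp (corr β η z z)).re = ∑ m, ‖B m none‖ ^ 2 := by
    have := hB none hz none hz
    simp only [Matrix.submatrix_apply, Matrix.of_apply, ψ, Option.elim] at this
    rw [this, Complex.re_sum]
    refine Finset.sum_congr rfl fun m _ => ?_
    rw [Complex.star_def, ← Complex.normSq_eq_conj_mul_self, Complex.ofReal_re,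
      Complex.normSq_eq_norm_sq]
  have e3 : ‖Finsupp.linearCombination ℂ (expVec β η) f‖ ^ 2 = ∑ m, ‖v m‖ ^ 2 := by
    have h1 : (inner ℂ (Finsupp.linearCombination ℂ (expVec β η) f)
        (Finsupp.linearCombination ℂ (expVec β η) f) : ℂ) = ∑ m, star (v m) * v m := by
      rw [Finsupp.linearCombination_apply, Finsupp.sum, inner_sum_smul_sum_smul]
      simp only [v, star_sum, Finset.sum_mul_sum]
      conv_rhs => rw [Finset.sum_comm]
      refine Finset.sum_congr rfl fun a ha => ?_
      conv_rhs => rw [Finset.sum_comm]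
      refine Finset.sum_congr rfl fun b hb => ?_
      have := hB (some a) (hs a ha) (some b) (hs b hb)
      simp only [Matrix.submatrix_apply, Matrix.of_apply, ψ, Option.elim] at this
      rw [inner_expVec, this, Finset.mul_sum]
      refine Finset.sum_congr rfl fun m _ => ?_
      simp only [star_mul']
      ring
    rw [inner_self_eq_norm_sq_to_K] at h1
    have h2 : ∀ m, star (v m) * v m = ((‖v m‖ ^ 2 : ℝ) : ℂ) := fun m => by
      rw [Complex.star_def, ← Complex.normSq_eq_conj_mul_self, Complex.normSq_eq_norm_sq]
    simp only [h2, ← Complex.ofReal_sum] at h1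
    exact Complex.ofReal_injective (by rw [← h1]; push_cast; rfl)
  rw [e1, e2, ← Real.sqrt_sq (norm_nonneg (Finsupp.linearCombination ℂ (expVec β η) f)), e3]
  refine (norm_sum_le_of_le _ fun m _ => ?_).trans (Real.sum_mul_le_sqrt_mul_sqrt _ _ _)
  rw [norm_mul, norm_star]

/-- The exponential vector of a complex `z`: the vector with `⟨ξ_z, e^{½(a,Σa)} W(a) Ω⟩ = e^{(z, C a)}`
for all real `a`. -/
def cohVec (z : Fin 8 → ℂ) : GNS β η :=
  (InnerProductSpace.toDual ℂ (GNS β η)).symm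
    ((Finsupp.linearCombination ℂ fun a => Complex.exp (corr β η z (cvec a))).extendOfNorm
      (Finsupp.linearCombination ℂ (expVec β η)))

lemma inner_cohVec_expVec (z : Fin 8 → ℂ) (a : Fin 8 → ℝ) :
    inner ℂ (cohVec β η z) (expVec β η a) = Complex.exp (corr β η z (cvec a)) := by
  rw [cohVec, InnerProductSpace.toDual_symm_apply]
  have := LinearMap.extendOfNorm_eq (dense_expVec β η) ⟨_, norm_evaluation_le β η z⟩
    (Finsupp.single a 1)
  simpa using this

lemma inner_expVec_cohVec (a : Fin 8 → ℝ) (z : Fin 8 → ℂ) :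
    inner ℂ (expVec β η a) (cohVec β η z) = Complex.exp (corr β η (cvec a) z) := by
  rw [← inner_conj_symm, inner_cohVec_expVec, ← Complex.exp_conj, ← star_corr β η z]
  rfl

lemma norm_cohVec_le (z : Fin 8 → ℂ) : ‖cohVec β η z‖ ≤ √(Complex.exp (corr β η z z)).re := by
  rw [cohVec, LinearIsometryEquiv.norm_map]
  exact ContinuousLinearMap.opNorm_le_bound _ (Real.sqrt_nonneg _) fun x =>
    LinearMap.norm_extendOfNorm_apply_le (dense_expVec β η) _ (norm_evaluation_le β η z) x

lemma cohVec_cvec (a : Fin 8 → ℝ) : cohVec β η (cvec a) = expVec β η a :=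
  gns_eq_of_inner_expVec β η fun b => by rw [inner_expVec_cohVec, inner_expVec]

/-- For ζ a finite combination of exponential vectors the function is explicit and entire. The norms
of the vectors ξ_{a+sb} are locally bounded in s, so approximating ζ gives locally uniform
convergence, which preserves holomorphy. -/
lemma differentiable_inner_cohVec (ζ : GNS β η) (a b : Fin 8 → ℂ) :
    Differentiable ℂ fun s : ℂ => inner ℂ ζ (cohVec β η (a + s • b)) := by
  have hne : (Filter.comap (Finsupp.linearCombination ℂ (expVec β η)) (𝓝 ζ)).NeBot :=
    Filter.comap_neBot_iff.mpr fun t ht => by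
      obtain ⟨_, hy, f, rfl⟩ := mem_closure_iff_nhds.mp (dense_expVec β η ζ) t ht
      exact ⟨f, hy⟩
  set l := Filter.comap (Finsupp.linearCombination ℂ (expVec β η)) (𝓝 ζ)
  have ht : Filter.Tendsto (Finsupp.linearCombination ℂ (expVec β η)) l (𝓝 ζ) :=
    Filter.tendsto_comap
  have hdiff : ∀ f : (Fin 8 → ℝ) →₀ ℂ, Differentiable ℂ fun s : ℂ =>
      inner ℂ (Finsupp.linearCombination ℂ (expVec β η) f) (cohVec β η (a + s • b)) := fun f => by
    simp only [Finsupp.linearCombination_apply, Finsupp.sum, sum_inner, inner_smul_left,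
      inner_expVec_cohVec, corr_add_right, corr_smul_right]
    fun_prop
  set bd : ℂ → ℝ := fun s => √(Complex.exp (corr β η (a + s • b) (a + s • b))).re
  have hbd : Continuous bd := by
    simp only [bd, corr_add_right, corr_smul_right, corr_add_left, corr_smul_left]
    fun_prop
  have hu : TendstoLocallyUniformlyOn (fun f (s : ℂ) => inner ℂ
      (Finsupp.linearCombination ℂ (expVec β η) f) (cohVec β η (a + s • b)))
      (fun s => inner ℂ ζ (cohVec β η (a + s • b))) l Set.univ := by
    rw [Metric.tendstoLocallyUniformlyOn_iff]
    intro ε hε s₀ _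
    refine ⟨{s | bd s < bd s₀ + 1}, ?_, ?_⟩
    · rw [nhdsWithin_univ]
      exact (isOpen_lt hbd continuous_const).mem_nhds (by simp)
    · have hpos : 0 < bd s₀ + 1 := by positivity
      filter_upwards [ht (Metric.ball_mem_nhds ζ (div_pos hε hpos))] with f hf s hs
      rw [dist_eq_norm, ← inner_sub_left]
      rw [Set.mem_preimage, Metric.mem_ball, dist_comm, dist_eq_norm] at hf
      calc _ ≤ ‖ζ - Finsupp.linearCombination ℂ (expVec β η) f‖ * ‖cohVec β η (a + s • b)‖ :=
            norm_inner_le_norm _ _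
        _ ≤ ‖ζ - Finsupp.linearCombination ℂ (expVec β η) f‖ * (bd s₀ + 1) := by
            gcongr
            exact (norm_cohVec_le β η _).trans (le_of_lt hs)
        _ < ε / (bd s₀ + 1) * (bd s₀ + 1) := by gcongr
        _ = ε := by field_simp
  exact differentiableOn_univ.mp (hu.differentiableOn
    (Filter.Eventually.of_forall fun f => (hdiff f).differentiableOn) isOpen_univ)

/-- The exponential vectors have the Gram kernel `e^{(z, C w)}`. -/
lemma inner_cohVec (z w : Fin 8 → ℂ) :
    inner ℂ (cohVec β η z) (cohVec β η w) = Complex.exp (corr β η z w) := by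
  let a : Fin 8 → ℝ := fun j => (w j).re
  let b : Fin 8 → ℝ := fun j => (w j).im
  have hw : w = cvec a + Complex.I • cvec b := by
    ext j
    simp only [Pi.add_apply, Pi.smul_apply, cvec, a, b, smul_eq_mul]
    rw [mul_comm]
    exact (Complex.re_add_im (w j)).symm
  have h1 : AnalyticOnNhd ℂ (fun s : ℂ => (inner ℂ (cohVec β η z)
      (cohVec β η (cvec a + s • cvec b)) : ℂ)) Set.univ :=
    (differentiable_inner_cohVec β η (cohVec β η z) (cvec a)
      (cvec b)).differentiableOn.analyticOnNhd isOpen_univ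
  have h2 : AnalyticOnNhd ℂ (fun s : ℂ => Complex.exp (corr β η z (cvec a + s • cvec b)))
      Set.univ := by
    refine DifferentiableOn.analyticOnNhd (Differentiable.differentiableOn ?_) isOpen_univ
    simp only [corr_add_right, corr_smul_right]
    fun_prop
  -- For real s the label is a real vector and the identity is known. Both sides are entire in s, so
  -- it holds at s = i, where the label is w.
  have h3 : ∃ᶠ s in 𝓝[≠] (0 : ℂ), inner ℂ (cohVec β η z) (cohVec β η (cvec a + s • cvec b)) =
      Complex.exp (corr β η z (cvec a + s • cvec b)) := by
    have ht : Filter.Tendsto (fun x : ℝ => (x : ℂ)) (𝓝[≠] 0) (𝓝[≠] 0) := by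
      refine tendsto_nhdsWithin_of_tendsto_nhds_of_eventually_within _ ?_ ?_
      · exact (Complex.continuous_ofReal.tendsto' 0 0 (by simp)).mono_left nhdsWithin_le_nhds
      · filter_upwards [self_mem_nhdsWithin] with x hx
        simpa using hx
    refine ht.frequently (Filter.Frequently.of_forall fun x => ?_)
    have : cvec a + (x : ℂ) • cvec b = cvec (a + x • b) := by
      ext j; simp [cvec]
    rw [this, cohVec_cvec, inner_cohVec_expVec]
  have h4 := congrFun (h1.eq_of_frequently_eq h2 h3) Complex.I
  rw [hw]
  exact h4

lemma vacuum_eq_cohVec : vacuum β η = cohVec β η 0 := by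
  rw [← cvec_zero, cohVec_cvec, expVec, vacuum]
  simp [form]

lemma weylOp_expVec (r a : Fin 8 → ℝ) :
    weylOp β η r (expVec β η a) = Complex.exp (-((1 / 2 * form (covMat β η) r r : ℝ) : ℂ) -
      corr β η (cvec r) (cvec a)) • expVec β η (r + a) := by
  rw [expVec, expVec, map_smul, weylOp_coe, weylMul_gen, UniformSpace.Completion.coe_smul,
    smul_smul, smul_smul, weylPhase, ← Complex.exp_add, ← Complex.exp_add, corr_cvec]
  congr 2
  rw [form_add_left, form_add_right, form_add_right, form_covMat_symm β η a r]
  push_cast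
  ring

/-- The action of the Weyl operators on the exponential vectors. -/
lemma weylOp_cohVec (r : Fin 8 → ℝ) (z : Fin 8 → ℂ) :
    weylOp β η r (cohVec β η z) = Complex.exp (-((1 / 2 * form (covMat β η) r r : ℝ) : ℂ) -
      corr β η (cvec r) z) • cohVec β η (cvec r + z) := by
  refine gns_eq_of_inner_expVec β η fun a => ?_
  have h : ContinuousLinearMap.adjoint (weylOp β η (-r)) = weylOp β η r := by
    rw [adjoint_weylOp, neg_neg]
  rw [← h, ContinuousLinearMap.adjoint_inner_right, weylOp_expVec, inner_smul_left,
    inner_smul_right, inner_expVec_cohVec, inner_expVec_cohVec, ← Complex.exp_conj,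
    ← Complex.exp_add, ← Complex.exp_add]
  congr 1
  simp only [map_sub, map_neg, Complex.conj_ofReal, cvec_add, cvec_neg, corr_add_left,
    corr_neg_left, corr_add_right, form_neg_left, form_neg_right]
  have := star_corr β η (cvec r) (cvec a)
  rw [Complex.star_def] at this
  rw [this]
  ring_nf

lemma dense_cohVec : DenseRange (Finsupp.linearCombination ℂ (cohVec β η)) := by
  refine (dense_expVec β η).mono ?_
  rintro _ ⟨f, rfl⟩
  refine ⟨f.mapDomain cvec, ?_⟩
  rw [Finsupp.linearCombination_mapDomain]
  congr 2
  ext a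
  exact cohVec_cvec β η a

end

section

/-! ### Quasi-free maps -/

variable {β η : ℝ}

/-- A real matrix, acting on `ℂ⁸`. -/
def complexify (M : Matrix (Fin 8) (Fin 8) ℝ) : Matrix (Fin 8) (Fin 8) ℂ := M.map (fun x => (x : ℂ))

lemma complexify_mulVec_cvec (M : Matrix (Fin 8) (Fin 8) ℝ) (r : Fin 8 → ℝ) :
    (complexify M).mulVec (cvec r) = cvec (M.mulVec r) := by
  ext j
  simp [complexify, cvec, Matrix.mulVec, dotProduct]

lemma complexify_mul (M N : Matrix (Fin 8) (Fin 8) ℝ) :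
    complexify (M * N) = complexify M * complexify N := by
  ext i j
  simp [complexify, Matrix.mul_apply]

lemma star_complexify_mulVec (M : Matrix (Fin 8) (Fin 8) ℝ) (z : Fin 8 → ℂ) :
    star ((complexify M).mulVec z) = (complexify M).mulVec (star z) := by
  ext j
  simp [complexify, Matrix.mulVec, dotProduct]

variable (β η) in
/-- A real matrix contracts the correlation form. -/
def CorrContraction (M : Matrix (Fin 8) (Fin 8) ℝ) : Prop :=
  ∀ z, (corr β η ((complexify M).mulVec z) ((complexify M).mulVec z)).re ≤ (corr β η z z).re

variable (β η) in
/-- The adjoint `C⁻¹ Mᵀ C` of `M` for the correlation form. -/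
def corrAdjoint (M : Matrix (Fin 8) (Fin 8) ℝ) : Matrix (Fin 8) (Fin 8) ℂ :=
  (corrMat β η)⁻¹ * (complexify M).transpose * corrMat β η

variable (β η) in
lemma isUnit_det_corrMat : IsUnit (corrMat β η).det :=
  (Matrix.isUnit_iff_isUnit_det _).mp (posDef_corrMat β η).isUnit

lemma corr_corrAdjoint (M : Matrix (Fin 8) (Fin 8) ℝ) (z w : Fin 8 → ℂ) :
    corr β η z ((corrAdjoint β η M).mulVec w) = corr β η ((complexify M).mulVec z) w := by
  rw [corr, corr, corrAdjoint, Matrix.mulVec_mulVec, mul_assoc,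
    Matrix.mul_nonsing_inv_cancel_left _ _ (isUnit_det_corrMat β η), ← Matrix.mulVec_mulVec,
    Matrix.dotProduct_mulVec, Matrix.vecMul_transpose, star_complexify_mulVec]

lemma corr_corrAdjoint_left (M : Matrix (Fin 8) (Fin 8) ℝ) (z w : Fin 8 → ℂ) :
    corr β η ((corrAdjoint β η M).mulVec z) w = corr β η z ((complexify M).mulVec w) := by
  rw [← star_corr, corr_corrAdjoint, star_corr]

lemma corrAdjoint_mul (M N : Matrix (Fin 8) (Fin 8) ℝ) :
    corrAdjoint β η (M * N) = corrAdjoint β η N * corrAdjoint β η M := by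
  simp only [corrAdjoint, complexify_mul, Matrix.transpose_mul, mul_assoc]
  rw [Matrix.mul_nonsing_inv_cancel_left _ _ (isUnit_det_corrMat β η)]

lemma corrAdjoint_one : corrAdjoint β η 1 = 1 := by
  have : complexify 1 = 1 := by
    ext i j
    by_cases h : i = j <;> simp [complexify, Matrix.one_apply, h]
  rw [corrAdjoint, this, Matrix.transpose_one, mul_one,
    Matrix.nonsing_inv_mul _ (isUnit_det_corrMat β η)]

/-- For y = Tz one has (y, Cy) = (My, Cz). Cauchy–Schwarz and the contractivity of M give (y, Cy)² ≤
(y, Cy)(z, Cz). -/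
lemma CorrContraction.adjoint_le {M : Matrix (Fin 8) (Fin 8) ℝ} (hM : CorrContraction β η M)
    (z : Fin 8 → ℂ) :
    (corr β η ((corrAdjoint β η M).mulVec z) ((corrAdjoint β η M).mulVec z)).re ≤
      (corr β η z z).re := by
  set y := (corrAdjoint β η M).mulVec z
  have h0 := (Complex.nonneg_iff.mp (corr_self_nonneg β η y)).1
  have h1 : corr β η y y = corr β η ((complexify M).mulVec y) z := corr_corrAdjoint M y z
  have h2 := corr_cauchySchwarz β η ((complexify M).mulVec y) z
  rw [← h1] at h2
  have h3 : (corr β η y y).re ^ 2 ≤ ‖corr β η y y‖ ^ 2 :=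
    sq_le_sq' (by linarith [norm_nonneg (corr β η y y)]) (Complex.re_le_norm _)
  have h4 := hM y
  have hz := (Complex.nonneg_iff.mp (corr_self_nonneg β η z)).1
  by_contra! hlt
  nlinarith [mul_le_mul_of_nonneg_right h4 hz]

/-- The kernel `e^{(z, C w) - (T z, C T w)}`, `T` the adjoint of a contraction of the correlation
form, is positive semidefinite. -/
lemma CorrContraction.posSemidef {M : Matrix (Fin 8) (Fin 8) ℝ} (hM : CorrContraction β η M) :
    (Matrix.of fun z w : Fin 8 → ℂ => Complex.exp (corr β η z w -
      corr β η ((corrAdjoint β η M).mulVec z) ((corrAdjoint β η M).mulVec w)) :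
      Matrix (Fin 8 → ℂ) (Fin 8 → ℂ) ℂ).PosSemidef := by
  set T := corrAdjoint β η M
  -- The exponent is the sesquilinear form of Q, and Q ≥ 0 says that T is a contraction; entrywise
  -- exponentiation keeps positivity.
  set Q := corrMat β η - T.conjTranspose * corrMat β η * T
  have hQ : ∀ z w, star z ⬝ᵥ Q.mulVec w = corr β η z w - corr β η (T.mulVec z) (T.mulVec w) := by
    intro z w
    simp only [Q, Matrix.sub_mulVec, dotProduct_sub, corr, Matrix.star_mulVec,
      ← Matrix.mulVec_mulVec]
    rw [Matrix.dotProduct_mulVec (star z) T.conjTranspose]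
  have hherm := (posDef_corrMat β η).isHermitian
  have hQ' : Q.PosSemidef := by
    refine Matrix.PosSemidef.of_dotProduct_mulVec_nonneg ?_ fun z => ?_
    · refine hherm.sub ?_
      exact Matrix.isHermitian_conjTranspose_mul_mul T hherm
    · rw [hQ, sub_nonneg]
      refine Complex.le_def.mpr ⟨hM.adjoint_le z, ?_⟩
      rw [← (Complex.nonneg_iff.mp (corr_self_nonneg β η z)).2,
        ← (Complex.nonneg_iff.mp (corr_self_nonneg β η _)).2]
  have := posSemidef_exp (posSemidef_sesqForm hQ')
  simpa only [Matrix.of_apply, hQ] using this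

/-- The Schur multiplier data of a quasi-free map. -/
def CorrContraction.datum {M : Matrix (Fin 8) (Fin 8) ℝ} (hM : CorrContraction β η M) :
    SchurDatum (Fin 8 → ℂ) (GNS β η) where
  e := cohVec β η
  -- T need not be real even though M is, which is why exponential vectors at complex points are
  -- required.
  u z := cohVec β η ((corrAdjoint β η M).mulVec z)
  κ := Matrix.of fun z w => Complex.exp (corr β η z w -
      corr β η ((corrAdjoint β η M).mulVec z) ((corrAdjoint β η M).mulVec w))
  dense := dense_cohVec β η
  psd := hM.posSemidef
  inner_e z w := by
    simp only [inner_cohVec, Matrix.of_apply, ← Complex.exp_add, sub_add_cancel]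

/-- The quasi-free map on the bounded operators of the GNS space. -/
def CorrContraction.map {M : Matrix (Fin 8) (Fin 8) ℝ} (hM : CorrContraction β η M) :
    (GNS β η →L[ℂ] GNS β η) →ₗ[ℂ] (GNS β η →L[ℂ] GNS β η) := hM.datum.multiplier

lemma CorrContraction.inner_map {M : Matrix (Fin 8) (Fin 8) ℝ} (hM : CorrContraction β η M)
    (X : GNS β η →L[ℂ] GNS β η) (z w : Fin 8 → ℂ) :
    inner ℂ (cohVec β η z) (hM.map X (cohVec β η w)) =
      Complex.exp (corr β η z w - corr β η ((corrAdjoint β η M).mulVec z)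
        ((corrAdjoint β η M).mulVec w)) *
      inner ℂ (cohVec β η ((corrAdjoint β η M).mulVec z))
        (X (cohVec β η ((corrAdjoint β η M).mulVec w))) :=
  hM.datum.inner_multiplier_e X z w

lemma gns_ext_cohVec {X Y : GNS β η →L[ℂ] GNS β η}
    (h : ∀ z w, inner ℂ (cohVec β η z) (X (cohVec β η w)) =
      inner ℂ (cohVec β η z) (Y (cohVec β η w))) : X = Y := by
  -- The trivial contraction supplies a Schur datum whose total family is `cohVec`; only that
  -- totality matters here.
  have h1 : CorrContraction β η 1 := fun z => by
    have : complexify 1 = 1 := by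
      ext i j
      by_cases h : i = j <;> simp [complexify, Matrix.one_apply, h]
    rw [this, Matrix.one_mulVec]
  exact h1.datum.inner_ext h

lemma CorrContraction.map_one {M : Matrix (Fin 8) (Fin 8) ℝ} (hM : CorrContraction β η M)
    (h1 : M = 1) (X : GNS β η →L[ℂ] GNS β η) : hM.map X = X := by
  subst h1
  refine gns_ext_cohVec fun z w => ?_
  rw [hM.inner_map, corrAdjoint_one, Matrix.one_mulVec, Matrix.one_mulVec, sub_self,
    Complex.exp_zero, one_mul]

/-- Taking adjoints reverses products, which matches the order in which the labels are transformed,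
and the exponents of the two kernels telescope. The product enters as an equation because it is
applied to matrix exponentials. -/
lemma CorrContraction.map_map {M N P : Matrix (Fin 8) (Fin 8) ℝ} (hM : CorrContraction β η M)
    (hN : CorrContraction β η N) (hP : CorrContraction β η P) (h : P = M * N)
    (X : GNS β η →L[ℂ] GNS β η) : hP.map X = hM.map (hN.map X) := by
  subst h
  refine gns_ext_cohVec fun z w => ?_
  rw [hP.inner_map, hM.inner_map, hN.inner_map, corrAdjoint_mul, ← Matrix.mulVec_mulVec,
    ← Matrix.mulVec_mulVec, ← mul_assoc, ← Complex.exp_add]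
  congr 2
  ring

/-- The matrix element ⟨ξ_z, W(r) ξ_w⟩ is the exponential of -½(r,Σr) + (z,Cr) - (r,Cw) + (z,Cw).
Passing to Tz and Tw turns r into Mr in the two linear terms, and the kernel restores (z,Cw). The
mismatch in the quadratic term is the scalar factor. -/
lemma CorrContraction.map_weylOp {M : Matrix (Fin 8) (Fin 8) ℝ} (hM : CorrContraction β η M)
    (r : Fin 8 → ℝ) : hM.map (weylOp β η r) =
      Complex.exp ((-(1 / 2) * (form (covMat β η) r r -
        form (covMat β η) (M.mulVec r) (M.mulVec r)) : ℝ) : ℂ) • weylOp β η (M.mulVec r) := by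
  refine gns_ext_cohVec fun z w => ?_
  rw [hM.inner_map, weylOp_cohVec, FunLike.coe_smul, Pi.smul_apply, weylOp_cohVec,
    inner_smul_right, inner_smul_right, inner_smul_right, inner_cohVec, inner_cohVec,
    ← Complex.exp_add, ← Complex.exp_add, ← Complex.exp_add, ← Complex.exp_add]
  congr 1
  simp only [corr_add_right, corr_corrAdjoint, corr_corrAdjoint_left, complexify_mulVec_cvec]
  push_cast
  ring

/-- The vacuum is ξ_0, its label is fixed by T, and the kernel equals 1 at (0, 0). -/
lemma CorrContraction.mesoState_map {M : Matrix (Fin 8) (Fin 8) ℝ} (hM : CorrContraction β η M)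
    (X : GNS β η →L[ℂ] GNS β η) : mesoState β η (hM.map X) = mesoState β η X := by
  rw [mesoState, mesoState, vacuum_eq_cohVec, hM.inner_map]
  simp

/-! ### Invariance of the fluctuation algebra -/

/-- The linear span of the Weyl operators. -/
def weylSpanOp (β η : ℝ) : Submodule ℂ (GNS β η →L[ℂ] GNS β η) :=
  Submodule.span ℂ (Set.range (weylOp β η))

lemma weylOp_mem_weylSpanOp (r : Fin 8 → ℝ) : weylOp β η r ∈ weylSpanOp β η :=
  Submodule.subset_span ⟨r, rfl⟩

lemma weylSpanOp_mul {A B : GNS β η →L[ℂ] GNS β η} (hA : A ∈ weylSpanOp β η)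
    (hB : B ∈ weylSpanOp β η) : A * B ∈ weylSpanOp β η := by
  induction hA using Submodule.span_induction with
  | zero => rw [zero_mul]; exact Submodule.zero_mem _
  | add x y _ _ hx hy => rw [add_mul]; exact Submodule.add_mem _ hx hy
  | smul c x _ hx => rw [smul_mul_assoc]; exact Submodule.smul_mem _ c hx
  | mem x hx =>
    obtain ⟨r, rfl⟩ := hx
    induction hB using Submodule.span_induction with
    | zero => rw [mul_zero]; exact Submodule.zero_mem _
    | add x y _ _ hx hy => rw [mul_add]; exact Submodule.add_mem _ hx hy
    | smul c x _ hx => rw [mul_smul_comm]; exact Submodule.smul_mem _ c hx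
    | mem y hy =>
      obtain ⟨s, rfl⟩ := hy
      rw [weylOp_mul]
      exact Submodule.smul_mem _ _ (weylOp_mem_weylSpanOp _)

lemma weylSpanOp_adjoint {A : GNS β η →L[ℂ] GNS β η} (hA : A ∈ weylSpanOp β η) :
    ContinuousLinearMap.adjoint A ∈ weylSpanOp β η := by
  induction hA using Submodule.span_induction with
  | zero => rw [map_zero]; exact Submodule.zero_mem _
  | add x y _ _ hx hy => rw [map_add]; exact Submodule.add_mem _ hx hy
  | smul c x _ hx => rw [LinearIsometryEquiv.map_smulₛₗ]; exact Submodule.smul_mem _ _ hx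
  | mem x hx =>
    obtain ⟨r, rfl⟩ := hx
    rw [adjoint_weylOp]
    exact weylOp_mem_weylSpanOp _

/-- Operators in the double commutant of the Weyl operators lie in the fluctuation algebra. -/
lemma mem_fluctAlg_of_bicommutant {X : GNS β η →L[ℂ] GNS β η}
    (hX : ∀ Y, (∀ A ∈ weylSpanOp β η, Commute A Y) → Commute X Y) : X ∈ fluctAlg β η :=
  fun F _ hε => exists_approx_of_bicommutant (weylSpanOp β η)
    (weylOp_zero β η ▸ weylOp_mem_weylSpanOp 0) (fun _ hA _ hB => weylSpanOp_mul hA hB)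
    (fun _ hA => weylSpanOp_adjoint hA) X hX F hε

/-- An identity between matrix elements extends from the Weyl operators to the fluctuation
algebra. -/
lemma inner_eq_of_mem_fluctAlg {X : GNS β η →L[ℂ] GNS β η} (hX : X ∈ fluctAlg β η)
    {x₁ y₁ x₂ y₂ : GNS β η}
    (h : ∀ A ∈ weylSpanOp β η, (inner ℂ x₁ (A y₁) : ℂ) = inner ℂ x₂ (A y₂)) :
    (inner ℂ x₁ (X y₁) : ℂ) = inner ℂ x₂ (X y₂) := by
  classical
  refine eq_of_forall_dist_le fun ε hε => ?_
  have hpos : 0 < ‖x₁‖ + ‖x₂‖ + 1 := by positivity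
  obtain ⟨A, hA, hA'⟩ := hX {y₁, y₂} (ε / (‖x₁‖ + ‖x₂‖ + 1)) (div_pos hε hpos)
  have e : (inner ℂ x₁ (X y₁) : ℂ) - inner ℂ x₂ (X y₂) =
      inner ℂ x₁ (X y₁ - A y₁) - inner ℂ x₂ (X y₂ - A y₂) := by
    rw [inner_sub_right, inner_sub_right, h A hA]
    ring
  rw [dist_eq_norm, e]
  have h1 := (norm_inner_le_norm (𝕜 := ℂ) x₁ (X y₁ - A y₁)).trans
    (mul_le_mul_of_nonneg_left (hA' y₁ (by simp)).le (norm_nonneg _))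
  have h2 := (norm_inner_le_norm (𝕜 := ℂ) x₂ (X y₂ - A y₂)).trans
    (mul_le_mul_of_nonneg_left (hA' y₂ (by simp)).le (norm_nonneg _))
  calc _ ≤ ‖x₁‖ * (ε / (‖x₁‖ + ‖x₂‖ + 1)) + ‖x₂‖ * (ε / (‖x₁‖ + ‖x₂‖ + 1)) :=
        (norm_sub_le _ _).trans (add_le_add h1 h2)
    _ ≤ (‖x₁‖ + ‖x₂‖ + 1) * (ε / (‖x₁‖ + ‖x₂‖ + 1)) := by
        have := (div_pos hε hpos).le
        nlinarith
    _ = ε := by field_simp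

lemma CorrContraction.map_mem_weylSpanOp {M : Matrix (Fin 8) (Fin 8) ℝ}
    (hM : CorrContraction β η M) {A : GNS β η →L[ℂ] GNS β η} (hA : A ∈ weylSpanOp β η) :
    hM.map A ∈ weylSpanOp β η := by
  induction hA using Submodule.span_induction with
  | zero => rw [_root_.map_zero]; exact Submodule.zero_mem _
  | add x y _ _ hx hy => rw [map_add]; exact Submodule.add_mem _ hx hy
  | smul c x _ hx => rw [map_smul]; exact Submodule.smul_mem _ _ hx
  | mem x hx =>
    obtain ⟨r, rfl⟩ := hx
    rw [hM.map_weylOp]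
    exact Submodule.smul_mem _ _ (weylOp_mem_weylSpanOp _)

/-- Let Y commute with the Weyl operators. The matrix elements of Φ(X)Y and YΦ(X) at exponential
vectors are matrix elements of X between vectors independent of X. Their equality on the Weyl span,
which Φ preserves, therefore passes to its strong closure, and the double commutant theorem applies.
No strong continuity of Φ is needed. -/
lemma CorrContraction.map_mem_fluctAlg {M : Matrix (Fin 8) (Fin 8) ℝ}
    (hM : CorrContraction β η M) {X : GNS β η →L[ℂ] GNS β η} (hX : X ∈ fluctAlg β η) :
    hM.map X ∈ fluctAlg β η := by
  refine mem_fluctAlg_of_bicommutant fun Y hY => gns_ext_cohVec fun z w => ?_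
  have hl : ∀ X : GNS β η →L[ℂ] GNS β η,
      (inner ℂ (cohVec β η z) ((hM.map X * Y) (cohVec β η w)) : ℂ) =
      inner ℂ (hM.datum.u z) (X (hM.datum.row z (Y (cohVec β η w)))) := fun X =>
    hM.datum.inner_multiplier_left X z (Y (cohVec β η w))
  have hr : ∀ X : GNS β η →L[ℂ] GNS β η,
      (inner ℂ (cohVec β η z) ((Y * hM.map X) (cohVec β η w)) : ℂ) =
      inner ℂ (hM.datum.row w (ContinuousLinearMap.adjoint Y (cohVec β η z)))
        (X (hM.datum.u w)) := fun X => by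
    rw [← hM.datum.inner_multiplier_right, ContinuousLinearMap.adjoint_inner_left]
    rfl
  rw [hl, hr]
  refine inner_eq_of_mem_fluctAlg hX fun A hA => ?_
  rw [← hl, ← hr, (hY _ (hM.map_mem_weylSpanOp hA)).eq]

/-- The quasi-free map on the fluctuation algebra. -/
def CorrContraction.fluctMap {M : Matrix (Fin 8) (Fin 8) ℝ} (hM : CorrContraction β η M) :
    fluctAlg β η →ₗ[ℂ] fluctAlg β η :=
  hM.map.restrict fun _ hX => hM.map_mem_fluctAlg hX

lemma CorrContraction.coe_fluctMap {M : Matrix (Fin 8) (Fin 8) ℝ} (hM : CorrContraction β η M)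
    (X : fluctAlg β η) : (hM.fluctMap X : GNS β η →L[ℂ] GNS β η) = hM.map X := rfl

lemma CorrContraction.isCompletelyPositive {M : Matrix (Fin 8) (Fin 8) ℝ}
    (hM : CorrContraction β η M) : IsCompletelyPositive hM.fluctMap := fun _ A hA ξ =>
  hM.datum.multiplier_completelyPositive (fun i j => (A i j : GNS β η →L[ℂ] GNS β η)) hA ξ

lemma form_mul_mulVec (M S : Matrix (Fin 8) (Fin 8) ℝ) (r : Fin 8 → ℝ) :
    form (M.transpose * S * M) r r = form S (M.mulVec r) (M.mulVec r) := by
  rw [form, form, ← Matrix.mulVec_mulVec, ← Matrix.mulVec_mulVec, Matrix.dotProduct_mulVec,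
    Matrix.vecMul_transpose]

lemma damping_eq (L : Matrix (Fin 8) (Fin 8) ℝ) (t : ℝ) (r : Fin 8 → ℝ) :
    damping β η L t r = -(1 / 2) * (form (covMat β η) r r -
      form (covMat β η) (evolved L t r) (evolved L t r)) := by
  have h : NormedSpace.exp (t • L) = (NormedSpace.exp (t • L.transpose)).transpose := by
    rw [← Matrix.exp_transpose, Matrix.transpose_smul, Matrix.transpose_transpose]
  rw [damping, h, evolved, ← form_mul_mulVec]
  simp [form, Matrix.sub_mulVec]

end

section

/-! ### Product operators on the local algebras -/

variable {N : ℕ}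

/-- The tensor product `⨂_k f_k`. -/
def prodOp (f : Fin N → SiteMat) : LocalAlg N :=
  Matrix.of fun s s' => ∏ k, f k (s k) (s' k)

lemma prodOp_mul (f g : Fin N → SiteMat) : prodOp f * prodOp g = prodOp (fun k => f k * g k) := by
  ext s s'
  simp only [Matrix.mul_apply, prodOp, Matrix.of_apply, ← Finset.prod_mul_distrib]
  rw [Finset.prod_univ_sum, Fintype.piFinset_univ]

lemma trace_prodOp (f : Fin N → SiteMat) : (prodOp f).trace = ∏ k, (f k).trace := by
  simp only [Matrix.trace, Matrix.diag, prodOp, Matrix.of_apply]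
  rw [Finset.prod_univ_sum, Fintype.piFinset_univ]

lemma prodOp_conjTranspose (f : Fin N → SiteMat) :
    (prodOp f).conjTranspose = prodOp fun k => (f k).conjTranspose := by
  ext s s'
  simp [prodOp, Matrix.conjTranspose_apply]

lemma siteOp_eq_prodOp (k : Fin N) (x : SiteMat) :
    siteOp k x = prodOp fun j => if j = k then x else 1 := by
  ext s s'
  simp only [siteOp, prodOp, Matrix.of_apply]
  rw [← Finset.mul_prod_erase _ _ (Finset.mem_univ k), if_pos rfl]
  have h : ∏ j ∈ Finset.univ.erase k, (if j = k then x else (1 : SiteMat)) (s j) (s' j) =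
      ∏ j ∈ Finset.univ.erase k, if s j = s' j then (1 : ℂ) else 0 :=
    Finset.prod_congr rfl fun j hj => by
      rw [if_neg (Finset.ne_of_mem_erase hj), Matrix.one_apply]
  rw [h, Finset.prod_ite_zero]
  simp only [Finset.prod_const_one, Finset.mem_erase, Finset.mem_univ, and_true]
  split_ifs <;> simp

lemma prodOp_one : prodOp (fun _ : Fin N => (1 : SiteMat)) = 1 := by
  ext s s'
  simp only [prodOp, Matrix.of_apply, Matrix.one_apply, Finset.prod_ite_zero,
    Finset.prod_const_one, funext_iff, Finset.mem_univ, true_implies]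

lemma siteOp_mul (k : Fin N) (x y : SiteMat) : siteOp k (x * y) = siteOp k x * siteOp k y := by
  rw [siteOp_eq_prodOp, siteOp_eq_prodOp, siteOp_eq_prodOp, prodOp_mul]
  congr 1
  ext1 j
  split_ifs <;> simp

lemma siteOp_add (k : Fin N) (x y : SiteMat) : siteOp k (x + y) = siteOp k x + siteOp k y := by
  ext s s'
  simp only [siteOp, Matrix.of_apply, Matrix.add_apply]
  split_ifs <;> simp

lemma siteOp_smul (k : Fin N) (c : ℂ) (x : SiteMat) : siteOp k (c • x) = c • siteOp k x := by
  ext s s'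
  simp only [siteOp, Matrix.of_apply, Matrix.smul_apply]
  split_ifs <;> simp

lemma siteOp_one (k : Fin N) : siteOp k (1 : SiteMat) = 1 := by
  rw [siteOp_eq_prodOp, ← prodOp_one]
  congr 1
  ext1 j
  split_ifs <;> rfl

lemma siteOp_conjTranspose (k : Fin N) (x : SiteMat) :
    (siteOp k x).conjTranspose = siteOp k x.conjTranspose := by
  rw [siteOp_eq_prodOp, siteOp_eq_prodOp, prodOp_conjTranspose]
  congr 1
  ext1 j
  split_ifs <;> simp

/-- The embedding of the one-site algebra at the site `k`. -/
def siteHom (k : Fin N) : SiteMat →⋆ₐ[ℂ] LocalAlg N where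
  toFun := siteOp k
  map_one' := siteOp_one k
  map_mul' := siteOp_mul k
  map_zero' := by simpa using siteOp_smul k 0 0
  map_add' := siteOp_add k
  commutes' c := by
    rw [Algebra.algebraMap_eq_smul_one, Algebra.algebraMap_eq_smul_one, siteOp_smul, siteOp_one]
  map_star' x := (siteOp_conjTranspose k x).symm

lemma siteOp_sub (k : Fin N) (x y : SiteMat) : siteOp k (x - y) = siteOp k x - siteOp k y :=
  map_sub (siteHom k) x y

lemma siteOp_sum {ι : Type*} (k : Fin N) (s : Finset ι) (f : ι → SiteMat) :
    siteOp k (∑ i ∈ s, f i) = ∑ i ∈ s, siteOp k (f i) := map_sum (siteHom k) f s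

lemma siteOp_commute {k l : Fin N} (h : k ≠ l) (x y : SiteMat) :
    siteOp k x * siteOp l y = siteOp l y * siteOp k x := by
  simp only [siteOp_eq_prodOp, prodOp_mul]
  congr 1
  ext1 j
  by_cases hk : j = k
  · have : j ≠ l := fun h' => h (hk.symm.trans h')
    simp [hk, h]
  · simp [hk]

open scoped Matrix.Norms.L2Operator in
lemma exp_siteOp (k : Fin N) (y : SiteMat) :
    NormedSpace.exp (siteOp k y) = siteOp k (NormedSpace.exp y) := by
  have hc : Continuous (siteHom k : SiteMat → LocalAlg N) :=
    LinearMap.continuous_of_finiteDimensional (siteHom k).toAlgHom.toLinearMap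
  let : NormedAlgebra ℚ SiteMat := .restrictScalars ℚ ℂ SiteMat
  exact (NormedSpace.map_exp (siteHom k) hc y).symm

lemma exp_sum_siteOp (y : Fin N → SiteMat) :
    NormedSpace.exp (∑ k, siteOp k (y k)) = prodOp fun k => NormedSpace.exp (y k) := by
  have h : ∀ s : Finset (Fin N), NormedSpace.exp (∑ k ∈ s, siteOp k (y k)) =
      prodOp fun k => if k ∈ s then NormedSpace.exp (y k) else 1 := by
    intro s
    induction s using Finset.induction_on with
    | empty => simp [prodOp_one]
    | insert k s hk ih =>
      rw [Finset.sum_insert hk, Matrix.exp_add_of_commute, ih, exp_siteOp, siteOp_eq_prodOp,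
        prodOp_mul]
      · congr 1
        ext1 j
        by_cases hj : j = k
        · subst hj; simp [hk]
        · simp [hj]
      · refine Commute.sum_right _ _ _ fun l hl => ?_
        exact siteOp_commute (fun h : k = l => hk (by rw [h]; exact hl)) _ _
  simpa using h Finset.univ

variable (β η : ℝ)

lemma localRho_eq_prodOp : localRho β η N = prodOp fun _ => rho β η := rfl

lemma localState_prodOp (f : Fin N → SiteMat) :
    localState β η N (prodOp f) = ∏ k, siteExp β η (f k) := by
  rw [localState, localRho_eq_prodOp, prodOp_mul, trace_prodOp]
  rfl

lemma trace_rho : (rho β η).trace = 1 := by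
  rw [rho, Matrix.trace_smul, smul_eq_mul, inv_mul_cancel₀]
  intro h
  obtain ⟨c, K, hc, hK, hu, hρ⟩ := exists_gram_isUnit β η
  have h1 : rho β η = 0 := by rw [rho, h]; simp
  rw [h1] at hρ
  exact ((hu.mul hu).ne_zero) ((smul_eq_zero.mp hρ.symm).resolve_left hc.ne')

lemma siteExp_one : siteExp β η 1 = 1 := by
  rw [siteExp, mul_one, trace_rho]

lemma localState_one : localState β η N 1 = 1 := by
  rw [← prodOp_one, localState_prodOp]
  simp [siteExp_one]

lemma rho_diagonal : ∃ v : Site → ℂ, rho β η = Matrix.diagonal v := by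
  have h3 : pauli3 = Matrix.diagonal ![1, -1] := by
    ext i j
    fin_cases i <;> fin_cases j <;> simp [pauli3]
  have h : ∃ w : Site → ℂ, -(β : ℂ) • siteHam η = Matrix.diagonal w := by
    rw [siteHam, h3, ← Matrix.diagonal_one, Matrix.diagonal_kronecker_diagonal,
      Matrix.diagonal_kronecker_diagonal, Matrix.diagonal_add, ← Matrix.diagonal_smul,
      ← Matrix.diagonal_smul]
    exact ⟨_, rfl⟩
  obtain ⟨w, hw⟩ := h
  rw [rho, hw, Matrix.exp_diagonal, ← Matrix.diagonal_smul]
  exact ⟨_, rfl⟩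

/-- Each x_j flips a spin and so has zero diagonal, while ρ_β is diagonal. Hence the centring in the
fluctuations is void. -/
lemma siteExp_chi_eq_zero (j : Fin 8) : siteExp β η (chi j) = 0 := by
  obtain ⟨v, hv⟩ := rho_diagonal β η
  have hd : ∀ p, chi j p p = 0 := by
    rintro ⟨p, q⟩
    fin_cases j <;> fin_cases p <;> fin_cases q <;>
      simp [chi, pauli1, pauli2, pauli3, Matrix.kroneckerMap_apply]
  rw [siteExp, hv, Matrix.trace]
  simp [Matrix.diagonal_mul, hd]

lemma siteExp_obs (z : Fin 8 → ℂ) : siteExp β η (obs z) = 0 := by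
  simp [obs, siteExp_sum, siteExp_smul, siteExp_chi_eq_zero]

/-- The fluctuation `F_N(z) = N^{-1/2} ∑_k obs(z)^{(k)}`. -/
def fluctOp (N : ℕ) (z : Fin 8 → ℂ) : LocalAlg N :=
  ((√N)⁻¹ : ℂ) • ∑ k : Fin N, siteOp k (obs z)

lemma sum_smul_fluct (z : Fin 8 → ℂ) :
    ∑ j, z j • fluct β η N (chi j) = fluctOp N z := by
  simp only [fluct, siteExp_chi_eq_zero, zero_smul, sub_zero, fluctOp, obs, siteOp_sum, siteOp_smul,
    Finset.smul_sum]
  rw [Finset.sum_comm]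
  refine Finset.sum_congr rfl fun k _ => Finset.sum_congr rfl fun j _ => ?_
  rw [smul_comm]

lemma localWeyl_eq_exp (r : Fin 8 → ℝ) :
    localWeyl β η N r = NormedSpace.exp (Complex.I • fluctOp N (cvec r)) := by
  rw [localWeyl, ← sum_smul_fluct β η]
  rfl

lemma localWeyl_eq_prodOp (r : Fin 8 → ℝ) :
    localWeyl β η N r = prodOp fun _ =>
      NormedSpace.exp (((√N)⁻¹ : ℂ) • (Complex.I • obs (cvec r))) := by
  rw [localWeyl_eq_exp, ← exp_sum_siteOp, fluctOp, Finset.smul_sum, Finset.smul_sum]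
  congr 1
  refine Finset.sum_congr rfl fun k _ => ?_
  rw [siteOp_smul, siteOp_smul, smul_comm]

lemma fluctOp_conjTranspose (z : Fin 8 → ℂ) :
    (fluctOp N z).conjTranspose = fluctOp N (star z) := by
  simp only [fluctOp, Matrix.conjTranspose_smul, Matrix.conjTranspose_sum, siteOp_conjTranspose,
    obs_conjTranspose]
  congr 1
  simp

end

section

/-! ### Exponentials of self-adjoint elements and second-order generators -/

section ExpCalculus

variable {A : Type*} [CStarAlgebra A]

/-- The one-parameter group `e^{iuF}`. -/
def expI (F : A) (u : ℝ) : A := NormedSpace.exp ((u : ℂ) • (Complex.I • F))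

lemma expI_zero (F : A) : expI F 0 = 1 := by simp [expI]

lemma expI_one (F : A) : expI F 1 = NormedSpace.exp (Complex.I • F) := by simp [expI]

lemma expI_add (F : A) (u v : ℝ) : expI F (u + v) = expI F u * expI F v := by
  let : NormedAlgebra ℚ A := .restrictScalars ℚ ℂ A
  rw [expI, expI, expI, ← NormedSpace.exp_add_of_commute]
  · rw [Complex.ofReal_add, add_smul]
  · exact ((Commute.refl _).smul_left _).smul_right _

lemma expI_neg_mul (F : A) (u : ℝ) : expI F (-u) * expI F u = 1 := by
  rw [← expI_add, neg_add_cancel, expI_zero]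

lemma expI_mul_neg (F : A) (u : ℝ) : expI F u * expI F (-u) = 1 := by
  rw [← expI_add, add_neg_cancel, expI_zero]

lemma star_expI {F : A} (hF : star F = F) (u : ℝ) : star (expI F u) = expI F (-u) := by
  let : NormedAlgebra ℚ A := .restrictScalars ℚ ℂ A
  rw [expI, expI, NormedSpace.star_exp]
  congr 1
  simp [hF]

lemma norm_expI_le {F : A} (hF : star F = F) (u : ℝ) : ‖expI F u‖ ≤ 1 := by
  have h : ‖star (expI F u) * expI F u‖ = ‖expI F u‖ * ‖expI F u‖ := CStarRing.norm_star_mul_self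
  rw [star_expI hF, expI_neg_mul] at h
  rcases subsingleton_or_nontrivial A with _ | _
  · rw [Subsingleton.elim (expI F u) 0]; simp
  · rw [CStarRing.norm_one] at h
    nlinarith [norm_nonneg (expI F u)]

lemma hasDerivAt_expI (F : A) (u : ℝ) :
    HasDerivAt (expI F) ((Complex.I • F) * expI F u) u := by
  have h := hasDerivAt_exp_smul_const' (𝕂 := ℝ) (Complex.I • F) u
  simp only [← Complex.coe_smul] at h
  exact h

lemma hasDerivAt_expI_comp (F : A) {φ : ℝ → ℝ} {φ' u : ℝ} (hφ : HasDerivAt φ φ' u) :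
    HasDerivAt (fun u => expI F (φ u)) (φ' • ((Complex.I • F) * expI F (φ u))) u :=
  (hasDerivAt_expI F (φ u)).scomp u hφ

lemma expI_comm (F : A) (u : ℝ) : expI F u * F = F * expI F u := by
  let : NormedAlgebra ℚ A := .restrictScalars ℚ ℂ A
  exact ((((Commute.refl F).smul_left Complex.I).smul_left (u : ℂ)).exp_left).eq

lemma continuous_expI (F : A) : Continuous (expI F) :=
  continuous_iff_continuousAt.mpr fun u => (hasDerivAt_expI F u).continuousAt

lemma continuous_exp_algebra : Continuous (NormedSpace.exp : A → A) := by
  let : NormedAlgebra ℚ A := .restrictScalars ℚ ℂ A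
  exact NormedSpace.exp_continuous

/-- Duhamel's formula for the difference of two exponentials. -/
lemma exp_sub_exp_eq_integral (F G : A) :
    NormedSpace.exp (Complex.I • F) - NormedSpace.exp (Complex.I • G) =
      ∫ u in (0 : ℝ)..1, expI G (1 - u) * (Complex.I • (F - G)) * expI F u := by
  have hd : ∀ u : ℝ, HasDerivAt (fun u => expI G (1 - u) * expI F u)
      (expI G (1 - u) * (Complex.I • (F - G)) * expI F u) u := fun u => by
    have h1 : HasDerivAt (fun u : ℝ => expI G (1 - u)) (-((Complex.I • G) * expI G (1 - u))) u := by
      simpa using hasDerivAt_expI_comp G ((hasDerivAt_id' u).const_sub 1)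
    refine (h1.mul (hasDerivAt_expI F u)).congr_deriv ?_
    have := expI_comm G (1 - u)
    rw [smul_mul_assoc, ← this]
    simp only [smul_mul_assoc, mul_smul_comm, mul_sub, sub_mul, smul_sub, mul_assoc, neg_mul]
    abel
  rw [intervalIntegral.integral_eq_sub_of_hasDerivAt (fun u _ => hd u)]
  · simp [expI_zero, expI_one]
  · refine Continuous.intervalIntegrable ?_ _ _
    have h1 := continuous_expI F
    have h2 := continuous_expI G
    fun_prop

/-- The derivative of the exponential along a path. -/
lemma hasDerivAt_exp_path {F : ℝ → A} {F' : A} {τ : ℝ} (hF : HasDerivAt F F' τ) :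
    HasDerivAt (fun τ => NormedSpace.exp (Complex.I • F τ))
      (∫ u in (0 : ℝ)..1, expI (F τ) (1 - u) * (Complex.I • F') * expI (F τ) u) τ := by
  rw [hasDerivAt_iff_tendsto_slope] at hF ⊢
  -- By Duhamel's formula the difference quotient at τ' is Ψ evaluated at the slope of F and at F
  -- τ', so the derivative follows from continuity of Ψ.
  let Ψ : A × A → A := fun p =>
    ∫ u in (0 : ℝ)..1, expI (F τ) (1 - u) * (Complex.I • p.1) * expI p.2 u
  have hΨ : Continuous Ψ := by
    refine intervalIntegral.continuous_parametric_intervalIntegral_of_continuous ?_ continuous_const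
    have h1 := continuous_expI (F τ)
    have h2 : Continuous fun q : (A × A) × ℝ => expI q.1.2 q.2 := by
      refine continuous_exp_algebra.comp ?_
      fun_prop
    refine (Continuous.mul ?_ ?_).mul h2 <;> fun_prop
  have hFc : Filter.Tendsto F (𝓝[≠] τ) (𝓝 (F τ)) := by
    rw [← hasDerivAt_iff_tendsto_slope] at hF
    exact hF.continuousAt.tendsto.mono_left nhdsWithin_le_nhds
  refine ((hΨ.tendsto (F', F τ)).comp (hF.prodMk_nhds hFc)).congr fun τ' => ?_
  simp only [Function.comp_apply, Ψ, slope, vsub_eq_sub, exp_sub_exp_eq_integral]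
  rw [← intervalIntegral.integral_smul]
  refine intervalIntegral.integral_congr fun u _ => ?_
  simp only [smul_mul_assoc, mul_smul_comm, smul_comm Complex.I]

lemma hasDerivAt_conj_expI (F V : A) (u : ℝ) :
    HasDerivAt (fun u => expI F (-u) * V * expI F u)
      (-(Complex.I • (expI F (-u) * ⁅F, V⁆ * expI F u))) u := by
  have h1 : HasDerivAt (fun u : ℝ => expI F (-u)) (-((Complex.I • F) * expI F (-u))) u := by
    simpa using hasDerivAt_expI_comp F (hasDerivAt_id' u).neg
  refine ((h1.mul_const V).mul (hasDerivAt_expI F u)).congr_deriv ?_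
  have := expI_comm F (-u)
  simp only [Ring.lie_def, smul_mul_assoc, mul_smul_comm, ← this, mul_sub, sub_mul, smul_sub,
    mul_assoc, neg_mul]
  abel

lemma norm_conj_le {F : A} (hF : star F = F) (V : A) (u : ℝ) :
    ‖expI F (-u) * V * expI F u‖ ≤ ‖V‖ := by
  calc _ ≤ ‖expI F (-u)‖ * ‖V‖ * ‖expI F u‖ :=
        (norm_mul_le _ _).trans (mul_le_mul_of_nonneg_right (norm_mul_le _ _) (norm_nonneg _))
    _ ≤ 1 * ‖V‖ * 1 := by
        gcongr
        · exact norm_expI_le hF _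
        · exact norm_expI_le hF _
    _ = ‖V‖ := by ring

/-- The derivative of the conjugated element is a conjugate of -i[F, V], and conjugation by
unitaries does not increase the norm. -/
lemma norm_conj_sub_le {F : A} (hF : star F = F) (V : A) {u : ℝ} (hu0 : 0 ≤ u) (hu1 : u ≤ 1) :
    ‖expI F (-u) * V * expI F u - V‖ ≤ ‖⁅F, V⁆‖ := by
  have h := norm_image_sub_le_of_norm_deriv_le_segment' (f := fun u => expI F (-u) * V * expI F u)
    (a := 0) (b := 1) (C := ‖⁅F, V⁆‖) (fun x _ => (hasDerivAt_conj_expI F V x).hasDerivWithinAt)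
    (fun x _ => by
      rw [norm_neg, norm_smul, Complex.norm_I, one_mul]
      exact norm_conj_le hF _ x) u ⟨hu0, hu1⟩
  simp only [neg_zero, expI_zero, one_mul, mul_one, sub_zero] at h
  exact h.trans (mul_le_of_le_one_right (norm_nonneg _) hu1)

/-- Once the linear term is removed, the derivative is the deviation of the conjugate of [F, V] from
[F, V], to which `norm_conj_sub_le` applies. -/
lemma norm_conj_sub_sub_le {F : A} (hF : star F = F) (V : A) {u : ℝ} (hu0 : 0 ≤ u) (hu1 : u ≤ 1) :
    ‖expI F (-u) * V * expI F u - V + ((u : ℂ) * Complex.I) • ⁅F, V⁆‖ ≤ ‖⁅F, ⁅F, V⁆⁆‖ := by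
  have hd : ∀ x : ℝ, HasDerivAt
      (fun u : ℝ => expI F (-u) * V * expI F u + ((u : ℂ) * Complex.I) • ⁅F, V⁆)
      (-(Complex.I • (expI F (-x) * ⁅F, V⁆ * expI F x - ⁅F, V⁆))) x := fun x => by
    have h1 : HasDerivAt (fun u : ℝ => ((u : ℂ) * Complex.I) • ⁅F, V⁆) (Complex.I • ⁅F, V⁆) x := by
      have := ((hasDerivAt_id (x : ℂ)).comp_ofReal.mul_const Complex.I).smul_const ⁅F, V⁆
      simpa using this
    refine ((hasDerivAt_conj_expI F V x).add h1).congr_deriv ?_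
    rw [smul_sub]
    abel
  have h := norm_image_sub_le_of_norm_deriv_le_segment'
    (f := fun u : ℝ => expI F (-u) * V * expI F u + ((u : ℂ) * Complex.I) • ⁅F, V⁆)
    (a := 0) (b := 1) (C := ‖⁅F, ⁅F, V⁆⁆‖) (fun x _ => (hd x).hasDerivWithinAt)
    (fun x hx => by
      rw [norm_neg, norm_smul, Complex.norm_I, one_mul]
      exact norm_conj_sub_le hF _ hx.1 hx.2.le) u ⟨hu0, hu1⟩
  simp only [neg_zero, expI_zero, one_mul, mul_one, sub_zero, Complex.ofReal_zero, zero_mul,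
    zero_smul, add_zero] at h
  rw [sub_add_eq_add_sub]
  exact h.trans (mul_le_of_le_one_right (norm_nonneg _) hu1)

/-- A linear map annihilating `1` whose carré du champ is `∑ c_{αβ} [V_α, X] [Y, B_β]` acts on
`e^{iF}` as the derivative along `F ↦ 𝓛 F` up to the carré du champ of `F`. -/
lemma norm_generator_exp_sub_le {κ : Type*} [Fintype κ] (c : κ → κ → ℂ) (V B : κ → A)
    (𝓛 : A →L[ℂ] A) (h1 : 𝓛 1 = 0)
    (hΓ : ∀ X Y, 𝓛 (X * Y) = X * 𝓛 Y + 𝓛 X * Y + ∑ α, ∑ β, c α β • (⁅V α, X⁆ * ⁅Y, B β⁆))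
    {F : A} (hF : star F = F) :
    ‖𝓛 (NormedSpace.exp (Complex.I • F)) -
        (∫ u in (0 : ℝ)..1, expI F (1 - u) * (Complex.I • 𝓛 F) * expI F u) +
        (1 / 2 : ℂ) • (NormedSpace.exp (Complex.I • F) *
          ∑ α, ∑ β, c α β • (⁅V α, F⁆ * ⁅F, B β⁆))‖ ≤
      ∑ α, ∑ β, ‖c α β‖ * (‖⁅V α, F⁆‖ * ‖⁅F, ⁅F, B β⁆⁆‖ + ‖⁅F, ⁅V α, F⁆⁆‖ * ‖⁅F, B β⁆‖) := by
  set G : A → A := fun Y => ∑ α, ∑ β, c α β • (⁅V α, F⁆ * ⁅Y, B β⁆) with hG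
  set W := NormedSpace.exp (Complex.I • F)
  -- This path runs from 0, as 𝓛 1 = 0, to 𝓛(e^{iF}). The product formula for 𝓛 at iF and e^{iuF}
  -- splits its derivative into the drift and the carré du champ part G.
  have hp : ∀ u : ℝ, HasDerivAt (fun u => expI F (1 - u) * 𝓛 (expI F u))
      (expI F (1 - u) * (Complex.I • 𝓛 F) * expI F u +
        Complex.I • (expI F (1 - u) * G (expI F u))) u := fun u => by
    have e1 : HasDerivAt (fun u : ℝ => expI F (1 - u)) (-((Complex.I • F) * expI F (1 - u))) u := by
      simpa using hasDerivAt_expI_comp F ((hasDerivAt_id' u).const_sub 1)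
    have e2 : HasDerivAt (fun u : ℝ => 𝓛 (expI F u)) (𝓛 ((Complex.I • F) * expI F u)) u :=
      ((𝓛.restrictScalars ℝ).hasFDerivAt.comp_hasDerivAt u (hasDerivAt_expI F u))
    refine (e1.mul e2).congr_deriv ?_
    have := expI_comm F (1 - u)
    rw [smul_mul_assoc, smul_mul_assoc, map_smul, hΓ, ← this]
    simp only [smul_mul_assoc, mul_smul_comm, mul_add, smul_add, mul_assoc, neg_mul]
    abel
  have hint : ∀ u : ℝ, HasDerivAt (fun u => ∫ v in (0 : ℝ)..u,
      expI F (1 - v) * (Complex.I • 𝓛 F) * expI F v)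
      (expI F (1 - u) * (Complex.I • 𝓛 F) * expI F u) u := fun u => by
    have hc := continuous_expI F
    have hc2 : Continuous fun v => expI F (1 - v) * (Complex.I • 𝓛 F) * expI F v := by fun_prop
    exact (hc2.integral_hasStrictDerivAt 0 u).hasDerivAt
  have hq : ∀ u : ℝ, HasDerivAt (fun u : ℝ => ((u : ℂ) ^ 2 / 2) • (W * G F))
      ((u : ℂ) • (W * G F)) u := fun u => by
    have := (((hasDerivAt_id (u : ℂ)).pow 2).div_const 2).comp_ofReal.smul_const (W * G F)
    refine this.congr_deriv ?_
    congr 1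
    simp
  have hW : ∀ u : ℝ, expI F (1 - u) = W * expI F (-u) := fun u => by
    rw [sub_eq_add_neg, expI_add, expI_one]
  -- To leading order the carré du champ part of the derivative is -u W G(F). The term u²/2 · W G(F)
  -- compensates it and gives the coefficient ½ at u = 1; what is left is the error.
  have key := norm_image_sub_le_of_norm_deriv_le_segment_01'
    (f := fun u => expI F (1 - u) * 𝓛 (expI F u) - (∫ v in (0 : ℝ)..u,
      expI F (1 - v) * (Complex.I • 𝓛 F) * expI F v) + ((u : ℂ) ^ 2 / 2) • (W * G F))
    (C := ∑ α, ∑ β, ‖c α β‖ * (‖⁅V α, F⁆‖ * ‖⁅F, ⁅F, B β⁆⁆‖ + ‖⁅F, ⁅V α, F⁆⁆‖ * ‖⁅F, B β⁆‖))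
    (fun u _ => (((hp u).sub (hint u)).add (hq u)).hasDerivWithinAt) fun u hu => by
      rw [add_sub_cancel_left, hW]
      have e1 : Complex.I • (W * expI F (-u) * G (expI F u)) + (u : ℂ) • (W * G F) =
          W * ∑ α, ∑ β, c α β • (Complex.I • (expI F (-u) * ⁅V α, F⁆ * expI F u *
            (B β - expI F (-u) * B β * expI F u)) + (u : ℂ) • (⁅V α, F⁆ * ⁅F, B β⁆)) := by
        have e2 : ∀ α β, expI F (-u) * (⁅V α, F⁆ * ⁅expI F u, B β⁆) = expI F (-u) * ⁅V α, F⁆ *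
            expI F u * (B β - expI F (-u) * B β * expI F u) := fun α β => by
          rw [mul_sub, Ring.lie_def (expI F u)]
          have e3 : expI F (-u) * ⁅V α, F⁆ * expI F u * (expI F (-u) * B β * expI F u) =
              expI F (-u) * ⁅V α, F⁆ * (expI F u * expI F (-u)) * B β * expI F u := by
            simp only [mul_assoc]
          rw [e3, expI_mul_neg]
          simp only [mul_sub, mul_assoc, mul_one]
        simp only [hG, mul_assoc W, Finset.mul_sum, Finset.smul_sum, mul_smul_comm, smul_add,
          mul_add, Finset.sum_add_distrib, e2]
        congr 1
        · refine Finset.sum_congr rfl fun α _ => Finset.sum_congr rfl fun β _ => ?_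
          rw [smul_comm]
        · refine Finset.sum_congr rfl fun α _ => Finset.sum_congr rfl fun β _ => ?_
          rw [smul_comm]
      have hWn : ‖W‖ ≤ 1 := by
        have := norm_expI_le hF 1
        rwa [expI_one] at this
      rw [e1]
      refine (norm_mul_le _ _).trans ((mul_le_of_le_one_left (norm_nonneg _) hWn).trans ?_)
      refine norm_sum_le_of_le _ fun α _ => norm_sum_le_of_le _ fun β _ => ?_
      rw [norm_smul]
      gcongr
      set g := ⁅V α, F⁆
      set g' := expI F (-u) * g * expI F u
      set D := B β - expI F (-u) * B β * expI F u
      -- The error splits into that of undoing the conjugation of [V_α, F] and that of linearising D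
      -- to iu[F, B_β].
      have e4 : Complex.I • (g' * D) + (u : ℂ) • (g * ⁅F, B β⁆) =
          Complex.I • ((g' - g) * D) +
            Complex.I • (g * (D - ((u : ℂ) * Complex.I) • ⁅F, B β⁆)) := by
        simp only [sub_mul, mul_sub, smul_sub, mul_smul_comm, smul_smul]
        have : Complex.I * ((u : ℂ) * Complex.I) = -(u : ℂ) := by
          linear_combination (u : ℂ) * Complex.I_sq
        rw [this]
        module
      have hD : ‖D‖ ≤ ‖⁅F, B β⁆‖ := by
        rw [norm_sub_rev]
        exact norm_conj_sub_le hF _ hu.1 hu.2.le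
      have hD2 : ‖D - ((u : ℂ) * Complex.I) • ⁅F, B β⁆‖ ≤ ‖⁅F, ⁅F, B β⁆⁆‖ := by
        have := norm_conj_sub_sub_le hF (B β) hu.1 hu.2.le
        rw [← norm_neg] at this
        refine le_trans (le_of_eq ?_) this
        congr 1
        simp only [D]
        abel
      have hg : ‖g' - g‖ ≤ ‖⁅F, g⁆‖ := norm_conj_sub_le hF _ hu.1 hu.2.le
      rw [e4, add_comm]
      refine (norm_add_le _ _).trans ?_
      rw [norm_smul, norm_smul, Complex.norm_I, one_mul, one_mul]
      refine add_le_add ((norm_mul_le _ _).trans ?_) ((norm_mul_le _ _).trans ?_) <;> gcongr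
  simp only [sub_self, sub_zero, expI_zero, expI_one, one_mul, h1, mul_zero,
    intervalIntegral.integral_same, Complex.ofReal_one, Complex.ofReal_zero, one_pow, ne_eq,
    OfNat.ofNat_ne_zero, not_false_eq_true, zero_pow, zero_div, zero_smul, add_zero] at key
  exact key

end ExpCalculus

end

/-! ### The thermal state on the local algebras -/

section State

variable (β η : ℝ) {N : ℕ}

lemma localState_add (X Y : LocalAlg N) :
    localState β η N (X + Y) = localState β η N X + localState β η N Y := by
  simp [localState, mul_add]

lemma localState_sub (X Y : LocalAlg N) :
    localState β η N (X - Y) = localState β η N X - localState β η N Y := by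
  simp [localState, mul_sub]

lemma localState_smul (c : ℂ) (X : LocalAlg N) :
    localState β η N (c • X) = c * localState β η N X := by
  simp [localState]

lemma localState_sum {ι : Type*} (s : Finset ι) (f : ι → LocalAlg N) :
    localState β η N (∑ i ∈ s, f i) = ∑ i ∈ s, localState β η N (f i) := by
  simp [localState, Finset.mul_sum]

lemma localRho_conjTranspose : (localRho β η N).conjTranspose = localRho β η N := by
  rw [localRho_eq_prodOp, prodOp_conjTranspose]
  simp [rho_conjTranspose]

lemma localState_conjTranspose (X : LocalAlg N) :
    localState β η N X.conjTranspose = star (localState β η N X) := by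
  rw [localState, localState, ← Matrix.trace_conjTranspose, Matrix.conjTranspose_mul,
    localRho_conjTranspose, Matrix.trace_mul_comm]

/-- The density matrix is c^N P² with P Hermitian and c > 0, so the value is c^N Tr((XP)†(XP)). -/
lemma localState_nonneg (X : LocalAlg N) : 0 ≤ localState β η N (X.conjTranspose * X) := by
  obtain ⟨c, K, hc, hK, hu, h⟩ := exists_gram_isUnit β η
  have hr : localRho β η N = c ^ N • (prodOp (fun _ => K) * prodOp fun _ => K) := by
    rw [prodOp_mul, localRho_eq_prodOp]
    ext s s'
    simp [prodOp, h, Finset.prod_mul_distrib]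
  have hK' : (prodOp fun _ : Fin N => K).conjTranspose = prodOp fun _ => K := by
    rw [prodOp_conjTranspose, hK]
  set P := prodOp fun _ : Fin N => K
  have e : localState β η N (X.conjTranspose * X) =
      c ^ N * ((X * P).conjTranspose * (X * P)).trace := by
    rw [localState, hr, smul_mul_assoc, Matrix.trace_smul, mul_assoc, Matrix.trace_mul_comm,
      Matrix.conjTranspose_mul, hK', smul_eq_mul]
    simp only [mul_assoc]
  rw [e]
  exact mul_nonneg (pow_nonneg hc.le N) (Matrix.posSemidef_conjTranspose_mul_self _).trace_nonneg

/-- The Cauchy–Schwarz inequality for the thermal state. -/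
lemma localState_cauchySchwarz (X Y : LocalAlg N) :
    ‖localState β η N (X.conjTranspose * Y)‖ ^ 2 ≤
      (localState β η N (X.conjTranspose * X)).re * (localState β η N (Y.conjTranspose * Y)).re := by
  let core : PreInnerProductSpace.Core ℂ (LocalAlg N) :=
    { inner := fun X Y => localState β η N (X.conjTranspose * Y)
      conj_inner_symm := fun X Y => by
        change star (localState β η N (Y.conjTranspose * X)) = _
        rw [← localState_conjTranspose, Matrix.conjTranspose_mul, Matrix.conjTranspose_conjTranspose]
      re_inner_nonneg := fun X => (Complex.nonneg_iff.mp (localState_nonneg β η X)).1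
      add_left := fun X Y Z => by
        rw [Matrix.conjTranspose_add, add_mul, localState_add]
      smul_left := fun X Y c => by
        rw [Matrix.conjTranspose_smul, smul_mul_assoc, localState_smul]
        rfl }
  have h := InnerProductSpace.Core.inner_mul_inner_self_le (𝕜 := ℂ) (c := core) X Y
  have h2 : ‖localState β η N (Y.conjTranspose * X)‖ = ‖localState β η N (X.conjTranspose * Y)‖ := by
    rw [← norm_star, ← localState_conjTranspose, Matrix.conjTranspose_mul,
      Matrix.conjTranspose_conjTranspose]
  change ‖localState β η N (X.conjTranspose * Y)‖ * ‖localState β η N (Y.conjTranspose * X)‖ ≤ _ at h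
  rw [h2, ← sq] at h
  exact h

open scoped MatrixOrder Matrix.Norms.L2Operator in
lemma localState_conjTranspose_mul_self_le (X : LocalAlg N) :
    (localState β η N (X.conjTranspose * X)).re ≤ ‖X‖ ^ 2 := by
  have h : star X * X ≤ algebraMap ℝ (LocalAlg N) (‖X‖ ^ 2) :=
    CStarAlgebra.star_mul_le_algebraMap_norm_sq
  obtain ⟨Z, hZ⟩ := CStarAlgebra.nonneg_iff_eq_star_mul_self.mp (sub_nonneg.mpr h)
  have h2 := localState_nonneg β η Z
  rw [← Matrix.star_eq_conjTranspose, ← hZ, localState_sub, Algebra.algebraMap_eq_smul_one,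
    ← Complex.coe_smul, localState_smul, localState_one] at h2
  have h3 := (Complex.nonneg_iff.mp h2).1
  rw [mul_one, Complex.sub_re, Complex.ofReal_re] at h3
  rw [← Matrix.star_eq_conjTranspose]
  linarith

open scoped Matrix.Norms.L2Operator in
lemma norm_localState_le (X : LocalAlg N) : ‖localState β η N X‖ ≤ ‖X‖ := by
  have h := localState_cauchySchwarz β η 1 X
  have h2 := localState_conjTranspose_mul_self_le β η X
  simp only [Matrix.conjTranspose_one, one_mul, localState_one, Complex.one_re] at h
  exact le_of_sq_le_sq (h.trans h2) (norm_nonneg _)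

/-- The thermal state as a continuous functional. -/
def localStateCLM (N : ℕ) : LocalAlg N →L[ℂ] ℂ :=
  LinearMap.toContinuousLinearMap
    { toFun := localState β η N
      map_add' := localState_add β η
      map_smul' := localState_smul β η }

end State

/-! ### The Lindblad generators -/

section Lindblad

variable {N d : ℕ} (J : ℕ → ℝ) (D : Matrix (Fin d) (Fin d) ℂ) (v : Fin d → SiteMat) (h : SiteMat)

/-- The coefficients `J_{kl} D_{μν}` of the dissipator. -/
def kossakowski (N : ℕ) : Matrix (Fin N × Fin d) (Fin N × Fin d) ℂ :=
  Matrix.of fun p q => (couplings J N p.1 q.1 : ℂ) * D p.2 q.2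

/-- The noise operators `v_μ^{(k)}`. -/
def noise (N : ℕ) (p : Fin N × Fin d) : LocalAlg N := siteOp p.1 (v p.2)

lemma noise_conjTranspose (p : Fin N × Fin d) :
    (noise v N p).conjTranspose = siteOp p.1 (v p.2).conjTranspose := by
  rw [noise, siteOp_conjTranspose]

lemma lindblad_apply (X : LocalAlg N) : lindblad N J D v h X =
    Complex.I • ((∑ k, siteOp k h) * X - X * ∑ k, siteOp k h) +
      ∑ p, ∑ q, kossakowski J D N p q • (noise v N p * X * (noise v N q).conjTranspose -
        (1 / 2 : ℂ) • (noise v N p * (noise v N q).conjTranspose * X +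
          X * (noise v N p * (noise v N q).conjTranspose))) := by
  simp only [lindblad, LinearMap.add_apply, LinearMap.smul_apply, LinearMap.sub_apply,
    LinearMap.mulLeft_apply, LinearMap.mulRight_apply, LinearMap.sum_apply, dissip_apply,
    Fintype.sum_prod_type, kossakowski, Matrix.of_apply, noise_conjTranspose]
  congr 1
  refine Finset.sum_congr rfl fun k _ => ?_
  conv_rhs => rw [Finset.sum_comm]
  refine Finset.sum_congr rfl fun l _ => ?_
  simp only [Finset.smul_sum, smul_smul, noise]

lemma lindblad_one : lindblad N J D v h 1 = 0 := by
  rw [lindblad_apply]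
  simp [← two_smul ℂ]

/-- The carré du champ of the generator. -/
lemma lindblad_mul (X Y : LocalAlg N) : lindblad N J D v h (X * Y) =
    X * lindblad N J D v h Y + lindblad N J D v h X * Y + ∑ p, ∑ q, kossakowski J D N p q •
      (⁅noise v N p, X⁆ * ⁅Y, (noise v N q).conjTranspose⁆) := by
  rw [lindblad_apply, lindblad_apply, lindblad_apply]
  generalize (∑ k, siteOp k h : LocalAlg N) = H
  simp only [mul_add, add_mul, Finset.mul_sum, Finset.sum_mul, mul_smul_comm, smul_mul_assoc]
  have e1 : Complex.I • (H * (X * Y) - X * Y * H) = Complex.I • (X * (H * Y - Y * H)) +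
      Complex.I • ((H * X - X * H) * Y) := by
    rw [← smul_add]
    congr 1
    noncomm_ring
  have e2 : ∀ p q, noise v N p * (X * Y) * (noise v N q).conjTranspose -
      (1 / 2 : ℂ) • (noise v N p * (noise v N q).conjTranspose * (X * Y) +
        X * Y * (noise v N p * (noise v N q).conjTranspose)) =
      X * (noise v N p * Y * (noise v N q).conjTranspose -
        (1 / 2 : ℂ) • (noise v N p * (noise v N q).conjTranspose * Y +
          Y * (noise v N p * (noise v N q).conjTranspose))) +
      (noise v N p * X * (noise v N q).conjTranspose -
        (1 / 2 : ℂ) • (noise v N p * (noise v N q).conjTranspose * X +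
          X * (noise v N p * (noise v N q).conjTranspose))) * Y +
      ⁅noise v N p, X⁆ * ⁅Y, (noise v N q).conjTranspose⁆ := fun p q => by
    simp only [Ring.lie_def, mul_sub, sub_mul, mul_add, add_mul, smul_add, mul_smul_comm,
      smul_mul_assoc, mul_assoc]
    module
  have e3 : (∑ p, ∑ q, kossakowski J D N p q • (noise v N p * (X * Y) * (noise v N q).conjTranspose -
      (1 / 2 : ℂ) • (noise v N p * (noise v N q).conjTranspose * (X * Y) +
        X * Y * (noise v N p * (noise v N q).conjTranspose)))) = _ :=
    Finset.sum_congr rfl fun p _ => Finset.sum_congr rfl fun q _ =>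
      congrArg (kossakowski J D N p q • ·) (e2 p q)
  simp only [smul_add, Finset.sum_add_distrib] at e3 e1 ⊢
  rw [e1, e3]
  abel

variable {J D h}

/-- The coefficient matrix is the Kronecker product of J and D. The real matrix J stays positive
over ℂ, since its quadratic form is the sum of its values at the real and imaginary parts. -/
lemma kossakowski_posSemidef (hD : D.PosSemidef) (hJ : (couplings J N).PosSemidef) :
    (kossakowski J D N).PosSemidef := by
  have hJ' : ((couplings J N).map (fun x => (x : ℂ))).PosSemidef := by
    refine Matrix.PosSemidef.of_dotProduct_mulVec_nonneg ?_ fun x => ?_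
    · ext i j
      have := hJ.isHermitian.apply i j
      simp only [star_trivial] at this
      simp [Matrix.conjTranspose_apply, this]
    · have e : star x ⬝ᵥ ((couplings J N).map (fun x => (x : ℂ))).mulVec x =
          (((fun i => (x i).re) ⬝ᵥ (couplings J N).mulVec (fun i => (x i).re) +
          (fun i => (x i).im) ⬝ᵥ (couplings J N).mulVec (fun i => (x i).im) : ℝ) : ℂ) := by
        have hsymm : ∀ i j, couplings J N j i = couplings J N i j := fun i j => by
          have := hJ.isHermitian.apply i j
          simpa using this
        simp only [dotProduct, Matrix.mulVec, Finset.mul_sum, Matrix.map_apply, Pi.star_apply]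
        apply Complex.ext
        · simp only [Complex.re_sum, Complex.ofReal_re, ← Finset.sum_add_distrib]
          refine Finset.sum_congr rfl fun i _ => Finset.sum_congr rfl fun j _ => ?_
          simp
        · simp only [Complex.im_sum, Complex.ofReal_im]
          have h1 : ∀ i j, (star (x i) * ((couplings J N i j : ℂ) * x j)).im =
              couplings J N i j * ((x i).re * (x j).im) -
              couplings J N i j * ((x i).im * (x j).re) := fun i j => by
            simp
            ring
          simp only [h1, Finset.sum_sub_distrib]
          rw [sub_eq_zero, Finset.sum_comm]
          refine Finset.sum_congr rfl fun i _ => Finset.sum_congr rfl fun j _ => ?_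
          rw [hsymm]
          ring
      rw [e]
      have h1 := hJ.dotProduct_mulVec_nonneg (fun i => (x i).re)
      have h2 := hJ.dotProduct_mulVec_nonneg (fun i => (x i).im)
      simp only [star_trivial] at h1 h2
      exact Complex.zero_le_real.mpr (add_nonneg h1 h2)
  exact hJ'.kronecker hD

lemma lindblad_conjTranspose (hh : h.IsHermitian) (hc : (kossakowski J D N).IsHermitian)
    (X : LocalAlg N) :
    lindblad N J D v h X.conjTranspose = (lindblad N J D v h X).conjTranspose := by
  have hH : (∑ k, siteOp k h : LocalAlg N).conjTranspose = ∑ k, siteOp k h := by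
    simp only [Matrix.conjTranspose_sum, siteOp_conjTranspose, hh.eq]
  rw [lindblad_apply, lindblad_apply]
  generalize (∑ k, siteOp k h : LocalAlg N) = H at hH
  simp only [Matrix.conjTranspose_add, Matrix.conjTranspose_smul, Matrix.conjTranspose_sub,
    Matrix.conjTranspose_mul, Matrix.conjTranspose_sum, hH, Matrix.conjTranspose_conjTranspose]
  congr 1
  · rw [Complex.star_def, Complex.conj_I, neg_smul, ← smul_neg, neg_sub]
  · rw [Finset.sum_comm]
    refine Finset.sum_congr rfl fun p _ => Finset.sum_congr rfl fun q _ => ?_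
    rw [hc.apply]
    congr 1
    have : star (1 / 2 : ℂ) = 1 / 2 := by simp
    rw [this]
    simp only [mul_assoc]
    congr 2
    abel

variable (β η : ℝ)

/-- The commutators [v, Y†] and [Y, v†] are adjoint to each other, so a Gram factor of the
coefficients turns the double sum into ∑_m Z_m† Z_m. -/
lemma carreDuChamp_nonneg (hc : (kossakowski J D N).PosSemidef) (Y : LocalAlg N) :
    0 ≤ localState β η N (∑ p, ∑ q, kossakowski J D N p q •
      (⁅noise v N p, Y.conjTranspose⁆ * ⁅Y, (noise v N q).conjTranspose⁆)) := by
  obtain ⟨B, hB⟩ := exists_gram_factor hc Finset.univ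
  have hG : ∀ q, ⁅noise v N q, Y.conjTranspose⁆ = ⁅Y, (noise v N q).conjTranspose⁆.conjTranspose :=
    fun q => by
      simp only [Ring.lie_def, Matrix.conjTranspose_sub, Matrix.conjTranspose_mul,
        Matrix.conjTranspose_conjTranspose]
  have e : ∑ p, ∑ q, kossakowski J D N p q •
      (⁅noise v N p, Y.conjTranspose⁆ * ⁅Y, (noise v N q).conjTranspose⁆) =
      ∑ m, (∑ p, B m p • ⁅Y, (noise v N p).conjTranspose⁆).conjTranspose *
        ∑ q, B m q • ⁅Y, (noise v N q).conjTranspose⁆ := by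
    simp only [Matrix.conjTranspose_sum, Matrix.conjTranspose_smul, ← hG, Finset.sum_mul_sum]
    conv_rhs => rw [Finset.sum_comm]
    refine Finset.sum_congr rfl fun p _ => ?_
    conv_rhs => rw [Finset.sum_comm]
    refine Finset.sum_congr rfl fun q _ => ?_
    rw [hB p (Finset.mem_univ _) q (Finset.mem_univ _), Finset.sum_smul]
    refine Finset.sum_congr rfl fun m _ => ?_
    rw [smul_mul_smul_comm]
  rw [e, localState_sum]
  exact Finset.sum_nonneg fun m _ => localState_nonneg β η _

end Lindblad

/-! ### Invariance of the state and contractivity -/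

section ExpCLM

variable {E : Type*} [NormedAddCommGroup E] [NormedSpace ℂ E] (T : E →L[ℂ] E)

lemma exp_zero_smul_clm_apply (x : E) :
    (NormedSpace.exp (((0 : ℝ) : ℂ) • T) : E →L[ℂ] E) x = x := by
  rw [Complex.ofReal_zero, zero_smul, NormedSpace.exp_zero]
  rfl

lemma exp_smul_clm_comm (t : ℝ) (x : E) :
    (NormedSpace.exp ((t : ℂ) • T) : E →L[ℂ] E) (T x) =
      T ((NormedSpace.exp ((t : ℂ) • T) : E →L[ℂ] E) x) := by
  let : NormedAlgebra ℚ (E →L[ℂ] E) := .restrictScalars ℚ ℂ _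
  have h := (((Commute.refl T).smul_right (t : ℂ)).exp_right).eq
  exact (congrArg (fun S : E →L[ℂ] E => S x) h).symm

lemma hasDerivAt_exp_smul_clm_path [CompleteSpace E] {z : ℝ → E} {z' : E} {s : ℝ} (hz : HasDerivAt z z' s) :
    HasDerivAt (fun s : ℝ => (NormedSpace.exp ((s : ℂ) • T) : E →L[ℂ] E) (z s))
      ((NormedSpace.exp ((s : ℂ) • T) : E →L[ℂ] E) (T (z s) + z')) s := by
  have h : HasDerivAt (fun s : ℝ => (NormedSpace.exp ((s : ℂ) • T) : E →L[ℂ] E))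
      (NormedSpace.exp ((s : ℂ) • T) * T) s := by
    have h := hasDerivAt_exp_smul_const (𝕂 := ℝ) T s
    simp only [← Complex.coe_smul] at h
    exact h
  have h2 : HasDerivAt (fun s : ℝ => ContinuousLinearMap.restrictScalars ℝ
      (NormedSpace.exp ((s : ℂ) • T) : E →L[ℂ] E))
      (ContinuousLinearMap.restrictScalars ℝ (NormedSpace.exp ((s : ℂ) • T) * T)) s :=
    (ContinuousLinearMap.restrictScalarsL ℂ E E ℝ ℝ).hasFDerivAt.comp_hasDerivAt s h
  refine (h2.clm_apply hz).congr_deriv ?_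
  rw [map_add]
  rfl

end ExpCLM

section Semigroup

variable {N : ℕ} (𝓛 : LocalAlg N →ₗ[ℂ] LocalAlg N)

open scoped Matrix.Norms.L2Operator in
lemma semigroupOf_zero (X : LocalAlg N) : semigroupOf 𝓛 0 X = X :=
  exp_zero_smul_clm_apply (LinearMap.toContinuousLinearMap 𝓛) X

open scoped Matrix.Norms.L2Operator in
/-- The derivative of the semigroup applied to a path. -/
lemma hasDerivAt_semigroupOf_path {Z : ℝ → LocalAlg N} {Z' : LocalAlg N} {s : ℝ}
    (hZ : HasDerivAt Z Z' s) : HasDerivAt (fun s => semigroupOf 𝓛 s (Z s))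
      (semigroupOf 𝓛 s (𝓛 (Z s) + Z')) s :=
  hasDerivAt_exp_smul_clm_path (LinearMap.toContinuousLinearMap 𝓛) hZ

open scoped Matrix.Norms.L2Operator in
lemma semigroupOf_comm (t : ℝ) (X : LocalAlg N) :
    semigroupOf 𝓛 t (𝓛 X) = 𝓛 (semigroupOf 𝓛 t X) :=
  exp_smul_clm_comm (LinearMap.toContinuousLinearMap 𝓛) t X

open scoped Matrix.Norms.L2Operator in
lemma hasDerivAt_semigroupOf (X : LocalAlg N) (t : ℝ) :
    HasDerivAt (fun t => semigroupOf 𝓛 t X) (𝓛 (semigroupOf 𝓛 t X)) t := by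
  have := hasDerivAt_semigroupOf_path 𝓛 (hasDerivAt_const t X)
  rwa [add_zero, semigroupOf_comm] at this

/-- The generator of a semigroup leaving the state invariant is annihilated by the state. -/
lemma localState_generator_eq_zero {β η : ℝ}
    (hinv : ∀ t : ℝ, 0 ≤ t → ∀ X, localState β η N (semigroupOf 𝓛 t X) = localState β η N X)
    (X : LocalAlg N) : localState β η N (𝓛 X) = 0 := by
  have h1 : HasDerivAt (fun t => localState β η N (semigroupOf 𝓛 t X))
      (localState β η N (𝓛 (semigroupOf 𝓛 0 X))) 0 := by
    open scoped Matrix.Norms.L2Operator in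
    exact ((localStateCLM β η N).restrictScalars ℝ).hasFDerivAt.comp_hasDerivAt (0 : ℝ)
      (hasDerivAt_semigroupOf 𝓛 X 0)
  rw [semigroupOf_zero] at h1
  -- Invariance is available only for t ≥ 0, so the derivatives at 0 are compared from the right.
  have h2 : HasDerivWithinAt (fun t => localState β η N (semigroupOf 𝓛 t X)) 0 (Set.Ici 0) 0 :=
    (hasDerivWithinAt_const (0 : ℝ) (Set.Ici 0) (localState β η N X)).congr
      (fun t ht => hinv t ht X) (hinv 0 le_rfl X)
  exact (uniqueDiffWithinAt_Ici (0 : ℝ)).eq_deriv _ h1.hasDerivWithinAt h2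

/-- A generator dissipative for the state yields contractions for the `L²`-norm of the state. -/
lemma localState_semigroupOf_le {β η : ℝ}
    (hdiss : ∀ Y, (localState β η N (Y.conjTranspose * 𝓛 Y)).re ≤ 0) (Y : LocalAlg N) {t : ℝ}
    (ht : 0 ≤ t) : (localState β η N ((semigroupOf 𝓛 t Y).conjTranspose * semigroupOf 𝓛 t Y)).re ≤
      (localState β η N (Y.conjTranspose * Y)).re := by
  have hd : ∀ s : ℝ, HasDerivAt (fun s : ℝ =>
      (localState β η N ((semigroupOf 𝓛 s Y).conjTranspose * semigroupOf 𝓛 s Y)).re)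
      (2 * (localState β η N ((semigroupOf 𝓛 s Y).conjTranspose * 𝓛 (semigroupOf 𝓛 s Y))).re) s := by
    intro s
    open scoped Matrix.Norms.L2Operator in
    have h1 := hasDerivAt_semigroupOf 𝓛 Y s
    have h2 : HasDerivAt (fun s => star (semigroupOf 𝓛 s Y)) (star (𝓛 (semigroupOf 𝓛 s Y))) s :=
      h1.star
    have h3 := ((localStateCLM β η N).restrictScalars ℝ).hasFDerivAt.comp_hasDerivAt s (h2.mul h1)
    have h4 := Complex.reCLM.hasFDerivAt.comp_hasDerivAt s h3
    refine h4.congr_deriv ?_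
    change (localState β η N _).re = _
    simp only [Matrix.star_eq_conjTranspose]
    have e : localState β η N ((𝓛 (semigroupOf 𝓛 s Y)).conjTranspose * semigroupOf 𝓛 s Y) =
        star (localState β η N ((semigroupOf 𝓛 s Y).conjTranspose * 𝓛 (semigroupOf 𝓛 s Y))) := by
      rw [← localState_conjTranspose, Matrix.conjTranspose_mul, Matrix.conjTranspose_conjTranspose]
    rw [localState_add, e, Complex.add_re, Complex.star_def, Complex.conj_re]
    ring
  have ha : Antitone (fun s : ℝ =>
      (localState β η N ((semigroupOf 𝓛 s Y).conjTranspose * semigroupOf 𝓛 s Y)).re) := by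
    refine antitone_of_deriv_nonpos (fun s => (hd s).differentiableAt) fun s => ?_
    rw [(hd s).deriv]
    linarith [hdiss (semigroupOf 𝓛 s Y)]
  have := ha ht
  simpa only [semigroupOf_zero] using this

end Semigroup

/-! ### Dissipativity of the local generators and of ℒᵀ -/

section Invariance

variable {N d : ℕ} {J : ℕ → ℝ} {D : Matrix (Fin d) (Fin d) ℂ} {v : Fin d → SiteMat} {h : SiteMat}
  {β η : ℝ}

/-- The carré du champ of a self-adjoint element has expectation `-2 Re ω(F 𝓛 F)`. -/
lemma localState_carreDuChamp (hh : h.IsHermitian) (hc : (kossakowski J D N).PosSemidef)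
    (hω : ∀ X, localState β η N (lindblad N J D v h X) = 0) (Y : LocalAlg N) :
    localState β η N (∑ p, ∑ q, kossakowski J D N p q •
      (⁅noise v N p, Y.conjTranspose⁆ * ⁅Y, (noise v N q).conjTranspose⁆)) =
      ((-2 * (localState β η N (Y.conjTranspose * lindblad N J D v h Y)).re : ℝ) : ℂ) := by
  have h1 := hω (Y.conjTranspose * Y)
  rw [lindblad_mul, localState_add, localState_add,
    lindblad_conjTranspose v hh hc.isHermitian] at h1
  have e : localState β η N ((lindblad N J D v h Y).conjTranspose * Y) =
      star (localState β η N (Y.conjTranspose * lindblad N J D v h Y)) := by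
    rw [← localState_conjTranspose, Matrix.conjTranspose_mul, Matrix.conjTranspose_conjTranspose]
  rw [e] at h1
  rw [eq_neg_of_add_eq_zero_right h1]
  apply Complex.ext
  · simp
    ring
  · simp

/-- Stationarity identifies -2 Re ω(Y† 𝕃 Y) with the expectation of the carré du champ, which is
nonnegative. -/
lemma lindblad_dissipative (hh : h.IsHermitian) (hc : (kossakowski J D N).PosSemidef)
    (hω : ∀ X, localState β η N (lindblad N J D v h X) = 0) (Y : LocalAlg N) :
    (localState β η N (Y.conjTranspose * lindblad N J D v h Y)).re ≤ 0 := by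
  have h1 := carreDuChamp_nonneg v β η hc Y
  rw [localState_carreDuChamp hh hc hω, Complex.zero_le_real] at h1
  linarith

variable {L : Matrix (Fin 8) (Fin 8) ℝ}

/-- The rows of ℒ act on the observables, hence its transpose acts on coefficient vectors. -/
lemma lindblad_fluctOp (hL : ∀ (k : Fin N) (j : Fin 8),
      lindblad N J D v h (siteOp k (chi j)) = ∑ p, (L j p : ℂ) • siteOp k (chi p))
    (z : Fin 8 → ℂ) :
    lindblad N J D v h (fluctOp N z) = fluctOp N ((complexify L.transpose).mulVec z) := by
  simp only [fluctOp, map_smul, map_sum]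
  congr 1
  refine Finset.sum_congr rfl fun k _ => ?_
  simp only [obs, siteOp_sum, siteOp_smul, map_sum, map_smul, hL, Finset.smul_sum, smul_smul]
  rw [Finset.sum_comm]
  refine Finset.sum_congr rfl fun p _ => ?_
  rw [← Finset.sum_smul]
  congr 1
  simp only [complexify, Matrix.mulVec, dotProduct, Matrix.map_apply, Matrix.transpose_apply]
  exact Finset.sum_congr rfl fun j _ => mul_comm _ _

lemma localState_siteOp_mul (k l : Fin N) (x y : SiteMat) :
    localState β η N (siteOp k x * siteOp l y) =
      if k = l then siteExp β η (x * y) else siteExp β η x * siteExp β η y := by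
  rw [siteOp_eq_prodOp, siteOp_eq_prodOp, prodOp_mul, localState_prodOp]
  split_ifs with hkl
  · subst hkl
    rw [Finset.prod_eq_single k]
    · simp
    · intro j _ hj
      simp [hj, siteExp_one]
    · simp
  · rw [← Finset.mul_prod_erase _ _ (Finset.mem_univ k),
      ← Finset.mul_prod_erase _ _ (Finset.mem_erase.mpr ⟨Ne.symm hkl, Finset.mem_univ l⟩)]
    rw [Finset.prod_eq_one]
    · simp [hkl, Ne.symm hkl]
    · intro j hj
      simp only [Finset.mem_erase] at hj
      simp [hj.1, hj.2.1, siteExp_one]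

/-- All means vanish, so only the N pairs of equal sites contribute and cancel the prefactor 1/N:
the two-point function is already the limiting one for every N ≥ 1. -/
lemma localState_fluctOp_mul (hN : N ≠ 0) (z w : Fin 8 → ℂ) :
    localState β η N (fluctOp N z * fluctOp N w) = corr β η (star z) w := by
  simp only [fluctOp, smul_mul_smul_comm, localState_smul, Finset.sum_mul_sum, localState_sum,
    localState_siteOp_mul, siteExp_obs, zero_mul, siteExp_obs_mul]
  simp only [Finset.sum_ite_eq, Finset.mem_univ, if_true, Finset.sum_const, Finset.card_univ,
    Fintype.card_fin, nsmul_eq_mul]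
  have h1 : (((√N : ℝ) : ℂ))⁻¹ * ((√N : ℝ) : ℂ)⁻¹ * N = 1 := by
    have h2 : ((√N : ℝ) : ℂ) * (√N : ℝ) = N := by
      rw [← Complex.ofReal_mul, Real.mul_self_sqrt (Nat.cast_nonneg N), Complex.ofReal_natCast]
    have h3 : ((√N : ℝ) : ℂ) ≠ 0 := by
      simp [hN]
    rw [← h2]
    field_simp
  rw [← mul_assoc, h1, one_mul]

/-- The generator matrix is dissipative for the correlation form. -/
lemma corr_dissipative (hh : h.IsHermitian) (hc : (kossakowski J D N).PosSemidef)
    (hω : ∀ X, localState β η N (lindblad N J D v h X) = 0) (hN : N ≠ 0)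
    (hL : ∀ (k : Fin N) (j : Fin 8),
      lindblad N J D v h (siteOp k (chi j)) = ∑ p, (L j p : ℂ) • siteOp k (chi p))
    (z : Fin 8 → ℂ) : (corr β η z ((complexify L.transpose).mulVec z)).re ≤ 0 := by
  have h1 := lindblad_dissipative hh hc hω (fluctOp N z)
  rwa [lindblad_fluctOp hL, fluctOp_conjTranspose, localState_fluctOp_mul hN, star_star] at h1

open scoped Matrix.Norms.L2Operator in
lemma hasDerivAt_exp_smul_matrix (A : Matrix (Fin 8) (Fin 8) ℝ) (t : ℝ) :
    HasDerivAt (fun t : ℝ => NormedSpace.exp (t • A)) (A * NormedSpace.exp (t • A)) t :=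
  hasDerivAt_exp_smul_const' (𝕂 := ℝ) A t

lemma hasDerivAt_complexify_exp_mulVec (A : Matrix (Fin 8) (Fin 8) ℝ) (z : Fin 8 → ℂ) (t : ℝ) :
    HasDerivAt (fun t : ℝ => (complexify (NormedSpace.exp (t • A))).mulVec z)
      ((complexify A).mulVec ((complexify (NormedSpace.exp (t • A))).mulVec z)) t := by
  let T : Matrix (Fin 8) (Fin 8) ℝ →ₗ[ℝ] (Fin 8 → ℂ) :=
    { toFun := fun M => (complexify M).mulVec z
      map_add' := fun M M' => by
        rw [← Matrix.add_mulVec]; congr 1; ext i j; simp [complexify]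
      map_smul' := fun c M => by
        rw [RingHom.id_apply, ← Matrix.smul_mulVec]; congr 1; ext i j; simp [complexify] }
  have h1 := hasDerivAt_exp_smul_matrix A t
  open scoped Matrix.Norms.L2Operator in
  have h2 := (LinearMap.toContinuousLinearMap T).hasFDerivAt.comp_hasDerivAt t h1
  refine h2.congr_deriv ?_
  change (complexify _).mulVec z = _
  rw [complexify_mul, Matrix.mulVec_mulVec]

lemma hasDerivAt_corr_exp_mulVec (A : Matrix (Fin 8) (Fin 8) ℝ) (z : Fin 8 → ℂ) (s : ℝ) :
    HasDerivAt (fun s : ℝ => (corr β η ((complexify (NormedSpace.exp (s • A))).mulVec z)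
        ((complexify (NormedSpace.exp (s • A))).mulVec z)).re)
      (2 * (corr β η ((complexify (NormedSpace.exp (s • A))).mulVec z)
        ((complexify A).mulVec ((complexify (NormedSpace.exp (s • A))).mulVec z))).re) s := by
  set y : ℝ → (Fin 8 → ℂ) := fun t => (complexify (NormedSpace.exp (t • A))).mulVec z
  have h1 := hasDerivAt_complexify_exp_mulVec A z s
  have h2 : HasDerivAt (fun s => corr β η (y s) (y s))
      (corr β η ((complexify A).mulVec (y s)) (y s) +
        corr β η (y s) ((complexify A).mulVec (y s))) s := by
    have hc : ∀ i, HasDerivAt (fun s => y s i) ((complexify A).mulVec (y s) i) s :=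
      hasDerivAt_pi.mp h1
    simp only [corr, dotProduct, Matrix.mulVec, Pi.star_apply] at hc ⊢
    rw [← Finset.sum_add_distrib]
    refine HasDerivAt.fun_sum fun i _ => ?_
    refine ((hc i).star.mul (HasDerivAt.fun_sum fun j _ =>
      (hc j).const_mul (corrMat β η i j))).congr_deriv ?_
    rfl
  have h3 := Complex.reCLM.hasFDerivAt.comp_hasDerivAt s h2
  refine h3.congr_deriv ?_
  change (_ + _ : ℂ).re = _
  rw [← star_corr, Complex.add_re, Complex.star_def, Complex.conj_re]
  ring

/-- A dissipative generator generates contractions of the correlation form. -/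
lemma corrContraction_exp {A : Matrix (Fin 8) (Fin 8) ℝ}
    (hA : ∀ z, (corr β η z ((complexify A).mulVec z)).re ≤ 0) {t : ℝ} (ht : 0 ≤ t) :
    CorrContraction β η (NormedSpace.exp (t • A)) := by
  intro z
  set y : ℝ → (Fin 8 → ℂ) := fun t => (complexify (NormedSpace.exp (t • A))).mulVec z
  have hd : ∀ s : ℝ, HasDerivAt (fun s => (corr β η (y s) (y s)).re)
      (2 * (corr β η (y s) ((complexify A).mulVec (y s))).re) s := hasDerivAt_corr_exp_mulVec A z
  have ha : Antitone (fun s => (corr β η (y s) (y s)).re) := by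
    refine antitone_of_deriv_nonpos (fun s => (hd s).differentiableAt) fun s => ?_
    rw [(hd s).deriv]
    linarith [hA (y s)]
  have h0 : y 0 = z := by
    have : complexify 1 = 1 := by
      ext i j
      by_cases h : i = j <;> simp [complexify, Matrix.one_apply, h]
    simp [y, this]
  have := ha ht
  simp only [h0] at this
  exact this

end Invariance

/-! ### The central limit theorem -/

/-- The second-order Taylor expansion at a critical point. -/
lemma tendsto_second_difference {E : Type*} [NormedAddCommGroup E] [NormedSpace ℝ E] {f f' : ℝ → E}
    {a : E} (hf : ∀ x, HasDerivAt f (f' x) x) (h0 : f' 0 = 0) (hf' : HasDerivAt f' a 0) :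
    Filter.Tendsto (fun x : ℝ => (x ^ 2)⁻¹ • (f x - f 0)) (𝓝[>] 0) (𝓝 ((1 / 2 : ℝ) • a)) := by
  rw [Metric.tendsto_nhds]
  intro ε hε
  have hlo := (hasDerivAt_iff_isLittleO.mp hf').def (half_pos hε)
  obtain ⟨δ, hδ, hball⟩ := Metric.eventually_nhds_iff.mp hlo
  filter_upwards [Ioo_mem_nhdsGT hδ] with x hx
  have hd : ∀ y : ℝ, HasDerivAt (fun y => f y - (y ^ 2 / 2) • a) (f' y - y • a) y := fun y => by
    have h1 := (((hasDerivAt_id' y).pow 2).div_const 2).smul_const a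
    refine ((hf y).sub h1).congr_deriv ?_
    simp
  have hb : ∀ y ∈ Set.Ico (0 : ℝ) x, ‖f' y - y • a‖ ≤ ε / 2 * x := fun y hy => by
    have hy2 : dist y 0 < δ := by
      rw [Real.dist_eq, sub_zero, abs_of_nonneg hy.1]
      exact hy.2.trans hx.2
    have := hball hy2
    rw [h0, sub_zero, sub_zero, Real.norm_eq_abs, abs_of_nonneg hy.1] at this
    exact this.trans (mul_le_mul_of_nonneg_left hy.2.le (half_pos hε).le)
  have h := norm_image_sub_le_of_norm_deriv_le_segment' (fun y _ => (hd y).hasDerivWithinAt) hb x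
    ⟨hx.1.le, le_rfl⟩
  have hx2 : 0 < x ^ 2 := pow_pos hx.1 2
  have e : (x ^ 2)⁻¹ • (f x - f 0) - (1 / 2 : ℝ) • a =
      (x ^ 2)⁻¹ • (f x - (x ^ 2 / 2) • a - (f 0 - ((0 : ℝ) ^ 2 / 2) • a)) := by
    have : (1 / 2 : ℝ) • a = (x ^ 2)⁻¹ • ((x ^ 2 / 2) • a) := by
      have := hx.1.ne'
      rw [smul_smul]
      congr 1
      field_simp
    rw [this, ← smul_sub]
    congr 1
    simp only [ne_eq, OfNat.ofNat_ne_zero, not_false_eq_true, zero_pow, zero_div, zero_smul,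
      sub_zero]
    abel
  rw [dist_eq_norm, e, norm_smul, norm_inv, Real.norm_eq_abs, abs_of_pos hx2]
  calc (x ^ 2)⁻¹ * _ ≤ (x ^ 2)⁻¹ * (ε / 2 * x * (x - 0)) := by gcongr
    _ = ε / 2 := by
        have := hx.1.ne'
        field_simp
        ring
    _ < ε := half_lt_self hε

section CLT

variable (β η : ℝ)

/-- The one-site expectation as a continuous functional. -/
def siteExpCLM : SiteMat →L[ℂ] ℂ :=
  LinearMap.toContinuousLinearMap
    { toFun := siteExp β η
      map_add' := siteExp_add β η
      map_smul' := siteExp_smul β η }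

-- The first-order term is the expectation of A + B + C, which vanishes. The factors do not commute,
-- so the second-order cross terms keep their order.
open scoped Matrix.Norms.L2Operator in
lemma tendsto_siteExp_second_difference (A B C : SiteMat) (h0 : siteExp β η (A + B + C) = 0) :
    Filter.Tendsto (fun x : ℝ => (x ^ 2)⁻¹ • (siteExp β η (NormedSpace.exp ((x : ℂ) • A) *
      NormedSpace.exp ((x : ℂ) • B) * NormedSpace.exp ((x : ℂ) • C)) - 1)) (𝓝[>] 0)
      (𝓝 ((1 / 2 : ℝ) • siteExp β η (A * A + B * B + C * C +
        (2 : ℂ) • (A * B + A * C + B * C)))) := by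
  have hE : ∀ (X : SiteMat) (x : ℝ), HasDerivAt (fun x : ℝ => NormedSpace.exp ((x : ℂ) • X))
      (X * NormedSpace.exp ((x : ℂ) • X)) x := fun X x => by
    have h := hasDerivAt_exp_smul_const' (𝕂 := ℝ) X x
    simp only [← Complex.coe_smul] at h
    exact h
  set E : SiteMat → ℝ → SiteMat := fun X x => NormedSpace.exp ((x : ℂ) • X)
  have hE0 : ∀ X, E X 0 = 1 := fun X => by simp [E]
  have h1 : ∀ x, HasDerivAt (fun x => E A x * E B x * E C x)
      (A * E A x * E B x * E C x + E A x * (B * E B x) * E C x + E A x * E B x * (C * E C x)) x :=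
    fun x => by
      refine (((hE A x).mul (hE B x)).mul (hE C x)).congr_deriv ?_
      rw [add_mul]
      rfl
  have h2 : HasDerivAt (fun x => A * E A x * E B x * E C x + E A x * (B * E B x) * E C x +
      E A x * E B x * (C * E C x)) (A * A + B * B + C * C + (2 : ℂ) • (A * B + A * C + B * C)) 0 := by
    refine ((((((hE A 0).const_mul A).mul (hE B 0)).mul (hE C 0)).add
      (((hE A 0).mul ((hE B 0).const_mul B)).mul (hE C 0))).add
      (((hE A 0).mul (hE B 0)).mul ((hE C 0).const_mul C))).congr_deriv ?_
    change (A * (A * E A 0) * E B 0 + A * E A 0 * (B * E B 0)) * E C 0 +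
      A * E A 0 * E B 0 * (C * E C 0) + ((A * E A 0 * (B * E B 0) + E A 0 * (B * (B * E B 0))) * E C 0
      + E A 0 * (B * E B 0) * (C * E C 0)) + ((A * E A 0 * E B 0 + E A 0 * (B * E B 0)) * (C * E C 0)
      + E A 0 * E B 0 * (C * (C * E C 0))) = _
    simp only [hE0, mul_one, one_mul, add_mul, two_smul]
    abel
  have key := tendsto_second_difference (f := fun x => siteExp β η (E A x * E B x * E C x))
    (f' := fun x => siteExp β η (A * E A x * E B x * E C x + E A x * (B * E B x) * E C x +
      E A x * E B x * (C * E C x)))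
    (fun x => ((siteExpCLM β η).restrictScalars ℝ).hasFDerivAt.comp_hasDerivAt x (h1 x))
    (by simpa [hE0] using h0)
    (((siteExpCLM β η).restrictScalars ℝ).hasFDerivAt.comp_hasDerivAt (0 : ℝ) h2)
  simp only [hE0, mul_one, siteExp_one] at key
  exact key

/-- The central limit theorem for products of three exponentials in the product state. -/
lemma tendsto_localState_prodOp_exp (A B C : SiteMat) (h0 : siteExp β η (A + B + C) = 0) :
    Filter.Tendsto (fun N : ℕ => localState β η N (prodOp fun _ : Fin N =>
      NormedSpace.exp (((√N)⁻¹ : ℂ) • A) * NormedSpace.exp (((√N)⁻¹ : ℂ) • B) *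
        NormedSpace.exp (((√N)⁻¹ : ℂ) • C))) Filter.atTop
      (𝓝 (Complex.exp ((1 / 2 : ℂ) * siteExp β η (A * A + B * B + C * C +
        (2 : ℂ) • (A * B + A * C + B * C))))) := by
  have hε : Filter.Tendsto (fun N : ℕ => (√(N : ℝ))⁻¹) Filter.atTop (𝓝[>] 0) :=
    tendsto_inv_atTop_nhdsGT_zero.comp (Real.tendsto_sqrt_atTop.comp tendsto_natCast_atTop_atTop)
  have h1 := (tendsto_siteExp_second_difference β η A B C h0).comp hε
  set g : ℕ → ℂ := fun N => siteExp β η (NormedSpace.exp (((√N)⁻¹ : ℂ) • A) *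
    NormedSpace.exp (((√N)⁻¹ : ℂ) • B) * NormedSpace.exp (((√N)⁻¹ : ℂ) • C)) - 1
  have h2 : Filter.Tendsto (fun N : ℕ => (N : ℂ) * g N) Filter.atTop
      (𝓝 ((1 / 2 : ℂ) * siteExp β η (A * A + B * B + C * C +
        (2 : ℂ) • (A * B + A * C + B * C)))) := by
    have e : (1 / 2 : ℝ) • siteExp β η (A * A + B * B + C * C +
        (2 : ℂ) • (A * B + A * C + B * C)) = (1 / 2 : ℂ) * siteExp β η (A * A + B * B + C * C +
        (2 : ℂ) • (A * B + A * C + B * C)) := by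
      rw [Complex.real_smul]
      push_cast
      rfl
    rw [← e]
    refine h1.congr fun N => ?_
    simp only [Function.comp_apply, inv_pow, inv_inv, Real.sq_sqrt (Nat.cast_nonneg N), g,
      Complex.real_smul, Complex.ofReal_inv, Complex.ofReal_natCast]
  -- In the product state the expectation is the N-th power of the one-site value 1 + g N, and N · g
  -- N converges.
  refine (Complex.tendsto_one_add_pow_exp_of_tendsto h2).congr fun N => ?_
  rw [localState_prodOp, Finset.prod_const, Finset.card_univ, Fintype.card_fin]
  simp [g]

/-- The ordered cross terms in the limiting exponent are -(a, Cr), -(a, Cb) and -(r, Cb); their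
antisymmetric parts reproduce the phases of the Weyl relations. -/
lemma tendsto_localState_localWeyl (a r b : Fin 8 → ℝ) :
    Filter.Tendsto (fun N : ℕ => localState β η N
      (localWeyl β η N a * localWeyl β η N r * localWeyl β η N b)) Filter.atTop
      (𝓝 (mesoState β η (weylOp β η a * weylOp β η r * weylOp β η b))) := by
  have h0 : siteExp β η (Complex.I • obs (cvec a) + Complex.I • obs (cvec r) +
      Complex.I • obs (cvec b)) = 0 := by
    simp [siteExp_add, siteExp_smul, siteExp_obs]
  have h1 := tendsto_localState_prodOp_exp β η _ _ _ h0
  have e : mesoState β η (weylOp β η a * weylOp β η r * weylOp β η b) =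
      Complex.exp ((1 / 2 : ℂ) * siteExp β η ((Complex.I • obs (cvec a)) * (Complex.I • obs (cvec a)) +
        (Complex.I • obs (cvec r)) * (Complex.I • obs (cvec r)) +
        (Complex.I • obs (cvec b)) * (Complex.I • obs (cvec b)) +
        (2 : ℂ) • ((Complex.I • obs (cvec a)) * (Complex.I • obs (cvec r)) +
          (Complex.I • obs (cvec a)) * (Complex.I • obs (cvec b)) +
          (Complex.I • obs (cvec r)) * (Complex.I • obs (cvec b))))) := by
    have hself : ∀ s, form (sympMat β η) s s = 0 := fun s => by
      have := form_sympMat_antisymm β η s s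
      linarith
    have hm : ∀ (c : ℂ) X, mesoState β η (c • X) = c * mesoState β η X := fun c X => by
      simp [mesoState, inner_smul_right]
    rw [weylOp_mul, smul_mul_assoc, weylOp_mul, hm, hm, mesoState_weylOp, weylPhase, weylPhase,
      weylVal, ← Complex.exp_add, ← Complex.exp_add]
    congr 1
    simp only [siteExp_add, siteExp_smul, smul_mul_smul_comm, Complex.I_mul_I, siteExp_obs_mul,
      star_cvec, corr_cvec, hself, form_add_left, form_add_right]
    rw [form_covMat_symm β η r a, form_covMat_symm β η b a, form_covMat_symm β η b r]
    push_cast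
    ring
  rw [e]
  refine h1.congr fun N => ?_
  simp only [localWeyl_eq_prodOp, prodOp_mul]

lemma localWeyl_mul_conjTranspose (N : ℕ) (a : Fin 8 → ℝ) :
    localWeyl β η N a * (localWeyl β η N a).conjTranspose = 1 := by
  have hF : (Complex.I • fluctOp N (cvec a)).conjTranspose = -(Complex.I • fluctOp N (cvec a)) := by
    rw [Matrix.conjTranspose_smul, fluctOp_conjTranspose, star_cvec]
    simp
  rw [localWeyl_eq_exp, ← Matrix.exp_conjTranspose, hF,
    ← Matrix.exp_add_of_commute _ _
      (Commute.refl (Complex.I • fluctOp N (cvec a) : LocalAlg N)).neg_right, add_neg_cancel,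
    NormedSpace.exp_zero]

/-- Matrix elements between Weyl operators are bounded by the `L²`-norm of the thermal state. -/
lemma exists_norm_localState_localWeyl_le (a b : Fin 8 → ℝ) : ∃ K : ℝ, 0 ≤ K ∧ ∀ (N : ℕ)
    (Y : LocalAlg N), ‖localState β η N (localWeyl β η N a * Y * localWeyl β η N b)‖ ^ 2 ≤
      K * (localState β η N (Y.conjTranspose * Y)).re := by
  obtain ⟨c, P, hc, -, hu, hρ⟩ := exists_gram_isUnit β η
  have hdet : IsUnit (rho β η).det := by
    rw [hρ, Matrix.det_smul]
    exact ((IsUnit.mk0 c hc.ne').pow _).mul ((Matrix.isUnit_iff_isUnit_det _).mp (hu.mul hu))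
  -- The choice of A gives ρ e^{εA} = e^{εiX} ρ with X = ∑ b_j x_j, so under the trace W_N(b) can be
  -- moved to the left, where it becomes the product S of the e^{εA}. S is in general not unitary,
  -- but ω(SS†) converges by the central limit theorem and is therefore bounded in N.
  set A : SiteMat := (rho β η)⁻¹ * (Complex.I • obs (cvec b)) * rho β η with hA
  have hA0 : siteExp β η A = 0 := by
    rw [siteExp, hA, mul_assoc, Matrix.mul_nonsing_inv_cancel_left _ _ hdet, Matrix.trace_mul_comm]
    change siteExp β η _ = 0
    rw [siteExp_smul, siteExp_obs, mul_zero]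
  have h0 : siteExp β η (A + A.conjTranspose + 0) = 0 := by
    rw [siteExp_add, siteExp_add, siteExp_conjTranspose, hA0]
    simp [siteExp]
  have hlim := tendsto_localState_prodOp_exp β η A A.conjTranspose 0 h0
  obtain ⟨K, hK⟩ := ((Complex.continuous_re.tendsto _).comp hlim).bddAbove_range
  have hK' : ∀ N : ℕ, (localState β η N (prodOp fun _ : Fin N =>
      NormedSpace.exp (((√N)⁻¹ : ℂ) • A) * (NormedSpace.exp (((√N)⁻¹ : ℂ) • A)).conjTranspose)).re
      ≤ K := fun N => by
    have := hK ⟨N, rfl⟩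
    simp only [Function.comp_apply, smul_zero, NormedSpace.exp_zero, mul_one] at this
    have e : NormedSpace.exp (((√N)⁻¹ : ℂ) • A.conjTranspose) =
        (NormedSpace.exp (((√N)⁻¹ : ℂ) • A)).conjTranspose := by
      rw [← Matrix.exp_conjTranspose, Matrix.conjTranspose_smul]
      congr 2
      simp
    rwa [e] at this
  have hK0 : 0 ≤ K := by
    refine le_trans ?_ (hK' 0)
    have : prodOp (fun _ : Fin 0 => NormedSpace.exp (((√(0 : ℕ))⁻¹ : ℂ) • A) *
        (NormedSpace.exp (((√(0 : ℕ))⁻¹ : ℂ) • A)).conjTranspose) = 1 := by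
      rw [← prodOp_one]
      congr 1
      ext1 j
      exact j.elim0
    rw [this, localState_one]
    simp
  refine ⟨K, hK0, fun N Y => ?_⟩
  set ε : ℂ := (√N)⁻¹
  set S : LocalAlg N := prodOp fun _ => NormedSpace.exp (ε • A)
  have hS : localRho β η N * S = localWeyl β η N b * localRho β η N := by
    rw [localRho_eq_prodOp, prodOp_mul, localWeyl_eq_prodOp, prodOp_mul]
    congr 1
    ext1 _
    have e1 : ε • A = (rho β η)⁻¹ * (ε • (Complex.I • obs (cvec b))) * rho β η := by
      simp only [hA, mul_smul_comm, smul_mul_assoc]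
    rw [e1, Matrix.exp_conj' _ _ ((Matrix.isUnit_iff_isUnit_det _).mpr hdet), mul_assoc,
      Matrix.mul_nonsing_inv_cancel_left _ _ hdet]
  have hW := localWeyl_mul_conjTranspose β η N a
  have e2 : localState β η N (localWeyl β η N a * Y * localWeyl β η N b) =
      localState β η N ((S * localWeyl β η N a) * Y) := by
    rw [localState, localState, ← mul_assoc, Matrix.trace_mul_comm, ← mul_assoc, ← hS]
    simp only [mul_assoc]
  have h3 := localState_cauchySchwarz β η (S * localWeyl β η N a).conjTranspose Y
  have e3 : S * localWeyl β η N a * (localWeyl β η N a).conjTranspose * S.conjTranspose =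
      S * S.conjTranspose := by
    rw [mul_assoc S, hW, mul_one]
  rw [Matrix.conjTranspose_conjTranspose, ← e2, Matrix.conjTranspose_mul, ← mul_assoc, e3,
    prodOp_conjTranspose, prodOp_mul] at h3
  refine h3.trans (mul_le_mul_of_nonneg_right (hK' N) ?_)
  exact (Complex.nonneg_iff.mp (localState_nonneg β η Y)).1

end CLT

/-! ### Locality: summable couplings and the law of large numbers -/

/-- In a row each distance below N occurs at most once on either side of the diagonal. -/
lemma sum_couplings_row_le (J : ℕ → ℝ) (N : ℕ) (k : Fin N) :
    ∑ l, |couplings J N k l| ≤ 2 * ∑ i ∈ Finset.range N, |J i| := by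
  have h1 : ∑ l ∈ Finset.univ.filter (fun l : Fin N => l ≤ k), |couplings J N k l| ≤
      ∑ i ∈ Finset.range N, |J i| := by
    have hinj : Set.InjOn (fun l : Fin N => (k : ℕ) - l)
        (Finset.univ.filter (fun l : Fin N => l ≤ k) : Finset (Fin N)) := fun a ha b hb hab => by
      simp only [Finset.coe_filter, Set.mem_ofPred_eq, Finset.mem_univ, true_and] at ha hb
      have : (a : ℕ) ≤ k := ha
      have : (b : ℕ) ≤ k := hb
      ext
      simp only at hab
      omega
    calc _ = ∑ i ∈ (Finset.univ.filter (fun l : Fin N => l ≤ k)).image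
          (fun l : Fin N => (k : ℕ) - l), |J i| := by
          rw [Finset.sum_image hinj]
          refine Finset.sum_congr rfl fun l hl => ?_
          have hl : (l : ℕ) ≤ k := (Finset.mem_filter.mp hl).2
          rw [couplings, Matrix.of_apply]
          congr 2
          omega
      _ ≤ _ := by
          refine Finset.sum_le_sum_of_subset_of_nonneg (fun i hi => ?_) fun _ _ _ => abs_nonneg _
          obtain ⟨l, -, rfl⟩ := Finset.mem_image.mp hi
          exact Finset.mem_range.mpr (lt_of_le_of_lt (Nat.sub_le _ _) k.2)
  have h2 : ∑ l ∈ Finset.univ.filter (fun l : Fin N => ¬ l ≤ k), |couplings J N k l| ≤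
      ∑ i ∈ Finset.range N, |J i| := by
    have hinj : Set.InjOn (fun l : Fin N => (l : ℕ) - k)
        (Finset.univ.filter (fun l : Fin N => ¬ l ≤ k) : Finset (Fin N)) := fun a ha b hb hab => by
      simp only [Finset.coe_filter, Set.mem_ofPred_eq, Finset.mem_univ, true_and] at ha hb
      have : (k : ℕ) < a := not_le.mp ha
      have : (k : ℕ) < b := not_le.mp hb
      ext
      simp only at hab
      omega
    calc _ = ∑ i ∈ (Finset.univ.filter (fun l : Fin N => ¬ l ≤ k)).image
          (fun l : Fin N => (l : ℕ) - k), |J i| := by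
          rw [Finset.sum_image hinj]
          refine Finset.sum_congr rfl fun l hl => ?_
          have hl : (k : ℕ) < l := not_le.mp (Finset.mem_filter.mp hl).2
          rw [couplings, Matrix.of_apply]
          congr 2
          omega
      _ ≤ _ := by
          refine Finset.sum_le_sum_of_subset_of_nonneg (fun i hi => ?_) fun _ _ _ => abs_nonneg _
          obtain ⟨l, -, rfl⟩ := Finset.mem_image.mp hi
          exact Finset.mem_range.mpr (lt_of_le_of_lt (Nat.sub_le _ _) l.2)
  rw [← Finset.sum_filter_add_sum_filter_not Finset.univ (fun l : Fin N => l ≤ k)]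
  linarith

/-- In a chain of 2N sites, each of the first N sites has sites at all distances 0, …, N - 1 to its
right. -/
lemma mul_sum_abs_le_sum_couplings (J : ℕ → ℝ) (N : ℕ) :
    N * ∑ i ∈ Finset.range N, |J i| ≤
      ∑ k : Fin (N + N), ∑ l : Fin (N + N), |couplings J (N + N) k l| := by
  rw [Fin.sum_univ_add]
  have h1 : ∀ k : Fin N, ∑ i ∈ Finset.range N, |J i| ≤
      ∑ l, |couplings J (N + N) (Fin.castAdd N k) l| := fun k => by
    have hinj : Function.Injective fun i : Fin N => (⟨k + i, by omega⟩ : Fin (N + N)) :=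
      fun a b hab => by
        simp only [Fin.mk.injEq] at hab
        ext
        omega
    calc ∑ i ∈ Finset.range N, |J i| = ∑ i : Fin N, |J i| :=
          (Fin.sum_univ_eq_sum_range (fun i => |J i|) N).symm
      _ = ∑ l ∈ Finset.univ.map ⟨_, hinj⟩, |couplings J (N + N) (Fin.castAdd N k) l| := by
          rw [Finset.sum_map]
          refine Finset.sum_congr rfl fun i _ => ?_
          rw [couplings, Matrix.of_apply]
          congr 2
          simp
      _ ≤ _ := Finset.sum_le_sum_of_subset_of_nonneg (Finset.subset_univ _)
          fun _ _ _ => abs_nonneg _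
  have h2 := Finset.sum_le_sum fun (k : Fin N) (_ : k ∈ Finset.univ) => h1 k
  rw [Finset.sum_const, Finset.card_univ, Fintype.card_fin, nsmul_eq_mul] at h2
  have h3 : 0 ≤ ∑ k : Fin N, ∑ l, |couplings J (N + N) (Fin.natAdd N k) l| :=
    Finset.sum_nonneg fun _ _ => Finset.sum_nonneg fun _ _ => abs_nonneg _
  linarith

/-- Couplings of bounded average total strength have bounded row sums. -/
lemma exists_couplings_row_le {J : ℕ → ℝ} (hJ : ∃ c : ℝ, Filter.Tendsto
    (fun N : ℕ => (1 / (N : ℝ)) * ∑ k : Fin N, ∑ l : Fin N, |couplings J N k l|)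
    Filter.atTop (𝓝 c)) : ∃ R : ℝ, 0 ≤ R ∧ ∀ N k, ∑ l, |couplings J N k l| ≤ R := by
  obtain ⟨c, hc⟩ := hJ
  obtain ⟨B, hB⟩ := hc.bddAbove_range
  -- If B bounds the averages, the total strength on 2N sites is at most 2N · B, and dividing by N
  -- leaves 2B.
  have h1 : ∀ N : ℕ, N ≠ 0 → ∑ i ∈ Finset.range N, |J i| ≤ 2 * B := fun N hN => by
    have h2 := hB ⟨N + N, rfl⟩
    have hN' : (0 : ℝ) < N := by positivity
    simp only at h2
    rw [one_div, inv_mul_le_iff₀ (by push_cast; positivity)] at h2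
    have h3 := (mul_sum_abs_le_sum_couplings J N).trans h2
    push_cast at h3
    nlinarith
  have h0 : 0 ≤ 2 * B := le_trans (Finset.sum_nonneg fun _ _ => abs_nonneg _) (h1 1 one_ne_zero)
  refine ⟨2 * (2 * B), by positivity, fun N k => (sum_couplings_row_le J N k).trans ?_⟩
  have := h1 N (by rintro rfl; exact k.elim0)
  linarith

lemma couplings_symm (J : ℕ → ℝ) (N : ℕ) (k l : Fin N) :
    couplings J N k l = couplings J N l k := by
  rw [couplings, Matrix.of_apply, Matrix.of_apply, ← Int.natAbs_neg, neg_sub]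

/-! ### Variances of weighted sums of two-site observables -/

section Variance

variable {β η : ℝ} {N : ℕ}

lemma localState_conjTranspose_prodOp_mul_prodOp {f g : Fin N → SiteMat}
    (hfg : ∀ j, f j = 1 ∨ g j = 1) :
    localState β η N ((prodOp f).conjTranspose * prodOp g) =
      star (localState β η N (prodOp f)) * localState β η N (prodOp g) := by
  rw [prodOp_conjTranspose, prodOp_mul, localState_prodOp, localState_prodOp, localState_prodOp,
    star_prod, ← Finset.prod_mul_distrib]
  refine Finset.prod_congr rfl fun j _ => ?_
  rw [← siteExp_conjTranspose]
  rcases hfg j with h | h <;> simp [h, siteExp_one]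

/-- Two-site observables on disjoint pairs of sites are uncorrelated. -/
lemma localState_conjTranspose_mul_of_disjoint {k l k' l' : Fin N} (h1 : k' ≠ k) (h2 : k' ≠ l)
    (h3 : l' ≠ k) (h4 : l' ≠ l) (a b a' b' : SiteMat) :
    localState β η N ((siteOp k a * siteOp l b).conjTranspose * (siteOp k' a' * siteOp l' b')) =
      star (localState β η N (siteOp k a * siteOp l b)) *
        localState β η N (siteOp k' a' * siteOp l' b') := by
  simp only [siteOp_eq_prodOp, prodOp_mul]
  refine localState_conjTranspose_prodOp_mul_prodOp fun j => ?_
  by_cases hk : j = k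
  · subst hk
    simp [h1.symm, h3.symm]
  · by_cases hl : j = l
    · subst hl
      simp [h2.symm, h4.symm]
    · simp [hk, hl]

lemma localState_centered (Y : LocalAlg N) :
    localState β η N ((Y - localState β η N Y • 1).conjTranspose * (Y - localState β η N Y • 1)) =
      localState β η N (Y.conjTranspose * Y) - star (localState β η N Y) * localState β η N Y := by
  simp only [Matrix.conjTranspose_sub, Matrix.conjTranspose_smul, Matrix.conjTranspose_one, sub_mul,
    mul_sub, localState_sub, mul_smul_comm, smul_mul_assoc, mul_one, one_mul, localState_smul,
    localState_one, localState_conjTranspose]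
  ring

open scoped Matrix.Norms.L2Operator in
/-- The variance of a linear combination of two-site observables. -/
lemma variance_sum_le {c : Fin N → Fin N → ℝ} {T : Fin N → Fin N → LocalAlg N} {K R : ℝ}
    (hK : ∀ k l, ‖T k l‖ ≤ K) (hT : ∀ k l k' l', k' ≠ k → k' ≠ l → l' ≠ k → l' ≠ l →
      localState β η N ((T k l).conjTranspose * T k' l') =
        star (localState β η N (T k l)) * localState β η N (T k' l'))
    (hrow : ∀ k, ∑ l, |c k l| ≤ R) (hcol : ∀ l, ∑ k, |c k l| ≤ R) {Y : LocalAlg N}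
    (hY : Y = ∑ k, ∑ l, (c k l : ℂ) • T k l) :
    (localState β η N ((Y - localState β η N Y • 1).conjTranspose *
      (Y - localState β η N Y • 1))).re ≤ 8 * K ^ 2 * R ^ 2 * N := by
  rcases Nat.eq_zero_or_pos N with rfl | hN
  · simp [hY, localState]
  have hK0 : 0 ≤ K := (norm_nonneg _).trans (hK ⟨0, hN⟩ ⟨0, hN⟩)
  have hR0 : 0 ≤ R := (Finset.sum_nonneg fun _ _ => abs_nonneg _).trans (hrow ⟨0, hN⟩)
  set cov : Fin N → Fin N → Fin N → Fin N → ℂ := fun k l k' l' =>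
    localState β η N ((T k l).conjTranspose * T k' l') -
      star (localState β η N (T k l)) * localState β η N (T k' l') with hcov
  -- The covariance of two terms vanishes unless their pairs share a site, and is at most 2K²
  -- otherwise. The four indicators dominate the event of a shared site and make the sum tractable.
  have hc1 : ∀ k l k' l', ‖cov k l k' l'‖ ≤ 2 * K ^ 2 * ((if k' = k then 1 else 0) +
      (if k' = l then 1 else 0) + (if l' = k then 1 else 0) + (if l' = l then 1 else 0)) :=
    fun k l k' l' => by
      by_cases h : k' ≠ k ∧ k' ≠ l ∧ l' ≠ k ∧ l' ≠ l
      · obtain ⟨h1, h2, h3, h4⟩ := h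
        simp only [hcov, hT k l k' l' h1 h2 h3 h4, sub_self, norm_zero]
        positivity
      · have hb : ‖cov k l k' l'‖ ≤ 2 * K ^ 2 := by
          have e1 : ‖localState β η N ((T k l).conjTranspose * T k' l')‖ ≤ K * K := by
            refine (norm_localState_le β η _).trans ((norm_mul_le _ _).trans ?_)
            rw [← Matrix.star_eq_conjTranspose, norm_star]
            exact mul_le_mul (hK _ _) (hK _ _) (norm_nonneg _) hK0
          have e2 : ‖star (localState β η N (T k l)) * localState β η N (T k' l')‖ ≤ K * K := by
            rw [norm_mul, norm_star]
            exact mul_le_mul ((norm_localState_le β η _).trans (hK _ _))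
              ((norm_localState_le β η _).trans (hK _ _)) (norm_nonneg _) hK0
          refine (norm_sub_le _ _).trans ?_
          linarith
        refine hb.trans (le_mul_of_one_le_right (by positivity) ?_)
        split_ifs <;> simp_all
        norm_num
  have e : localState β η N ((Y - localState β η N Y • 1).conjTranspose *
      (Y - localState β η N Y • 1)) =
      ∑ k, ∑ l, ∑ k', ∑ l', ((c k l : ℂ) * c k' l') * cov k l k' l' := by
    rw [localState_centered, hY]
    simp only [Matrix.conjTranspose_sum, Matrix.conjTranspose_smul, Complex.star_def,
      Complex.conj_ofReal, Finset.sum_mul, localState_sum, localState_smul, map_sum, map_mul]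
    simp only [Finset.mul_sum, smul_mul_smul_comm, localState_sum, localState_smul,
      ← Finset.sum_sub_distrib, hcov, Complex.star_def]
    refine Finset.sum_congr rfl fun k _ => Finset.sum_congr rfl fun l _ =>
      Finset.sum_congr rfl fun k' _ => Finset.sum_congr rfl fun l' _ => ?_
    ring
  -- Each possible coincidence fixes one of the two inner indices and leaves one row or column sum;
  -- four of them, times 2K², produce the constant 8.
  have hrow' : ∀ k l, ∑ k', ∑ l', |c k' l'| * ((if k' = k then 1 else 0) +
      (if k' = l then 1 else 0) + (if l' = k then 1 else 0) + (if l' = l then (1 : ℝ) else 0)) ≤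
      4 * R := fun k l => by
    simp only [mul_add, Finset.sum_add_distrib, mul_ite, mul_one, mul_zero, Finset.sum_ite_eq',
      Finset.mem_univ, if_true]
    have e1 : ∀ m, ∑ k', ∑ l', (if k' = m then |c k' l'| else 0) = ∑ l', |c m l'| := fun m => by
      rw [Finset.sum_comm]
      simp
    rw [e1, e1]
    linarith [hrow k, hrow l, hcol k, hcol l]
  rw [e]
  calc _ ≤ ‖∑ k, ∑ l, ∑ k', ∑ l', ((c k l : ℂ) * c k' l') * cov k l k' l'‖ := Complex.re_le_norm _
    _ ≤ ∑ k, ∑ l, ∑ k', ∑ l', (|c k l| * |c k' l'|) * (2 * K ^ 2 * ((if k' = k then 1 else 0) +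
      (if k' = l then 1 else 0) + (if l' = k then 1 else 0) + (if l' = l then 1 else 0))) := by
        refine norm_sum_le_of_le _ fun k _ => norm_sum_le_of_le _ fun l _ =>
          norm_sum_le_of_le _ fun k' _ => norm_sum_le_of_le _ fun l' _ => ?_
        rw [norm_mul, norm_mul, Complex.norm_real, Complex.norm_real, Real.norm_eq_abs,
          Real.norm_eq_abs]
        exact mul_le_mul_of_nonneg_left (hc1 k l k' l') (by positivity)
    _ = ∑ k, ∑ l, |c k l| * (2 * K ^ 2) * ∑ k', ∑ l', |c k' l'| * ((if k' = k then 1 else 0) +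
      (if k' = l then 1 else 0) + (if l' = k then 1 else 0) + (if l' = l then (1 : ℝ) else 0)) := by
        simp only [Finset.mul_sum]
        refine Finset.sum_congr rfl fun k _ => Finset.sum_congr rfl fun l _ =>
          Finset.sum_congr rfl fun k' _ => Finset.sum_congr rfl fun l' _ => ?_
        ring
    _ ≤ ∑ k, ∑ l, |c k l| * (2 * K ^ 2) * (4 * R) :=
        Finset.sum_le_sum fun k _ => Finset.sum_le_sum fun l _ =>
          mul_le_mul_of_nonneg_left (hrow' k l) (by positivity)
    _ = (∑ k, ∑ l, |c k l|) * (8 * K ^ 2 * R) := by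
        simp only [Finset.sum_mul]
        refine Finset.sum_congr rfl fun k _ => Finset.sum_congr rfl fun l _ => ?_
        ring
    _ ≤ (∑ _k : Fin N, R) * (8 * K ^ 2 * R) :=
        mul_le_mul_of_nonneg_right (Finset.sum_le_sum fun k _ => hrow k) (by positivity)
    _ = _ := by
        rw [Finset.sum_const, Finset.card_univ, Fintype.card_fin, nsmul_eq_mul]
        ring

end Variance

/-! ### Commutators of fluctuations with one-site operators -/

section Commutators

variable {N : ℕ}

/-- Only the site k contributes, so every commutator with a fluctuation gains a factor N^{-1/2} and
stays at one site. This is the source of the powers of N in the remainders. -/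
lemma fluctOp_lie_siteOp (z : Fin 8 → ℂ) (k : Fin N) (x : SiteMat) :
    ⁅fluctOp N z, siteOp k x⁆ = ((√N)⁻¹ : ℂ) • siteOp k ⁅obs z, x⁆ := by
  rw [fluctOp, Ring.lie_def, smul_mul_assoc, mul_smul_comm, ← smul_sub, Finset.sum_mul,
    Finset.mul_sum, ← Finset.sum_sub_distrib, Finset.sum_eq_single k]
  · rw [Ring.lie_def, siteOp_sub, siteOp_mul, siteOp_mul]
  · intro j _ hj
    rw [siteOp_commute hj, sub_self]
  · simp

lemma siteOp_lie_fluctOp (z : Fin 8 → ℂ) (k : Fin N) (x : SiteMat) :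
    ⁅siteOp k x, fluctOp N z⁆ = ((√N)⁻¹ : ℂ) • siteOp k ⁅x, obs z⁆ := by
  have h := fluctOp_lie_siteOp z k x
  rw [← neg_inj, Ring.lie_def, neg_sub, ← Ring.lie_def, h, ← smul_neg, Ring.lie_def, Ring.lie_def,
    siteOp_sub, siteOp_sub, neg_sub]

open scoped Matrix.Norms.L2Operator in
lemma norm_siteOp_le (k : Fin N) (x : SiteMat) : ‖siteOp k x‖ ≤ ‖x‖ :=
  NonUnitalStarAlgHom.norm_apply_le (siteHom k) x

open scoped Matrix.Norms.L2Operator in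
lemma norm_lie_le {x y : SiteMat} {a b : ℝ} (ha : ‖x‖ ≤ a) (hb : ‖y‖ ≤ b) :
    ‖⁅x, y⁆‖ ≤ 2 * a * b := by
  have ha0 : 0 ≤ a := (norm_nonneg _).trans ha
  rw [Ring.lie_def]
  have h1 := (norm_mul_le x y).trans (mul_le_mul ha hb (norm_nonneg _) ha0)
  have h2 := (norm_mul_le y x).trans (mul_le_mul hb ha (norm_nonneg _) ((norm_nonneg _).trans hb))
  refine (norm_sub_le _ _).trans ?_
  linarith

end Commutators

/-! ### The generator on local Weyl operators -/

/-- By the parallelogram law the defect is the nonnegative value at X + Y. -/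
lemma localState_sub_conjTranspose_mul_le (β η : ℝ) {N : ℕ} (X Y : LocalAlg N) :
    (localState β η N ((X - Y).conjTranspose * (X - Y))).re ≤
      2 * (localState β η N (X.conjTranspose * X)).re +
        2 * (localState β η N (Y.conjTranspose * Y)).re := by
  have h := (Complex.nonneg_iff.mp (localState_nonneg β η (X + Y))).1
  simp only [Matrix.conjTranspose_add, Matrix.conjTranspose_sub, add_mul, mul_add, sub_mul, mul_sub,
    localState_add, localState_sub, Complex.add_re, Complex.sub_re] at h ⊢
  linarith

section Error

variable {N d : ℕ} {J : ℕ → ℝ} {D : Matrix (Fin d) (Fin d) ℂ} {v : Fin d → SiteMat} {h : SiteMat}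
  {β η : ℝ} {L : Matrix (Fin 8) (Fin 8) ℝ}

lemma sum_norm_kossakowski_le {R : ℝ} (hR : ∀ k : Fin N, ∑ l, |couplings J N k l| ≤ R) :
    ∑ p, ∑ q, ‖kossakowski J D N p q‖ ≤ N * R * ∑ μ, ∑ ν, ‖D μ ν‖ := by
  have e : ∑ p, ∑ q, ‖kossakowski J D N p q‖ =
      (∑ k, ∑ l, |couplings J N k l|) * ∑ μ, ∑ ν, ‖D μ ν‖ := by
    simp only [Fintype.sum_prod_type, kossakowski, Matrix.of_apply, norm_mul, Complex.norm_real,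
      Real.norm_eq_abs, Finset.sum_mul]
    refine Finset.sum_congr rfl fun k _ => ?_
    rw [Finset.sum_comm]
    refine Finset.sum_congr rfl fun l _ => ?_
    simp only [Finset.mul_sum]
  rw [e]
  refine mul_le_mul_of_nonneg_right ?_
    (Finset.sum_nonneg fun _ _ => Finset.sum_nonneg fun _ _ => norm_nonneg _)
  refine (Finset.sum_le_sum fun k _ => hR k).trans ?_
  simp

lemma norm_inv_sqrt (N : ℕ) : ‖((√N)⁻¹ : ℂ)‖ = (√(N : ℝ))⁻¹ := by
  rw [norm_inv, Complex.norm_real, Real.norm_of_nonneg (Real.sqrt_nonneg _)]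

lemma inv_sqrt_mul_inv_sqrt (N : ℕ) : ((√N)⁻¹ : ℂ) * ((√N)⁻¹ : ℂ) = ((N : ℝ)⁻¹ : ℝ) := by
  rw [← Complex.ofReal_inv, ← Complex.ofReal_mul, ← mul_inv, Real.mul_self_sqrt (Nat.cast_nonneg N)]

variable (J D v) in
/-- The carré du champ of a fluctuation as an average of two-site observables. -/
lemma carreDuChamp_fluctOp (z : Fin 8 → ℂ) :
    ∑ p, ∑ q, kossakowski J D N p q •
      (⁅noise v N p, fluctOp N z⁆ * ⁅fluctOp N z, (noise v N q).conjTranspose⁆) =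
    ∑ k, ∑ l, ((couplings J N k l * (N : ℝ)⁻¹ : ℝ) : ℂ) • ∑ μ, ∑ ν, D μ ν •
      (siteOp k ⁅v μ, obs z⁆ * siteOp l ⁅obs z, (v ν).conjTranspose⁆) := by
  simp only [Fintype.sum_prod_type, kossakowski, Matrix.of_apply, noise, siteOp_conjTranspose,
    fluctOp_lie_siteOp, siteOp_lie_fluctOp, smul_mul_smul_comm, smul_smul, inv_sqrt_mul_inv_sqrt]
  refine Finset.sum_congr rfl fun k _ => ?_
  rw [Finset.sum_comm]
  refine Finset.sum_congr rfl fun l _ => ?_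
  simp only [Finset.smul_sum, smul_smul]
  refine Finset.sum_congr rfl fun μ _ => Finset.sum_congr rfl fun ν _ => ?_
  congr 1
  push_cast
  ring

open scoped Matrix.Norms.L2Operator in
/-- The fluctuations of the carré du champ vanish in the limit. -/
lemma variance_carreDuChamp_le {R V B : ℝ} (hR : ∀ k : Fin N, ∑ l, |couplings J N k l| ≤ R)
    (hV : ∀ μ, ‖v μ‖ ≤ V) {z : Fin 8 → ℂ} (hB : ‖obs z‖ ≤ B) {Γ : LocalAlg N}
    (hΓ : Γ = ∑ p, ∑ q, kossakowski J D N p q •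
      (⁅noise v N p, fluctOp N z⁆ * ⁅fluctOp N z, (noise v N q).conjTranspose⁆)) :
    (localState β η N ((Γ - localState β η N Γ • 1).conjTranspose *
      (Γ - localState β η N Γ • 1))).re ≤
      8 * ((∑ μ, ∑ ν, ‖D μ ν‖) * (4 * V ^ 2 * B ^ 2)) ^ 2 * R ^ 2 / N := by
  rcases Nat.eq_zero_or_pos N with rfl | hN
  · simp [hΓ, localState]
  -- The weights J_{kl}/N have row sums at most R/N, so the factor N(R/N)² in `variance_sum_le` is
  -- R²/N.
  have hrow : ∀ k, ∑ l, |couplings J N k l * (N : ℝ)⁻¹| ≤ R * (N : ℝ)⁻¹ := fun k => by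
    simp only [abs_mul, abs_inv, Nat.abs_cast, ← Finset.sum_mul]
    exact mul_le_mul_of_nonneg_right (hR k) (by positivity)
  have hcol : ∀ l, ∑ k, |couplings J N k l * (N : ℝ)⁻¹| ≤ R * (N : ℝ)⁻¹ := fun l => by
    simp only [couplings_symm J N _ l]
    exact hrow l
  have h := variance_sum_le (β := β) (η := η) (T := fun k l => ∑ μ, ∑ ν, D μ ν •
      (siteOp k ⁅v μ, obs z⁆ * siteOp l ⁅obs z, (v ν).conjTranspose⁆))
    (K := (∑ μ, ∑ ν, ‖D μ ν‖) * (4 * V ^ 2 * B ^ 2)) (fun k l => ?_) (fun k l k' l' h1 h2 h3 h4 => ?_)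
    hrow hcol (hΓ.trans (carreDuChamp_fluctOp J D v z))
  · refine h.trans_eq ?_
    have : (N : ℝ) ≠ 0 := by positivity
    field_simp
  · simp only [Finset.sum_mul]
    refine norm_sum_le_of_le _ fun μ _ => norm_sum_le_of_le _ fun ν _ => ?_
    rw [norm_smul]
    refine mul_le_mul_of_nonneg_left ?_ (norm_nonneg _)
    have hV0 : 0 ≤ V := (norm_nonneg _).trans (hV μ)
    have hB0 : 0 ≤ B := (norm_nonneg _).trans hB
    have hV' : ‖(v ν).conjTranspose‖ ≤ V := by
      rw [← Matrix.star_eq_conjTranspose, norm_star]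
      exact hV ν
    refine (norm_mul_le _ _).trans ((mul_le_mul ((norm_siteOp_le _ _).trans (norm_lie_le (hV μ) hB))
      ((norm_siteOp_le _ _).trans (norm_lie_le hB hV')) (norm_nonneg _) (by positivity)).trans_eq ?_)
    ring
  · simp only [Matrix.conjTranspose_sum, Matrix.conjTranspose_smul, Finset.sum_mul, localState_sum,
      localState_smul, star_sum, star_mul']
    simp only [Finset.mul_sum, smul_mul_smul_comm, localState_sum, localState_smul,
      localState_conjTranspose_mul_of_disjoint h1 h2 h3 h4]
    refine Finset.sum_congr rfl fun _ _ => Finset.sum_congr rfl fun _ _ =>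
      Finset.sum_congr rfl fun _ _ => Finset.sum_congr rfl fun _ _ => ?_
    ring

open scoped Matrix.Norms.L2Operator in
/-- The first-order remainder of the generator on a local Weyl operator. -/
lemma norm_lindblad_exp_sub_le {R V B : ℝ} (hR : ∀ k : Fin N, ∑ l, |couplings J N k l| ≤ R)
    (hV : ∀ μ, ‖v μ‖ ≤ V) {z : Fin 8 → ℂ} (hz : star z = z) (hB : ‖obs z‖ ≤ B) :
    ‖lindblad N J D v h (NormedSpace.exp (Complex.I • fluctOp N z)) -
      (∫ u in (0 : ℝ)..1, expI (fluctOp N z) (1 - u) *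
        (Complex.I • lindblad N J D v h (fluctOp N z)) * expI (fluctOp N z) u) +
      (1 / 2 : ℂ) • (NormedSpace.exp (Complex.I • fluctOp N z) *
        ∑ p, ∑ q, kossakowski J D N p q •
          (⁅noise v N p, fluctOp N z⁆ * ⁅fluctOp N z, (noise v N q).conjTranspose⁆))‖ ≤
      16 * V ^ 2 * B ^ 3 * R * (∑ μ, ∑ ν, ‖D μ ν‖) * (√(N : ℝ))⁻¹ := by
  have hF : star (fluctOp N z) = fluctOp N z := by
    rw [Matrix.star_eq_conjTranspose, fluctOp_conjTranspose, hz]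
  refine (norm_generator_exp_sub_le (kossakowski J D N) (noise v N)
    (fun q => (noise v N q).conjTranspose) (LinearMap.toContinuousLinearMap (lindblad N J D v h))
    (lindblad_one J D v h) (lindblad_mul J D v h) hF).trans ?_
  have hB0 : 0 ≤ B := (norm_nonneg _).trans hB
  set n : ℝ := (√(N : ℝ))⁻¹ with hn
  have hn0 : 0 ≤ n := by positivity
  -- Each product contains three commutators with the fluctuation, hence N^{-3/2}; the sum of the
  -- coefficients costs a factor N. The constant is 16 = 8 + 8, each commutator contributing a
  -- factor 2.
  have hterm : ∀ p q : Fin N × Fin d, ‖⁅noise v N p, fluctOp N z⁆‖ *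
      ‖⁅fluctOp N z, ⁅fluctOp N z, (noise v N q).conjTranspose⁆⁆‖ +
      ‖⁅fluctOp N z, ⁅noise v N p, fluctOp N z⁆⁆‖ * ‖⁅fluctOp N z, (noise v N q).conjTranspose⁆‖ ≤
      16 * V ^ 2 * B ^ 3 * n ^ 3 := fun p q => by
    have hV0 : 0 ≤ V := (norm_nonneg _).trans (hV p.2)
    have hV' : ‖(v q.2).conjTranspose‖ ≤ V := by
      rw [← Matrix.star_eq_conjTranspose, norm_star]
      exact hV q.2
    have hlie : ∀ (c : ℂ) (X Y : LocalAlg N), ⁅X, c • Y⁆ = c • ⁅X, Y⁆ := fun c X Y => by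
      rw [Ring.lie_def, Ring.lie_def, mul_smul_comm, smul_mul_assoc, smul_sub]
    simp only [noise, siteOp_conjTranspose, fluctOp_lie_siteOp, siteOp_lie_fluctOp, hlie, norm_smul,
      norm_inv_sqrt, ← hn]
    have e1 := (norm_siteOp_le p.1 _).trans (norm_lie_le (hV p.2) hB)
    have e2 := (norm_siteOp_le q.1 _).trans (norm_lie_le hB hV')
    have e3 := (norm_siteOp_le p.1 _).trans (norm_lie_le hB (norm_lie_le (hV p.2) hB))
    have e4 := (norm_siteOp_le q.1 _).trans (norm_lie_le hB (norm_lie_le hB hV'))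
    calc _ ≤ n * (2 * V * B) * (n * (n * (2 * B * (2 * B * V)))) +
          n * (n * (2 * B * (2 * V * B))) * (n * (2 * B * V)) := by gcongr
      _ = _ := by ring
  calc _ ≤ ∑ p, ∑ q, ‖kossakowski J D N p q‖ * (16 * V ^ 2 * B ^ 3 * n ^ 3) :=
        Finset.sum_le_sum fun p _ => Finset.sum_le_sum fun q _ =>
          mul_le_mul_of_nonneg_left (hterm p q) (norm_nonneg _)
    _ = (∑ p, ∑ q, ‖kossakowski J D N p q‖) * (16 * V ^ 2 * B ^ 3 * n ^ 3) := by
        simp only [Finset.sum_mul]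
    _ ≤ (N * R * ∑ μ, ∑ ν, ‖D μ ν‖) * (16 * V ^ 2 * B ^ 3 * n ^ 3) :=
        mul_le_mul_of_nonneg_right (sum_norm_kossakowski_le hR) (by positivity)
    _ = 16 * V ^ 2 * B ^ 3 * R * (∑ μ, ∑ ν, ‖D μ ν‖) * ((N * n ^ 2) * n) := by ring
    _ = _ := by
        -- For N = 0 the inverse of √0 is 0 and both sides vanish.
        rcases Nat.eq_zero_or_pos N with h0 | hN
        · have : n = 0 := by rw [hn, h0]; simp
          simp [this]
        · have : (N : ℝ) * n ^ 2 = 1 := by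
            rw [hn, inv_pow, Real.sq_sqrt (Nat.cast_nonneg N)]
            exact mul_inv_cancel₀ (by positivity)
          rw [this, one_mul]

variable (β η) in
open scoped Matrix.Norms.L2Operator in
/-- On local Weyl operators the microscopic generator is close, in the `L²`-norm of the thermal
state, to the generator of the quasi-free dynamics. -/
lemma localState_generator_error_le (hh : h.IsHermitian) (hc : (kossakowski J D N).PosSemidef)
    (hω : ∀ X, localState β η N (lindblad N J D v h X) = 0) (hN : N ≠ 0)
    (hL : ∀ (k : Fin N) (j : Fin 8),
      lindblad N J D v h (siteOp k (chi j)) = ∑ p, (L j p : ℂ) • siteOp k (chi p))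
    {R V B : ℝ} (hR : ∀ k : Fin N, ∑ l, |couplings J N k l| ≤ R) (hV : ∀ μ, ‖v μ‖ ≤ V)
    {r : Fin 8 → ℝ} (hB : ‖obs (cvec r)‖ ≤ B) {E : LocalAlg N}
    (hE : E = lindblad N J D v h (localWeyl β η N r) -
      (∫ u in (0 : ℝ)..1, expI (fluctOp N (cvec r)) (1 - u) *
        (Complex.I • fluctOp N ((complexify L.transpose).mulVec (cvec r))) *
          expI (fluctOp N (cvec r)) u) -
      ((corr β η (cvec r) ((complexify L.transpose).mulVec (cvec r))).re : ℂ) •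
        localWeyl β η N r) :
    (localState β η N (E.conjTranspose * E)).re ≤
      (2 * (16 * V ^ 2 * B ^ 3 * R * ∑ μ, ∑ ν, ‖D μ ν‖) ^ 2 +
        4 * ((∑ μ, ∑ ν, ‖D μ ν‖) * (4 * V ^ 2 * B ^ 2)) ^ 2 * R ^ 2) / N := by
  have hstar := star_cvec r
  have hF : (fluctOp N (cvec r)).conjTranspose = fluctOp N (cvec r) := by
    rw [fluctOp_conjTranspose, hstar]
  obtain ⟨Γ, hΓ⟩ : ∃ Γ, Γ = ∑ p, ∑ q, kossakowski J D N p q •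
      (⁅noise v N p, fluctOp N (cvec r)⁆ * ⁅fluctOp N (cvec r), (noise v N q).conjTranspose⁆) :=
    ⟨_, rfl⟩
  have hm : localState β η N Γ =
      ((-2 * (corr β η (cvec r) ((complexify L.transpose).mulVec (cvec r))).re : ℝ) : ℂ) := by
    have := localState_carreDuChamp (β := β) (η := η) hh hc hω (fluctOp N (cvec r))
    rwa [hF, lindblad_fluctOp hL, localState_fluctOp_mul hN, hstar, ← hΓ] at this
  have hrem := norm_lindblad_exp_sub_le (D := D) (h := h) hR hV hstar hB
  have hvar := variance_carreDuChamp_le (β := β) (η := η) hR hV hB hΓ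
  rw [← hΓ, lindblad_fluctOp hL, ← localWeyl_eq_exp β η] at hrem
  set W := localWeyl β η N r with hW
  set I₁ := ∫ u in (0 : ℝ)..1, expI (fluctOp N (cvec r)) (1 - u) *
        (Complex.I • fluctOp N ((complexify L.transpose).mulVec (cvec r))) *
          expI (fluctOp N (cvec r)) u
  have hWW : W.conjTranspose * W = 1 :=
    mul_eq_one_comm.mp (localWeyl_mul_conjTranspose β η N r)
  -- The scalar Re (r, C ℒᵀ r) equals -½ ω(Γ). So E is the norm-small remainder minus ½ W(Γ - ω(Γ)),
  -- and the unitary W drops out of the L²-norm of the second term.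
  have e : E = (lindblad N J D v h W - I₁ + (1 / 2 : ℂ) • (W * Γ)) -
      (1 / 2 : ℂ) • (W * (Γ - localState β η N Γ • 1)) := by
    rw [hE, mul_sub, mul_smul_comm, mul_one, hm]
    push_cast
    module
  have e2 : ((1 / 2 : ℂ) • (W * (Γ - localState β η N Γ • 1))).conjTranspose *
      ((1 / 2 : ℂ) • (W * (Γ - localState β η N Γ • 1))) = (1 / 4 : ℂ) •
      ((Γ - localState β η N Γ • 1).conjTranspose * (Γ - localState β η N Γ • 1)) := by
    rw [Matrix.conjTranspose_smul, smul_mul_smul_comm, Matrix.conjTranspose_mul, mul_assoc,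
      ← mul_assoc W.conjTranspose, hWW, one_mul]
    congr 1
    norm_num
  rw [e]
  refine (localState_sub_conjTranspose_mul_le β η _ _).trans ?_
  rw [e2, localState_smul]
  have h1 := (localState_conjTranspose_mul_self_le β η
    (lindblad N J D v h W - I₁ + (1 / 2 : ℂ) • (W * Γ))).trans
      (pow_le_pow_left₀ (norm_nonneg _) hrem 2)
  have h2 : ((1 / 4 : ℂ) * localState β η N ((Γ - localState β η N Γ • 1).conjTranspose *
      (Γ - localState β η N Γ • 1))).re = 1 / 4 * (localState β η N
        ((Γ - localState β η N Γ • 1).conjTranspose * (Γ - localState β η N Γ • 1))).re := by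
    have : (1 / 4 : ℂ) = ((1 / 4 : ℝ) : ℂ) := by push_cast; rfl
    rw [this, Complex.re_ofReal_mul]
  rw [mul_pow, inv_pow, Real.sq_sqrt (Nat.cast_nonneg N), ← div_eq_mul_inv] at h1
  rw [h2]
  calc _ ≤ 2 * ((16 * V ^ 2 * B ^ 3 * R * ∑ μ, ∑ ν, ‖D μ ν‖) ^ 2 / N) + 2 * (1 / 4 *
      (8 * ((∑ μ, ∑ ν, ‖D μ ν‖) * (4 * V ^ 2 * B ^ 2)) ^ 2 * R ^ 2 / N)) := by gcongr
    _ = _ := by ring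

end Error

/-! ### Convergence to the quasi-free dynamics -/

section Limit

variable {d : ℕ} {J : ℕ → ℝ} {D : Matrix (Fin d) (Fin d) ℂ} {v : Fin d → SiteMat} {h : SiteMat}
  {β η : ℝ} {L : Matrix (Fin 8) (Fin 8) ℝ}

lemma cvec_evolved (L : Matrix (Fin 8) (Fin 8) ℝ) (τ : ℝ) (r : Fin 8 → ℝ) :
    cvec (evolved L τ r) = (complexify (NormedSpace.exp (τ • L.transpose))).mulVec (cvec r) :=
  (complexify_mulVec_cvec _ _).symm

lemma evolved_zero (L : Matrix (Fin 8) (Fin 8) ℝ) (r : Fin 8 → ℝ) : evolved L 0 r = r := by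
  simp [evolved]

lemma damping_zero (L : Matrix (Fin 8) (Fin 8) ℝ) (r : Fin 8 → ℝ) : damping β η L 0 r = 0 := by
  rw [damping_eq, evolved_zero, sub_self, mul_zero]

lemma corr_cvec_self_re (r : Fin 8 → ℝ) :
    (corr β η (cvec r) (cvec r)).re = form (covMat β η) r r := by
  rw [corr_cvec]
  simp

/-- Half the derivative of (r_τ, Σ r_τ): this is exactly the scalar subtracted in
`localState_generator_error_le`, so the damped Weyl operators solve the evolution equation up to
that error. -/
lemma hasDerivAt_damping (L : Matrix (Fin 8) (Fin 8) ℝ) (r : Fin 8 → ℝ) (τ : ℝ) :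
    HasDerivAt (fun τ => damping β η L τ r) (corr β η (cvec (evolved L τ r))
      ((complexify L.transpose).mulVec (cvec (evolved L τ r)))).re τ := by
  have h1 := hasDerivAt_corr_exp_mulVec (β := β) (η := η) L.transpose (cvec r) τ
  simp only [← cvec_evolved, corr_cvec_self_re] at h1
  simp only [damping_eq]
  refine ((h1.const_sub (form (covMat β η) r r)).const_mul (-(1 / 2))).congr_deriv ?_
  ring

lemma hasDerivAt_cvec_evolved (L : Matrix (Fin 8) (Fin 8) ℝ) (r : Fin 8 → ℝ) (τ : ℝ) :
    HasDerivAt (fun τ => cvec (evolved L τ r))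
      ((complexify L.transpose).mulVec (cvec (evolved L τ r))) τ := by
  simp only [cvec_evolved]
  exact hasDerivAt_complexify_exp_mulVec L.transpose (cvec r) τ

variable (β η) in
open scoped Matrix.Norms.L2Operator in
lemma hasDerivAt_localWeyl_evolved (N : ℕ) (L : Matrix (Fin 8) (Fin 8) ℝ) (r : Fin 8 → ℝ) (τ : ℝ) :
    HasDerivAt (fun τ => localWeyl β η N (evolved L τ r))
      (∫ u in (0 : ℝ)..1, expI (fluctOp N (cvec (evolved L τ r))) (1 - u) *
        (Complex.I • fluctOp N ((complexify L.transpose).mulVec (cvec (evolved L τ r)))) *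
          expI (fluctOp N (cvec (evolved L τ r))) u) τ := by
  simp only [localWeyl_eq_exp]
  refine hasDerivAt_exp_path (F := fun τ => fluctOp N (cvec (evolved L τ r))) ?_
  simp only [← sum_smul_fluct β η]
  exact HasDerivAt.fun_sum fun j _ =>
    (hasDerivAt_pi.mp (hasDerivAt_cvec_evolved L r τ) j).smul_const _

lemma damping_nonpos (hA : ∀ z, (corr β η z ((complexify L.transpose).mulVec z)).re ≤ 0) {τ : ℝ}
    (hτ : 0 ≤ τ) (r : Fin 8 → ℝ) : damping β η L τ r ≤ 0 := by
  have h1 := corrContraction_exp hA hτ (cvec r)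
  rw [← cvec_evolved, corr_cvec_self_re, corr_cvec_self_re] at h1
  rw [damping_eq]
  linarith

open scoped Matrix.Norms.L2Operator in
/-- Matrix elements of the evolved local Weyl operators between Weyl operators converge. -/
lemma tendsto_localState_semigroupOf_localWeyl (hh : h.IsHermitian) (hD : D.PosSemidef)
    (hJ : ∀ N : ℕ, (couplings J N).PosSemidef)
    (hJsum : ∃ R : ℝ, ∀ N (k : Fin N), ∑ l, |couplings J N k l| ≤ R)
    (hω : ∀ (N : ℕ) X, localState β η N (lindblad N J D v h X) = 0)
    (hL : ∀ (N : ℕ) (k : Fin N) (j : Fin 8),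
      lindblad N J D v h (siteOp k (chi j)) = ∑ p, (L j p : ℂ) • siteOp k (chi p))
    {t : ℝ} (ht : 0 ≤ t) (a b r : Fin 8 → ℝ) :
    Filter.Tendsto (fun N : ℕ => localState β η N (localWeyl β η N a *
        semigroupOf (lindblad N J D v h) t (localWeyl β η N r) * localWeyl β η N b))
      Filter.atTop (𝓝 (Real.exp (damping β η L t r) *
        mesoState β η (weylOp β η a * weylOp β η (evolved L t r) * weylOp β η b))) := by
  obtain ⟨R, hR⟩ := hJsum
  obtain ⟨K, hK0, hK⟩ := exists_norm_localState_localWeyl_le β η a b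
  have hc : ∀ N, (kossakowski J D N).PosSemidef := fun N => kossakowski_posSemidef hD (hJ N)
  have hA : ∀ z, (corr β η z ((complexify L.transpose).mulVec z)).re ≤ 0 :=
    corr_dissipative hh (hc 1) (hω 1) one_ne_zero (hL 1)
  obtain ⟨B, hB⟩ : ∃ B, ∀ τ ∈ Set.Icc 0 t, ‖obs (cvec (evolved L τ r))‖ ≤ B := by
    refine isCompact_Icc.exists_bound_of_continuousOn (Continuous.continuousOn ?_)
    have hcont : Continuous fun τ => cvec (evolved L τ r) :=
      continuous_iff_continuousAt.mpr fun τ => (hasDerivAt_cvec_evolved L r τ).continuousAt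
    simp only [obs]
    exact continuous_finsetSum _ fun j _ =>
      ((continuous_apply j).comp hcont).smul continuous_const
  have hV : ∀ μ, ‖v μ‖ ≤ ∑ μ, ‖v μ‖ := fun μ =>
    Finset.single_le_sum (f := fun μ => ‖v μ‖) (fun _ _ => norm_nonneg _) (Finset.mem_univ μ)
  set V := ∑ μ, ‖v μ‖
  set C := 2 * (16 * V ^ 2 * B ^ 3 * R * ∑ μ, ∑ ν, ‖D μ ν‖) ^ 2 +
        4 * ((∑ μ, ∑ ν, ‖D μ ν‖) * (4 * V ^ 2 * B ^ 2)) ^ 2 * R ^ 2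
  have hdiff : ∀ N : ℕ, N ≠ 0 → ‖localState β η N (localWeyl β η N a *
      semigroupOf (lindblad N J D v h) t (localWeyl β η N r) * localWeyl β η N b) -
      Real.exp (damping β η L t r) * localState β η N (localWeyl β η N a *
        localWeyl β η N (evolved L t r) * localWeyl β η N b)‖ ≤ √(K * (C / N)) * t := fun N hN => by
    set 𝓛 := lindblad N J D v h with h𝓛
    set D₁ : ℝ → LocalAlg N := fun τ => ∫ u in (0 : ℝ)..1,
      expI (fluctOp N (cvec (evolved L τ r))) (1 - u) *
        (Complex.I • fluctOp N ((complexify L.transpose).mulVec (cvec (evolved L τ r)))) *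
          expI (fluctOp N (cvec (evolved L τ r))) u
    set δ : ℝ → ℝ := fun τ => (corr β η (cvec (evolved L τ r))
      ((complexify L.transpose).mulVec (cvec (evolved L τ r)))).re
    -- The defect of the quasi-free evolution: applying 𝓛 to m(τ) W_N(r_τ) and subtracting its
    -- τ-derivative gives m(τ) E(τ).
    set E : ℝ → LocalAlg N := fun τ => 𝓛 (localWeyl β η N (evolved L τ r)) - D₁ τ -
      (δ τ : ℂ) • localWeyl β η N (evolved L τ r)
    set m : ℝ → ℂ := fun τ => (Real.exp (damping β η L τ r) : ℂ)
    have hsub : ∀ s : ℝ, HasDerivAt (fun s => t - s) (-1) s := fun s => by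
      simpa using (hasDerivAt_id' s).const_sub t
    have hm : ∀ s, HasDerivAt (fun s => m (t - s)) (-(m (t - s) * δ (t - s))) s := fun s => by
      have h1 := ((hasDerivAt_damping (β := β) (η := η) L r (t - s)).exp.comp s (hsub s)).ofReal_comp
      refine h1.congr_deriv ?_
      simp only [m, δ]
      push_cast
      ring
    have hZ : ∀ s, HasDerivAt (fun s => m (t - s) • localWeyl β η N (evolved L (t - s) r))
        (-(m (t - s) • (D₁ (t - s) + (δ (t - s) : ℂ) • localWeyl β η N (evolved L (t - s) r)))) s :=
      fun s => by
        have h1 := (hasDerivAt_localWeyl_evolved β η N L r (t - s)).scomp s (hsub s)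
        refine ((hm s).smul h1).congr_deriv ?_
        simp only [Function.comp_apply, D₁]
        module
    let T : LocalAlg N →L[ℝ] ℂ := ((localStateCLM β η N).comp
      ((ContinuousLinearMap.mul ℂ (LocalAlg N)).flip (localWeyl β η N b) ∘L
        ContinuousLinearMap.mul ℂ (LocalAlg N) (localWeyl β η N a))).restrictScalars ℝ
    -- The interpolation starts at the quasi-free evolution for s = 0 and ends at Φ^N_t[W_N(r)] for
    -- s = t; its derivative is the evolved defect.
    have hg : ∀ s, HasDerivAt (fun s => localState β η N (localWeyl β η N a *
        semigroupOf 𝓛 s (m (t - s) • localWeyl β η N (evolved L (t - s) r)) * localWeyl β η N b))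
        (localState β η N (localWeyl β η N a * semigroupOf 𝓛 s (m (t - s) • E (t - s)) *
          localWeyl β η N b)) s := fun s => by
      have h1 := T.hasFDerivAt.comp_hasDerivAt s (hasDerivAt_semigroupOf_path 𝓛 (hZ s))
      refine h1.congr_deriv ?_
      have e : 𝓛 (m (t - s) • localWeyl β η N (evolved L (t - s) r)) +
          -(m (t - s) • (D₁ (t - s) + (δ (t - s) : ℂ) • localWeyl β η N (evolved L (t - s) r))) =
          m (t - s) • E (t - s) := by
        rw [map_smul]
        simp only [E]
        module
      rw [e]
      rfl
    -- The matrix element is bounded by the L²-norm, the semigroup contracts that norm, the damping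
    -- factor is at most 1, and the defect has squared norm at most C/N.
    have hbound : ∀ s ∈ Set.Ico (0 : ℝ) t, ‖localState β η N (localWeyl β η N a *
        semigroupOf 𝓛 s (m (t - s) • E (t - s)) * localWeyl β η N b)‖ ≤ √(K * (C / N)) :=
      fun s hs => by
        have hts : 0 ≤ t - s := sub_nonneg.mpr hs.2.le
        refine Real.le_sqrt_of_sq_le ((hK N _).trans (mul_le_mul_of_nonneg_left ?_ hK0))
        refine (localState_semigroupOf_le 𝓛 (lindblad_dissipative hh (hc N) (hω N)) _ hs.1).trans ?_
        have hE := localState_generator_error_le β η hh (hc N) (hω N) hN (hL N) (hR N) hV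
          (hB (t - s) ⟨hts, sub_le_self _ hs.1⟩) (E := E (t - s)) rfl
        have hE0 := (Complex.nonneg_iff.mp (localState_nonneg β η (E (t - s)))).1
        have hm1 : Real.exp (damping β η L (t - s) r) ≤ 1 :=
          Real.exp_le_one_iff.mpr (damping_nonpos hA hts r)
        have e : localState β η N ((m (t - s) • E (t - s)).conjTranspose * (m (t - s) • E (t - s))) =
            ((Real.exp (damping β η L (t - s) r) * Real.exp (damping β η L (t - s) r) : ℝ) : ℂ) *
              localState β η N ((E (t - s)).conjTranspose * E (t - s)) := by
          rw [Matrix.conjTranspose_smul, smul_mul_smul_comm, localState_smul, Complex.ofReal_mul]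
          simp only [m, Complex.star_def, Complex.conj_ofReal]
        rw [e, Complex.re_ofReal_mul]
        refine le_trans (mul_le_of_le_one_left hE0 ?_) hE
        exact mul_le_one₀ hm1 (Real.exp_pos _).le hm1
    have key := norm_image_sub_le_of_norm_deriv_le_segment'
      (fun s _ => (hg s).hasDerivWithinAt) hbound t ⟨ht, le_rfl⟩
    simp only [sub_self, sub_zero, semigroupOf_zero, evolved_zero, m, damping_zero, Real.exp_zero,
      Complex.ofReal_one, one_smul, mul_smul_comm, smul_mul_assoc, localState_smul] at key
    exact key
  have hlim0 : Filter.Tendsto (fun N : ℕ => √(K * (C / N)) * t) Filter.atTop (𝓝 0) := by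
    have h1 := (((tendsto_const_div_atTop_nhds_zero_nat C).const_mul K).sqrt).mul_const t
    simpa using h1
  have hlim1 := squeeze_zero_norm' ((Filter.eventually_ne_atTop 0).mono hdiff) hlim0
  have hlim2 := (tendsto_localState_localWeyl β η a (evolved L t r) b).const_mul
    (Real.exp (damping β η L t r) : ℂ)
  have := hlim1.add hlim2
  rw [zero_add] at this
  exact this.congr fun N => by ring

end Limit

end SpinFluct

end

/-! ### The limiting semigroup and its properties -/

open SpinFluct in
theorem theorem2 (β η : ℝ)
    -- data of the local Lindblad generators
    (d : ℕ) (J : ℕ → ℝ) (D : Matrix (Fin d) (Fin d) ℂ) (v : Fin d → SiteMat) (h : SiteMat)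
    (hh : h.IsHermitian) (hD : D.PosSemidef)
    (hJ0 : 0 < J 0) (hJ : ∀ N : ℕ, (couplings J N).PosSemidef)
    (hJsum : ∃ c : ℝ, Filter.Tendsto
      (fun N : ℕ => (1 / (N : ℝ)) * ∑ k : Fin N, ∑ l : Fin N, |couplings J N k l|)
      Filter.atTop (𝓝 c))
    -- the thermal state is invariant under the local semigroups
    (hinv : ∀ (N : ℕ) (t : ℝ), 0 ≤ t → ∀ X : LocalAlg N,
      localState β η N (semigroupOf (lindblad N J D v h) t X) = localState β η N X)
    -- the generators map the span of the selected observables into itself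
    (L : Matrix (Fin 8) (Fin 8) ℝ)
    (hL : ∀ (N : ℕ) (k : Fin N) (j : Fin 8),
      lindblad N J D v h (siteOp k (chi j)) = ∑ p, (L j p : ℂ) • siteOp k (chi p)) :
    ∃ Φ : NNReal → (fluctAlg β η →ₗ[ℂ] fluctAlg β η),
      -- a semigroup of completely positive unital maps
      Φ 0 = LinearMap.id ∧
      (∀ s t : NNReal, Φ (s + t) = Φ s ∘ₗ Φ t) ∧
      (∀ t : NNReal, IsCompletelyPositive (Φ t)) ∧
      (∀ t : NNReal, Φ t (weylOne β η) = weylOne β η) ∧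
      -- the maps are quasi-free
      (∀ (t : NNReal) (r : Fin 8 → ℝ),
        Φ t (weyl β η r) = (Real.exp (damping β η L t r) : ℂ) • weyl β η (evolved L t r)) ∧
      -- the mesoscopic state is invariant
      (∀ (t : NNReal) (X : fluctAlg β η), mesoState β η (Φ t X) = mesoState β η X) ∧
      -- convergence of the matrix elements
      (∀ (t : NNReal) (a b r : Fin 8 → ℝ), Filter.Tendsto
        (fun N : ℕ => localState β η N (localWeyl β η N a *
          semigroupOf (lindblad N J D v h) t (localWeyl β η N r) * localWeyl β η N b))
        Filter.atTop
        (𝓝 (mesoState β η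
          (weylOp β η a * (Φ t (weyl β η r) : GNS β η →L[ℂ] GNS β η) * weylOp β η b)))) := by
  have hω : ∀ (N : ℕ) X, localState β η N (lindblad N J D v h X) = 0 := fun N =>
    localState_generator_eq_zero _ (hinv N)
  -- The matrix ℒ does not depend on N, so the chain with a single site already yields the
  -- inequality.
  have hA : ∀ z, (corr β η z ((complexify L.transpose).mulVec z)).re ≤ 0 :=
    corr_dissipative hh (kossakowski_posSemidef hD (hJ 1)) (hω 1) one_ne_zero (hL 1)
  have hM : ∀ t : NNReal, CorrContraction β η (NormedSpace.exp ((t : ℝ) • L.transpose)) := fun t =>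
    corrContraction_exp hA t.2
  have hweyl : ∀ (t : NNReal) (r : Fin 8 → ℝ), (hM t).fluctMap (weyl β η r) =
      (Real.exp (damping β η L t r) : ℂ) • weyl β η (evolved L t r) := fun t r => by
    refine Subtype.ext ?_
    rw [CorrContraction.coe_fluctMap]
    refine ((hM t).map_weylOp r).trans ?_
    rw [damping_eq, Complex.ofReal_exp]
    rfl
  refine ⟨fun t => (hM t).fluctMap, ?_, fun s t => ?_, fun t => (hM t).isCompletelyPositive,
    fun t => ?_, hweyl, fun t X => (hM t).mesoState_map X, fun t a b r => ?_⟩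
  · refine LinearMap.ext fun X => Subtype.ext ((hM 0).map_one (by simp) _)
  · refine LinearMap.ext fun X => Subtype.ext ((hM s).map_map (hM t) (hM (s + t)) ?_ _)
    rw [NNReal.coe_add, add_smul, Matrix.exp_add_of_commute]
    exact ((Commute.refl L.transpose).smul_left _).smul_right _
  -- Unitality is the quasi-free formula at r = 0.
  · have h0 : weyl β η 0 = weylOne β η := Subtype.ext (weylOp_zero β η)
    have h1 := hweyl t 0
    have h2 : evolved L t 0 = 0 := by simp [evolved]
    have h3 : damping β η L t 0 = 0 := by rw [damping_eq, h2, sub_self, mul_zero]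
    rw [h2, h3, h0] at h1
    simpa using h1
  · obtain ⟨R, -, hR⟩ := exists_couplings_row_le hJsum
    have hlim := tendsto_localState_semigroupOf_localWeyl (L := L) hh hD hJ ⟨R, hR⟩ hω hL t.2 a b r
    rw [hweyl]
    have e : mesoState β η (weylOp β η a * (((Real.exp (damping β η L t r) : ℂ) •
        weyl β η (evolved L t r) : fluctAlg β η) : GNS β η →L[ℂ] GNS β η) * weylOp β η b) =
        Real.exp (damping β η L t r) *
          mesoState β η (weylOp β η a * weylOp β η (evolved L t r) * weylOp β η b) := by
      rw [Submodule.coe_smul, mul_smul_comm, smul_mul_assoc, mesoState, FunLike.coe_smul,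
        Pi.smul_apply, inner_smul_right]
      rfl
    rw [e]
    exact hlim
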